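/- Consider, for $u=(u_1,u_2)$ with $u_j=u_j(t,x)\in\mathbb C$, $x\in\mathbb R$, the system $$ i\partial_t u_1+\tfrac12\partial_x^2u_1=-i|u_2|^2u_1,\qquad i\partial_t u_2+\tfrac12\partial_x^2u_2=-i|u_1|^2u_2. \tag{1}$$ Let $U(t)=\exp(\tfrac{it}{2}\partial_x^2)$, $J(t)=x+it\partial_x=U(t)\,x\,U(-t)$, $\langle x\rangle=\sqrt{1+x^2}$, $H^{0,s}=\{\phi\in L^2(\mathbb R):\langle x\rangle^s\phi\in L^2\}$ and $\hat\phi(\xi)=(2\pi)^{-1/2}\int e^{-iy\xi}\phi(y)\,dy$. Let $s>1$ and $0<\mu<(\min\{2,s\}-1)/2$. There is $\delta_0>0$, depending only on $s$ and $\mu$, such that the following holds. Let $\psi^+=(\psi_1^+,\psi_2^+)$ satisfy $\psi_j^+\in H^{0,s}$, $\hat\psi_j^+\in L^\infty$ and $\|\hat\psi_j^+\|_{L^\infty}\le\delta_0$ for $j=1,2$, and suppose $\hat\psi_1^+\hat\psi_2^+=0$ almost everywhere. Then there are $T\ge1$ and a solution $u$ of (1) for $t\ge T$ (in the sense of tempered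 distributions in $x$ for each $t\geq T$) such that, for $j=1,2$, * $U(-t)u_j\in C([T,\infty);H^{0,1})$, * $\|u_j(t)-U(t)\psi_j^+\|_{L^2}\to0$ as $t\to+\infty$, * $\sup_{t\ge T}\bigl(t^{\mu+1/2}\|u_j(t)-U(t)\psi_j^+\|_{L^2}+t^{\mu}\|J(t)(u_j(t)-U(t)\psi_j^+)\|_{L^2}\bigr)<\infty$, and $u$ is the only solution of (1) for $t\ge T$ with these three properties. -/

import Mathlib

open MeasureTheory Filter Set
open scoped Topology ENNReal NNReal FourierTransform SchwartzMap

noncomputable section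

namespace NLSFinal

/-- The space `L²(ℝ; ℂ)`. -/
abbrev L2 : Type := Lp ℂ 2 (volume : Measure ℝ)

/-- The multiplier of `U(t) = exp(i (t/2) ∂ₓ²)` in the variable of Mathlib's Fourier transform
`∫ exp(-2 π i x ξ) φ(x) dx`, in which `∂ₓ` is multiplication by `2 π i ξ`. -/
def freeSymbol (t ξ : ℝ) : ℂ := Complex.exp (((-(2 * Real.pi ^ 2 * t * ξ ^ 2) : ℝ) : ℂ) * Complex.I)

theorem norm_freeSymbol (t ξ : ℝ) : ‖freeSymbol t ξ‖ = 1 :=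
  Complex.norm_exp_ofReal_mul_I _

theorem continuous_freeSymbol (t : ℝ) : Continuous (freeSymbol t) := by
  unfold freeSymbol; fun_prop

theorem memLp_freeSymbol_mul (t : ℝ) (g : L2) :
    MemLp (fun ξ => freeSymbol t ξ * g ξ) 2 volume := by
  refine (Lp.memLp g).of_le
    ((continuous_freeSymbol t).aestronglyMeasurable.mul (Lp.aestronglyMeasurable g)) ?_
  exact Eventually.of_forall fun ξ => by rw [norm_mul, norm_freeSymbol, one_mul]

/-- The free Schrödinger group `U(t) = exp(i (t/2) ∂ₓ²)` on `L²(ℝ)`. -/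
def U (t : ℝ) (φ : L2) : L2 := 𝓕⁻ (MemLp.toLp _ (memLp_freeSymbol_mul t (𝓕 φ)))

/-- The Fourier transform with the normalization
`φ̂(ξ) = (2π)^(-1/2) ∫ exp(-i y ξ) φ(y) dy`, extended to `L²`. -/
def hat (φ : L2) (ξ : ℝ) : ℂ := (((Real.sqrt (2 * Real.pi))⁻¹ : ℝ) : ℂ) * (𝓕 φ : L2) (ξ / (2 * Real.pi))

/-- The function `⟨x⟩^s φ(x)`, where `⟨x⟩ = √(1 + x²)`. -/
def weight (s : ℝ) (φ : L2) (x : ℝ) : ℂ := ((Real.sqrt (1 + x ^ 2) ^ s : ℝ) : ℂ) * φ x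

/-- Membership in the weighted space `H^{0,s} = {φ ∈ L² | ⟨x⟩^s φ ∈ L²}`. -/
def MemH0 (s : ℝ) (φ : L2) : Prop := MemLp (weight s φ) 2 volume

/-- The norm of `H^{0,s}`, with value `∞` off that space. -/
def normH0 (s : ℝ) (φ : L2) : ℝ≥0∞ := eLpNorm (weight s φ) 2 volume

/-- `f ∈ C([T,∞); H^{0,s})`. -/
def ContH0 (s T : ℝ) (f : ℝ → L2) : Prop :=
  (∀ t, T ≤ t → MemH0 s (f t)) ∧
  ∀ t, T ≤ t → Tendsto (fun τ => normH0 s (f τ - f t)) (𝓝[Ici T] t) (𝓝 0)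

/-- The norm `‖J(t) g‖_{L²}` of `J(t) = x + i t ∂ₓ = U(t) x U(-t)`; as `U(t)` is unitary, it is
`‖x U(-t) g‖_{L²}` (with value `∞` when `x U(-t) g` is not in `L²`). -/
def normJ (t : ℝ) (g : L2) : ℝ≥0∞ := eLpNorm (fun x : ℝ => (x : ℂ) * U (-t) g x) 2 volume

/-- The nonlinearity `|u_k|² u_j`, `k ≠ j`, of the `j`-th equation. -/
def N (v : Fin 2 → L2) (j : Fin 2) (x : ℝ) : ℂ := ((‖v (1 - j) x‖ ^ 2 : ℝ) : ℂ) * v j x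

/-- `u` solves `i ∂ₜ u_j + (1/2) ∂ₓ² u_j = -i |u_k|² u_j` (`k ≠ j`) for `t ≥ T`, the equation
being read in the sense of tempered distributions in `x` for every `t ≥ T`
(with the one-sided time derivative at `t = T`). -/
def IsSolution (T : ℝ) (u : Fin 2 → ℝ → L2) : Prop :=
  ∀ (j : Fin 2) (φ : 𝓢(ℝ, ℂ)) (t : ℝ), T ≤ t →
    Integrable (fun x => N (fun k => u k t) j x * φ x) ∧
    ∃ d : ℂ, HasDerivWithinAt (fun τ => ∫ x, u j τ x * φ x) d (Ici T) t ∧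
      Complex.I * d + (1 / 2) * ∫ x, u j t x * deriv (deriv φ) x =
        -Complex.I * ∫ x, N (fun k => u k t) j x * φ x

/-- `sup_{t ≥ T} (t^(μ+1/2) ‖g_j(t)‖_{L²} + t^μ ‖J(t) g_j(t)‖_{L²}) < ∞` for `j = 1, 2`. -/
def FiniteX (μ T : ℝ) (g : Fin 2 → ℝ → L2) : Prop :=
  ∃ C : ℝ≥0, ∀ (j : Fin 2) (t : ℝ), T ≤ t →
    ENNReal.ofReal (t ^ (μ + 1 / 2) * ‖g j t‖) + ENNReal.ofReal (t ^ μ) * normJ t (g j t) ≤ C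

/-- `u` solves the system for `t ≥ T`, `U(-t) u ∈ C([T,∞); H^{0,1})`, `u` scatters to the final
state `ψ`, and `u - U(t) ψ` has a finite weighted time-decay norm of exponent `μ`. -/
structure IsFinalStateSolution (μ T : ℝ) (ψ : Fin 2 → L2) (u : Fin 2 → ℝ → L2) : Prop where
  solution : IsSolution T u
  cont : ∀ j, ContH0 1 T (fun t => U (-t) (u j t))
  scattering : ∀ j, Tendsto (fun t => ‖u j t - U t (ψ j)‖) atTop (𝓝 0)
  decay : FiniteX μ T (fun j t => u j t - U t (ψ j))

end NLSFinal

end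

noncomputable section

namespace NLSFinal

/-! ### Multiplication by phases -/

/-! Let `f_j = U(-t) u_j` be the profiles and `M(t)` multiplication by `exp(i x²/(2t))`. The
factorization of `U(t)` into `M(t)`, the Fourier transform, a dilation and `M(t)` again
(`U_factorization`) turns the system into `∂ₜ f_j = -G t f_k f_j`. Here `G` is `(2πt)⁻¹` times the
product `|E f_k|² E f_j`, with `E t = 𝓕 M(t)`, pulled back by an isometry (`N_U_ae_eq`).

The factor `1/t` is not integrable, so the source must decay further. Write `f_j = ψ_j + r_j`, so
that `E f_j = 𝓕 ψ_j + z_j` with `z_j` made of `(M(t) - 1) ψ_j` and `M(t) r_j`. Since `𝓕 ψ_1 · 𝓕 ψ_2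
= 0`, the product contains no term free of remainders (`cub_eq_of_mul_eq_zero`). The hypothesis `ψ_j
∈ H^{0,s}` gives `(M(t) - 1) ψ_j` size `t^(-(μ+1/2))` in `L²` and `t^(-μ)` with the weight `x`
(`exists_chirp_bound`), the same rates as those asked of `r_j`. Hence `f_j = ψ_j + ∫_t^∞ G` can be
solved by contraction on a ball with these rates, for small `‖𝓕 ψ_j‖_∞` and large `T` (`Datum.rate`,
`exists_fixed`).

The weight `x` is handled through modulations: `‖x f‖ < ∞` is a Lipschitz bound on `h ↦ exp(2πihx)
f` (`LipW`), which on the Fourier side is a Lipschitz bound for translations. This survives limits,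
isometries and integrals, and obeys a discrete Leibniz rule for the cubic product
(`lipT_cub_of_mul_eq_zero`). Where the difference does not fall on a remainder, the remainder is
measured in `L^∞`; interpolation gives it `t^(-(μ+1/4))`, and the spare `t^(-1/4)` is made small by
taking `T` large.

For uniqueness, any competing solution has a profile that is differentiable in `L²`
(`hasDerivWithinAt_of_isSolution`) and stays in a ball with the same rates but an uncontrolled
radius. The squared `L²` distance `D` of two profiles satisfies `D' ≥ -t⁻¹ (2μ + B t^(-1/2)) D`,
while `D = O(t^(-2μ-1))`; a Gronwall argument from infinity forces `D = 0` (`profile_unique`). -/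

theorem memLp_phase_mul (θ : C(ℝ, ℝ)) (f : L2) :
    MemLp (fun x => Complex.exp ((θ x : ℂ) * Complex.I) * f x) 2 volume := by
  refine (Lp.memLp f).of_le (AEStronglyMeasurable.mul ?_ (Lp.aestronglyMeasurable f)) ?_
  · exact Continuous.aestronglyMeasurable (by fun_prop)
  · exact Eventually.of_forall fun x => by
      rw [norm_mul, Complex.norm_exp_ofReal_mul_I, one_mul]

/-- Multiplication by `exp(i θ(x))` as a linear isometry of `L²`. -/
def phase (θ : C(ℝ, ℝ)) : L2 →ₗᵢ[ℂ] L2 where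
  toFun f := MemLp.toLp _ (memLp_phase_mul θ f)
  map_add' f g := by
    apply Lp.ext
    filter_upwards [MemLp.coeFn_toLp (memLp_phase_mul θ (f + g)),
      MemLp.coeFn_toLp (memLp_phase_mul θ f), MemLp.coeFn_toLp (memLp_phase_mul θ g),
      Lp.coeFn_add f g, Lp.coeFn_add (MemLp.toLp _ (memLp_phase_mul θ f))
        (MemLp.toLp _ (memLp_phase_mul θ g))] with x h1 h2 h3 h4 h5
    rw [h1, h5, Pi.add_apply, h2, h3, h4, Pi.add_apply, mul_add]
  map_smul' c f := by
    apply Lp.ext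
    filter_upwards [MemLp.coeFn_toLp (memLp_phase_mul θ (c • f)),
      MemLp.coeFn_toLp (memLp_phase_mul θ f),
      Lp.coeFn_smul c f, Lp.coeFn_smul c (MemLp.toLp _ (memLp_phase_mul θ f))]
      with x h1 h2 h3 h4
    simp only [RingHom.id_apply]
    rw [h1, h4, Pi.smul_apply, h2, h3, Pi.smul_apply, smul_eq_mul, smul_eq_mul]
    ring
  norm_map' f := by
    simp only [LinearMap.coe_mk, AddHom.coe_mk]
    rw [Lp.norm_toLp, Lp.norm_def]
    congr 1
    apply eLpNorm_congr_norm_ae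
    exact Eventually.of_forall fun x => by
      rw [norm_mul, Complex.norm_exp_ofReal_mul_I, one_mul]

theorem coeFn_phase (θ : C(ℝ, ℝ)) (f : L2) :
    phase θ f =ᵐ[volume] fun x => Complex.exp ((θ x : ℂ) * Complex.I) * f x :=
  MemLp.coeFn_toLp (memLp_phase_mul θ f)

theorem phase_phase (θ η : C(ℝ, ℝ)) (f : L2) : phase θ (phase η f) = phase (θ + η) f := by
  apply Lp.ext
  filter_upwards [coeFn_phase θ (phase η f), coeFn_phase η f, coeFn_phase (θ + η) f]
    with x h1 h2 h3
  rw [h1, h2, h3, ← mul_assoc, ← Complex.exp_add, ContinuousMap.add_apply, Complex.ofReal_add,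
    add_mul]

theorem phase_zero (f : L2) : phase 0 f = f := by
  apply Lp.ext
  filter_upwards [coeFn_phase 0 f] with x h1
  simp [h1]

theorem phase_neg_phase (θ : C(ℝ, ℝ)) (f : L2) : phase (-θ) (phase θ f) = f := by
  rw [phase_phase, neg_add_cancel, phase_zero]

theorem phase_phase_neg (θ : C(ℝ, ℝ)) (f : L2) : phase θ (phase (-θ) f) = f := by
  rw [phase_phase, add_neg_cancel, phase_zero]

theorem phase_comm (θ η : C(ℝ, ℝ)) (f : L2) : phase θ (phase η f) = phase η (phase θ f) := by
  rw [phase_phase, phase_phase, add_comm]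

theorem norm_sq_eq_integral (f : L2) : ‖f‖ ^ 2 = ∫ x, ‖f x‖ ^ 2 := by
  have h := @inner_self_eq_norm_sq ℂ L2 _ _ _ f
  rw [← h, L2.inner_def, ← integral_re (L2.integrable_inner f f)]
  congr 1
  ext x
  rw [inner_self_eq_norm_sq]

/-- Dominated convergence to zero in `L²`. -/
theorem tendsto_zero_of_dominated {ι : Type*} {l : Filter ι} [l.IsCountablyGenerated]
    {F : ι → L2} {k : ι → ℝ → ℂ} {b : ℝ → ℝ} (hF : ∀ i, F i =ᵐ[volume] k i)
    (hb : MemLp b 2 volume) (hbound : ∀ᶠ i in l, ∀ᵐ x, ‖k i x‖ ≤ b x)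
    (hlim : ∀ᵐ x, Tendsto (fun i => k i x) l (𝓝 0)) : Tendsto F l (𝓝 0) := by
  have h1 : Tendsto (fun i => ∫ x, ‖k i x‖ ^ 2) l (𝓝 (∫ _ : ℝ, (0 : ℝ))) := by
    refine tendsto_integral_filter_of_dominated_convergence (fun x => b x ^ 2) ?_ ?_
      hb.integrable_sq ?_
    · refine Eventually.of_forall fun i => ?_
      exact ((Lp.aestronglyMeasurable (F i)).congr (hF i)).norm.pow 2
    · filter_upwards [hbound] with i hi
      filter_upwards [hi] with x hx
      rw [Real.norm_of_nonneg (by positivity)]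
      exact pow_le_pow_left₀ (norm_nonneg _) hx 2
    · filter_upwards [hlim] with x hx
      simpa using (hx.norm.pow 2)
  rw [integral_zero] at h1
  have h2 : (fun i => ‖F i‖ ^ 2) = fun i => ∫ x, ‖k i x‖ ^ 2 := by
    ext i
    rw [norm_sq_eq_integral]
    apply integral_congr_ae
    filter_upwards [hF i] with x hx
    rw [hx]
  rw [← h2] at h1
  rw [tendsto_zero_iff_norm_tendsto_zero]
  have h3 := h1.sqrt
  simpa [Real.sqrt_sq (norm_nonneg _)] using h3

theorem tendsto_phase {ι : Type*} {l : Filter ι} [l.IsCountablyGenerated]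
    {θ : ι → C(ℝ, ℝ)} {θ₀ : C(ℝ, ℝ)} (h : ∀ x, Tendsto (fun i => θ i x) l (𝓝 (θ₀ x))) (f : L2) :
    Tendsto (fun i => phase (θ i) f) l (𝓝 (phase θ₀ f)) := by
  rw [← tendsto_sub_nhds_zero_iff]
  refine tendsto_zero_of_dominated (k := fun i x => Complex.exp ((θ i x : ℂ) * Complex.I) * f x -
    Complex.exp ((θ₀ x : ℂ) * Complex.I) * f x) (b := fun x => 2 * ‖f x‖) ?_ ?_ ?_ ?_
  · intro i
    filter_upwards [Lp.coeFn_sub (phase (θ i) f) (phase θ₀ f), coeFn_phase (θ i) f,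
      coeFn_phase θ₀ f] with x h1 h2 h3
    rw [h1, Pi.sub_apply, h2, h3]
  · exact (Lp.memLp f).norm.const_mul 2
  · refine Eventually.of_forall fun i => Eventually.of_forall fun x => ?_
    refine (norm_sub_le _ _).trans ?_
    rw [norm_mul, norm_mul, Complex.norm_exp_ofReal_mul_I, Complex.norm_exp_ofReal_mul_I]
    linarith
  · refine Eventually.of_forall fun x => ?_
    have h2 : Tendsto (fun i => Complex.exp ((θ i x : ℂ) * Complex.I) * f x) l
        (𝓝 (Complex.exp ((θ₀ x : ℂ) * Complex.I) * f x)) := by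
      have hc : Continuous fun y : ℝ => Complex.exp ((y : ℂ) * Complex.I) * f x := by fun_prop
      exact (hc.tendsto _).comp (h x)
    simpa using h2.sub_const (Complex.exp ((θ₀ x : ℂ) * Complex.I) * f x)

theorem tendsto_phase_apply {ι : Type*} {l : Filter ι} [l.IsCountablyGenerated]
    {θ : ι → C(ℝ, ℝ)} {θ₀ : C(ℝ, ℝ)} (h : ∀ x, Tendsto (fun i => θ i x) l (𝓝 (θ₀ x)))
    {f : ι → L2} {f₀ : L2} (hf : Tendsto f l (𝓝 f₀)) :
    Tendsto (fun i => phase (θ i) (f i)) l (𝓝 (phase θ₀ f₀)) := by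
  have h1 : Tendsto (fun i => phase (θ i) (f i - f₀)) l (𝓝 0) := by
    rw [tendsto_zero_iff_norm_tendsto_zero]
    simp only [LinearIsometry.norm_map]
    rw [← tendsto_zero_iff_norm_tendsto_zero]
    simpa using hf.sub_const f₀
  have h2 := h1.add (tendsto_phase h f₀)
  simpa using h2

/-! ### The Fourier transform on `L²` -/

theorem integral_mul_fourier (f : L2) (φ : 𝓢(ℝ, ℂ)) :
    ∫ x, φ x * (𝓕 f : L2) x = ∫ x, (𝓕 φ) x * f x := by
  have h := DFunLike.congr_fun (Lp.fourier_toTemperedDistribution_eq f) φ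
  rw [TemperedDistribution.fourier_apply, Lp.toTemperedDistribution_apply,
    Lp.toTemperedDistribution_apply] at h
  simpa using h.symm

theorem integral_mul_fourierInv (f : L2) (φ : 𝓢(ℝ, ℂ)) :
    ∫ x, φ x * (𝓕⁻ f : L2) x = ∫ x, (𝓕⁻ φ) x * f x := by
  have h := DFunLike.congr_fun (Lp.fourierInv_toTemperedDistribution_eq f) φ
  rw [TemperedDistribution.fourierInv_apply, Lp.toTemperedDistribution_apply,
    Lp.toTemperedDistribution_apply] at h
  simpa using h.symm

theorem locallyIntegrable_L2 (f : L2) : LocallyIntegrable f volume :=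
  (Lp.memLp f).locallyIntegrable (by norm_num)

theorem integral_fourier_mul_eq_flip {f g : ℝ → ℂ} (hf : Integrable f) (hg : Integrable g) :
    ∫ x, 𝓕 f x * g x = ∫ x, f x * 𝓕 g x := by
  have h := VectorFourier.integral_fourierIntegral_smul_eq_flip (L := innerₗ ℝ)
    (μ := volume) (ν := volume) Real.continuous_fourierChar continuous_inner hf hg
  simpa using! h

/-- The `L²` transform is known here through its pairing with Schwartz functions. The integral
transform has the same pairings by Fubini, and compactly supported smooth functions separate locally
integrable functions. -/
theorem coeFn_fourier_of_integrable (f : L2) (hf : Integrable f) :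
    (𝓕 f : L2) =ᵐ[volume] 𝓕 (f : ℝ → ℂ) := by
  refine ae_eq_of_integral_contDiff_smul_eq (locallyIntegrable_L2 _) ?_ ?_
  · refine Continuous.locallyIntegrable ?_
    exact VectorFourier.fourierIntegral_continuous Real.continuous_fourierChar
      continuous_inner hf
  · intro g hg hc
    have hc' : HasCompactSupport (Complex.ofRealCLM ∘ g) := hc.comp_left rfl
    set φ : 𝓢(ℝ, ℂ) := hc'.toSchwartzMap (Complex.ofRealCLM.contDiff.comp hg) with hφ
    have hφx : ∀ x, φ x = (g x : ℂ) := fun x => rfl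
    have h1 := integral_mul_fourier f φ
    have h2 := integral_fourier_mul_eq_flip hf φ.integrable
    simp only [Complex.real_smul, ← hφx]
    rw [h1, show (fun x => φ x * 𝓕 (f : ℝ → ℂ) x) = fun x => 𝓕 (f : ℝ → ℂ) x * φ x from
      funext fun x => mul_comm _ _, h2, SchwartzMap.fourier_coe]
    simp only [mul_comm]

theorem coeFn_fourierInv_of_integrable (f : L2) (hf : Integrable f) :
    (𝓕⁻ f : L2) =ᵐ[volume] 𝓕⁻ (f : ℝ → ℂ) := by
  have hcont : Continuous (𝓕 (f : ℝ → ℂ)) :=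
    VectorFourier.fourierIntegral_continuous Real.continuous_fourierChar
      continuous_inner hf
  refine ae_eq_of_integral_contDiff_smul_eq (locallyIntegrable_L2 _) ?_ ?_
  · refine Continuous.locallyIntegrable ?_
    rw [Real.fourierInv_eq_fourier_comp_neg]
    have : Continuous (fun x : ℝ => 𝓕 (f : ℝ → ℂ) (-x)) := hcont.comp continuous_neg
    convert this using 1
    ext x
    rw [← Real.fourierInv_eq_fourier_neg, Real.fourierInv_eq_fourier_comp_neg]
  · intro g hg hc
    have hc' : HasCompactSupport (Complex.ofRealCLM ∘ g) := hc.comp_left rfl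
    set φ : 𝓢(ℝ, ℂ) := hc'.toSchwartzMap (Complex.ofRealCLM.contDiff.comp hg) with hφ
    have hφx : ∀ x, φ x = (g x : ℂ) := fun x => rfl
    have h1 := integral_mul_fourierInv f φ
    have h2 := integral_fourier_mul_eq_flip hf (φ.integrable (μ := volume)).comp_neg
    simp only [Complex.real_smul, ← hφx]
    rw [h1, SchwartzMap.fourierInv_coe]
    calc ∫ x, 𝓕⁻ (φ : ℝ → ℂ) x * f x = ∫ x, f x * 𝓕 (fun y => φ (-y)) x := by
          congr 1; ext x; rw [Real.fourierInv_eq_fourier_comp_neg, mul_comm]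
      _ = ∫ x, 𝓕 (f : ℝ → ℂ) x * φ (-x) := h2.symm
      _ = ∫ x, 𝓕 (f : ℝ → ℂ) (-x) * φ (- -x) :=
          (integral_neg_eq_self (fun x => 𝓕 (f : ℝ → ℂ) x * φ (-x)) volume).symm
      _ = _ := by
          congr 1; ext x; rw [Real.fourierInv_eq_fourier_neg, neg_neg, mul_comm]

theorem ae_norm_fourier_le (f : L2) (hf : Integrable f) :
    ∀ᵐ ξ, ‖(𝓕 f : L2) ξ‖ ≤ ∫ x, ‖f x‖ := by
  filter_upwards [coeFn_fourier_of_integrable f hf] with ξ h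
  rw [h]
  exact VectorFourier.norm_fourierIntegral_le_integral_norm _ _ _ _ _

/-! ### Modulations and translations -/

/-- The phase `2 π h x`. -/
def modPhase (h : ℝ) : C(ℝ, ℝ) := ⟨fun x => 2 * Real.pi * h * x, by fun_prop⟩

/-- Translation by `h` on `L²`. -/
def trans (h : ℝ) : L2 →ₗᵢ[ℂ] L2 :=
  Lp.compMeasurePreservingₗᵢ ℂ (fun x => x - h) (measurePreserving_sub_right volume h)

theorem coeFn_trans (h : ℝ) (f : L2) : trans h f =ᵐ[volume] fun x => f (x - h) :=
  Lp.coeFn_compMeasurePreserving f (measurePreserving_sub_right volume h)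

/-- Density reduces operator identities on `L²` to functions for which the Fourier integrals
converge absolutely. -/
theorem L2_ext_of_schwartz {A B : L2 → L2} (hA : Continuous A) (hB : Continuous B)
    (h : ∀ φ : 𝓢(ℝ, ℂ), A (φ.toLp 2) = B (φ.toLp 2)) : A = B := by
  refine DenseRange.equalizer (SchwartzMap.denseRange_toLpCLM (E := ℝ) (F := ℂ) (p := 2)
    (μ := volume) ENNReal.ofNat_ne_top) hA hB ?_
  ext1 φ
  exact h φ

theorem integrable_phase_toLp (θ : C(ℝ, ℝ)) (φ : 𝓢(ℝ, ℂ)) :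
    Integrable (phase θ (φ.toLp 2)) := by
  refine (φ.integrable (μ := volume)).congr' (Lp.aestronglyMeasurable _) ?_
  filter_upwards [coeFn_phase θ (φ.toLp 2), φ.coeFn_toLp 2] with x h1 h2
  rw [h1, norm_mul, Complex.norm_exp_ofReal_mul_I, one_mul, h2]

theorem fourier_modulation (h : ℝ) (f : L2) :
    (𝓕 (phase (modPhase h) f) : L2) = trans h (𝓕 f) := by
  have hF : Continuous (fun f : L2 => (𝓕 f : L2)) := (Lp.fourierTransformₗᵢ ℝ ℂ).continuous
  refine congrFun (L2_ext_of_schwartz (A := fun f => (𝓕 (phase (modPhase h) f) : L2))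
    (B := fun f => trans h (𝓕 f)) (hF.comp (phase _).continuous)
    ((trans h).continuous.comp hF) fun φ => ?_) f
  apply Lp.ext
  have hq := (measurePreserving_sub_right (volume : Measure ℝ) h).quasiMeasurePreserving
  filter_upwards [coeFn_fourier_of_integrable _ (integrable_phase_toLp (modPhase h) φ),
    coeFn_trans h (𝓕 (φ.toLp 2)), hq.ae_eq_comp
      (show (𝓕 (φ.toLp 2) : L2) =ᵐ[volume] (𝓕 φ : 𝓢(ℝ, ℂ)) by
        rw [SchwartzMap.toLp_fourier_eq]; exact SchwartzMap.coeFn_toLp _ _ _)] with ξ h1 h2 h3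
  rw [h1, h2]
  simp only [Function.comp_apply] at h3
  rw [h3, SchwartzMap.fourier_coe, Real.fourier_real_eq_integral_exp_smul,
    Real.fourier_real_eq_integral_exp_smul]
  apply integral_congr_ae
  filter_upwards [coeFn_phase (modPhase h) (φ.toLp 2), φ.coeFn_toLp 2] with x h4 h5
  rw [h4, h5, smul_eq_mul, smul_eq_mul, ← mul_assoc, ← Complex.exp_add]
  congr 2
  simp only [modPhase, ContinuousMap.coe_mk]
  push_cast
  ring

/-! ### Dilations -/

theorem quasiMeasurePreserving_mul {a : ℝ} (ha : a ≠ 0) :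
    Measure.QuasiMeasurePreserving (fun x : ℝ => a * x) volume volume := by
  refine ⟨measurable_const_mul a, ?_⟩
  rw [Real.map_volume_mul_left ha]
  exact Measure.smul_absolutelyContinuous

theorem memLp_dil {a : ℝ} (ha : a ≠ 0) (f : L2) : MemLp (fun x => f (a * x)) 2 volume := by
  have h : MemLp f 2 (Measure.map (fun x : ℝ => a * x) volume) := by
    rw [Real.map_volume_mul_left ha]
    exact (Lp.memLp f).smul_measure ENNReal.ofReal_ne_top
  exact h.comp_of_map (measurable_const_mul a).aemeasurable

/-- The dilation `f ↦ f(a ·)` on `L²`. -/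
def dil (a : ℝ) (ha : a ≠ 0) : L2 →L[ℂ] L2 :=
  LinearMap.mkContinuous
    { toFun := fun f => MemLp.toLp _ (memLp_dil ha f)
      map_add' := fun f g => by
        apply Lp.ext
        filter_upwards [MemLp.coeFn_toLp (memLp_dil ha (f + g)),
          MemLp.coeFn_toLp (memLp_dil ha f), MemLp.coeFn_toLp (memLp_dil ha g),
          (quasiMeasurePreserving_mul ha).ae_eq_comp (Lp.coeFn_add f g),
          Lp.coeFn_add (MemLp.toLp _ (memLp_dil ha f))
            (MemLp.toLp _ (memLp_dil ha g))] with x h1 h2 h3 h4 h5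
        simp only [Function.comp_apply, Pi.add_apply] at h4
        rw [h1, h5, Pi.add_apply, h2, h3, h4]
      map_smul' := fun c f => by
        apply Lp.ext
        filter_upwards [MemLp.coeFn_toLp (memLp_dil ha (c • f)),
          MemLp.coeFn_toLp (memLp_dil ha f),
          (quasiMeasurePreserving_mul ha).ae_eq_comp (Lp.coeFn_smul c f),
          Lp.coeFn_smul c (MemLp.toLp _ (memLp_dil ha f))] with x h1 h2 h3 h4
        simp only [Function.comp_apply, Pi.smul_apply] at h3
        simp only [RingHom.id_apply]
        rw [h1, h4, Pi.smul_apply, h2, h3] }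
    (Real.sqrt |a⁻¹|) (fun f => by
      refine le_of_sq_le_sq ?_ (by positivity)
      rw [mul_pow, Real.sq_sqrt (abs_nonneg _), norm_sq_eq_integral, norm_sq_eq_integral]
      apply le_of_eq
      calc _ = ∫ x, ‖f (a * x)‖ ^ 2 := by
            apply integral_congr_ae
            filter_upwards [MemLp.coeFn_toLp (memLp_dil ha f)] with x h1
            simp only [LinearMap.coe_mk, AddHom.coe_mk]
            rw [h1]
        _ = _ := by
            rw [Measure.integral_comp_mul_left (fun x => ‖f x‖ ^ 2) a, smul_eq_mul])

theorem coeFn_dil {a : ℝ} (ha : a ≠ 0) (f : L2) : dil a ha f =ᵐ[volume] fun x => f (a * x) :=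
  MemLp.coeFn_toLp (memLp_dil ha f)

/-! ### Factorization of the free group -/

/-- The phase of `M(t) = exp(i x² / (2 t))`. -/
def quadPhase (t : ℝ) : C(ℝ, ℝ) := ⟨fun x => x ^ 2 / (2 * t), by fun_prop⟩

/-- The phase of the symbol of `U(t)`. -/
def freqPhase (t : ℝ) : C(ℝ, ℝ) := ⟨fun ξ => -(2 * Real.pi ^ 2 * t * ξ ^ 2), by fun_prop⟩

theorem U_eq (t : ℝ) (f : L2) : U t f = 𝓕⁻ (phase (freqPhase t) (𝓕 f)) := rfl

/-- The constant `(2 π i t)^(-1/2)`. -/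
def fresnel (t : ℝ) : ℂ := 1 / (2 * Real.pi * t * Complex.I : ℂ) ^ (1 / 2 : ℂ)

theorem norm_fresnel_sq {t : ℝ} (ht : 0 < t) : ‖fresnel t‖ ^ 2 = (2 * Real.pi * t)⁻¹ := by
  have h : (2 * Real.pi * t * Complex.I : ℂ) ≠ 0 := by
    simp [Real.pi_ne_zero, ht.ne']
  have hs : ((2 * Real.pi * t * Complex.I : ℂ) ^ (1 / 2 : ℂ)) ^ 2 =
      2 * Real.pi * t * Complex.I := by
    rw [one_div]
    exact_mod_cast Complex.cpow_nat_inv_pow (2 * Real.pi * t * Complex.I : ℂ) two_ne_zero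
  rw [fresnel, ← norm_pow, div_pow, one_pow, hs, norm_div, norm_one, one_div]
  congr 1
  simp [abs_of_pos Real.pi_pos, abs_of_pos ht]

/-- The oscillating Gaussian is not integrable, so it is damped: with `b = ε + 2πit` the Gaussian
transform and the exchange formula apply. Both exponentials have modulus at most one, so dominated
convergence lets `ε → 0+`. -/
theorem fresnel_integral {f : ℝ → ℂ} (hf : Integrable f) (hf' : Integrable (𝓕 f)) {t : ℝ}
    (ht : 0 < t) (x : ℝ) :
    ∫ ξ : ℝ, Complex.exp (-(2 * Real.pi ^ 2 * t * ξ ^ 2) * Complex.I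
        + 2 * Real.pi * x * ξ * Complex.I) * 𝓕 f ξ =
      fresnel t * ∫ y : ℝ, Complex.exp (((y - x) ^ 2 / (2 * t)) * Complex.I) * f y := by
  set b : ℝ → ℂ := fun ε => (ε : ℂ) + 2 * Real.pi * t * Complex.I with hb
  have hbre : ∀ ε, (b ε).re = ε := fun ε => by simp [hb]
  have hbc : Continuous b := by fun_prop
  have hb0 : ∀ ε, b ε ≠ 0 := fun ε h => by
    have : (b ε).im = 2 * Real.pi * t := by simp [hb]
    rw [h] at this
    simp [Real.pi_ne_zero, ht.ne'] at this
  -- This keeps the square root on the principal branch up to and including `ε = 0`.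
  have hslit : ∀ ε, b ε ∈ Complex.slitPlane := fun ε => by
    refine Complex.mem_slitPlane_iff.2 (Or.inr ?_)
    simp [hb, Real.pi_ne_zero, ht.ne']
  have key : ∀ ε : ℝ, 0 < ε →
      ∫ ξ : ℝ, Complex.exp (-Real.pi * b ε * ξ ^ 2 + 2 * Real.pi * (x * Complex.I) * ξ) * 𝓕 f ξ =
      ∫ y : ℝ, (1 / b ε ^ (1 / 2 : ℂ) *
        Complex.exp (-Real.pi / b ε * (y + Complex.I * (x * Complex.I)) ^ 2)) * f y := by
    intro ε hε
    have h1 := integral_fourier_mul_eq_flip hf (g := fun ξ : ℝ => Complex.exp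
      (-Real.pi * b ε * ξ ^ 2 + 2 * Real.pi * (x * Complex.I) * ξ)) (by
        have := integrable_cexp_quadratic (b := Real.pi * b ε) (by
          rw [Complex.re_ofReal_mul, hbre]; positivity) (2 * Real.pi * (x * Complex.I)) 0
        simpa using this)
    rw [fourier_gaussian_pi' (by rw [hbre]; exact hε)] at h1
    simp only [mul_comm (𝓕 f _)] at h1
    rw [h1]
    simp only [mul_comm (f _)]
  have hre : ∀ ε : ℝ, 0 < ε → ∀ y : ℝ,
      (-Real.pi / b ε * (y + Complex.I * (x * Complex.I)) ^ 2).re ≤ 0 := by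
    intro ε hε y
    have e1 : (y + Complex.I * (x * Complex.I)) ^ 2 = (((y - x) ^ 2 : ℝ) : ℂ) := by
      have : Complex.I * (x * Complex.I) = -x := by
        rw [mul_left_comm, Complex.I_mul_I]; ring
      rw [this]; push_cast; ring
    rw [e1, mul_comm, Complex.re_ofReal_mul]
    have e2 : (-Real.pi / b ε).re ≤ 0 := by
      rw [Complex.div_re]
      simp only [Complex.neg_re, Complex.ofReal_re, Complex.neg_im, Complex.ofReal_im, neg_zero,
        zero_mul, zero_div, add_zero, hbre]
      have : 0 < Complex.normSq (b ε) := Complex.normSq_pos.2 (hb0 ε)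
      rw [neg_mul, neg_div, neg_nonpos]
      have := Real.pi_pos
      positivity
    exact mul_nonpos_of_nonneg_of_nonpos (sq_nonneg _) e2
  have L1 : Tendsto (fun ε : ℝ => ∫ ξ : ℝ, Complex.exp (-Real.pi * b ε * ξ ^ 2
      + 2 * Real.pi * (x * Complex.I) * ξ) * 𝓕 f ξ) (𝓝[>] 0)
      (𝓝 (∫ ξ : ℝ, Complex.exp (-Real.pi * b 0 * ξ ^ 2
      + 2 * Real.pi * (x * Complex.I) * ξ) * 𝓕 f ξ)) := by
    refine tendsto_integral_filter_of_dominated_convergence (fun ξ => ‖𝓕 f ξ‖) ?_ ?_ hf'.norm ?_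
    · refine Eventually.of_forall fun ε => AEStronglyMeasurable.mul ?_ hf'.1
      exact Continuous.aestronglyMeasurable (by fun_prop)
    · filter_upwards [self_mem_nhdsWithin] with ε hε
      refine Eventually.of_forall fun ξ => ?_
      rw [norm_mul, Complex.norm_exp]
      refine mul_le_of_le_one_left (norm_nonneg _) (Real.exp_le_one_iff.2 ?_)
      have : (-Real.pi * b ε * ξ ^ 2 + 2 * Real.pi * (x * Complex.I) * ξ : ℂ).re =
          -(Real.pi * ε * ξ ^ 2) := by
        have e : (-Real.pi * b ε * ξ ^ 2 + 2 * Real.pi * (x * Complex.I) * ξ : ℂ) =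
          ((-(Real.pi * ε * ξ ^ 2) : ℝ) : ℂ) +
          ((-(Real.pi * (2 * Real.pi * t) * ξ ^ 2) + 2 * Real.pi * x * ξ : ℝ) : ℂ) * Complex.I := by
          simp only [hb]; push_cast; ring
        rw [e, Complex.add_re, Complex.re_ofReal_mul, Complex.I_re, mul_zero, add_zero,
          Complex.ofReal_re]
      rw [this]
      have h2 : (0 : ℝ) < ε := hε
      have := Real.pi_pos
      have : 0 ≤ Real.pi * ε * ξ ^ 2 := by positivity
      linarith
    · refine Eventually.of_forall fun ξ => ?_
      have : Continuous fun ε : ℝ => Complex.exp (-Real.pi * b ε * ξ ^ 2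
          + 2 * Real.pi * (x * Complex.I) * ξ) * 𝓕 f ξ := by fun_prop
      exact (this.tendsto 0).mono_left nhdsWithin_le_nhds
  have hc1 : Continuous fun ε : ℝ => b ε ^ (1 / 2 : ℂ) := by
    rw [continuous_iff_continuousAt]
    intro ε
    exact (hbc.continuousAt).cpow continuousAt_const (hslit ε)
  have hc2 : Continuous fun ε : ℝ => 1 / b ε ^ (1 / 2 : ℂ) :=
    continuous_const.div hc1 fun ε => by
      rw [Complex.cpow_ne_zero_iff]; exact Or.inl (hb0 ε)
  have hc3 : ∀ y : ℝ, Continuous fun ε : ℝ =>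
      Complex.exp (-Real.pi / b ε * (y + Complex.I * (x * Complex.I)) ^ 2) := fun y =>
    Complex.continuous_exp.comp ((continuous_const.div hbc hb0).mul continuous_const)
  have L2 : Tendsto (fun ε : ℝ => 1 / b ε ^ (1 / 2 : ℂ) * ∫ y : ℝ,
        Complex.exp (-Real.pi / b ε * (y + Complex.I * (x * Complex.I)) ^ 2) * f y) (𝓝[>] 0)
      (𝓝 (1 / b 0 ^ (1 / 2 : ℂ) * ∫ y : ℝ,
        Complex.exp (-Real.pi / b 0 * (y + Complex.I * (x * Complex.I)) ^ 2) * f y)) := by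
    refine ((hc2.tendsto 0).mono_left nhdsWithin_le_nhds).mul ?_
    refine tendsto_integral_filter_of_dominated_convergence (fun y => ‖f y‖) ?_ ?_ hf.norm ?_
    · refine Eventually.of_forall fun ε => AEStronglyMeasurable.mul ?_ hf.1
      exact Continuous.aestronglyMeasurable (by fun_prop)
    · filter_upwards [self_mem_nhdsWithin] with ε hε
      refine Eventually.of_forall fun y => ?_
      rw [norm_mul, Complex.norm_exp]
      exact mul_le_of_le_one_left (norm_nonneg _) (Real.exp_le_one_iff.2 (hre ε hε y))
    · refine Eventually.of_forall fun y => ?_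
      exact (((hc3 y).mul continuous_const).tendsto 0).mono_left nhdsWithin_le_nhds
  have hlim := tendsto_nhds_unique_of_eventuallyEq L1 L2 (by
    filter_upwards [self_mem_nhdsWithin] with ε hε
    rw [key ε hε, ← integral_const_mul]
    simp only [mul_assoc])
  have hb00 : b 0 = 2 * Real.pi * t * Complex.I := by simp [hb]
  rw [hb00] at hlim
  convert hlim using 1
  · congr 1; ext ξ; congr 2; ring
  · rw [fresnel]
    congr 2; ext y; congr 2
    have : Complex.I * (x * Complex.I) = -x := by
      rw [mul_left_comm, Complex.I_mul_I]; ring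
    rw [this]
    have hp : (Real.pi : ℂ) ≠ 0 := by exact_mod_cast Real.pi_ne_zero
    have ht' : (t : ℂ) ≠ 0 := by exact_mod_cast ht.ne'
    field_simp
    rw [Complex.I_sq]
    ring

theorem dil_ne {t : ℝ} (ht : 0 < t) : (2 * Real.pi * t)⁻¹ ≠ 0 := by positivity

theorem continuous_U (t : ℝ) : Continuous (U t) :=
  (Lp.fourierTransformₗᵢ ℝ ℂ).symm.continuous.comp
    ((phase (freqPhase t)).continuous.comp (Lp.fourierTransformₗᵢ ℝ ℂ).continuous)

/-- On Schwartz functions this is `fresnel_integral`, after expanding `(y - x)² / (2t)` into two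
chirps and a Fourier kernel. The dilation by `(2πt)⁻¹` reflects the `2π` in the exponent of `𝓕`. -/
theorem U_factorization {t : ℝ} (ht : 0 < t) (f : L2) :
    U t f = fresnel t • phase (quadPhase t)
      (dil (2 * Real.pi * t)⁻¹ (dil_ne ht) (𝓕 (phase (quadPhase t) f))) := by
  have hF : Continuous (fun f : L2 => (𝓕 f : L2)) := (Lp.fourierTransformₗᵢ ℝ ℂ).continuous
  refine congrFun (L2_ext_of_schwartz (continuous_U t) (B := fun f => fresnel t •
    phase (quadPhase t) (dil (2 * Real.pi * t)⁻¹ (dil_ne ht) (𝓕 (phase (quadPhase t) f))))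
    ?_ fun φ => ?_) f
  · have h : Continuous fun f : L2 => phase (quadPhase t)
        (dil (2 * Real.pi * t)⁻¹ (dil_ne ht) (𝓕 (phase (quadPhase t) f))) :=
      (phase _).continuous.comp ((dil _ _).continuous.comp (hF.comp (phase _).continuous))
    exact h.const_smul (fresnel t)
  rw [U_eq, SchwartzMap.toLp_fourier_eq]
  apply Lp.ext
  filter_upwards [coeFn_fourierInv_of_integrable _ (integrable_phase_toLp (freqPhase t) (𝓕 φ)),
    Lp.coeFn_smul (fresnel t) (phase (quadPhase t)
      (dil (2 * Real.pi * t)⁻¹ (dil_ne ht) (𝓕 (phase (quadPhase t) (φ.toLp 2))))),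
    coeFn_phase (quadPhase t)
      (dil (2 * Real.pi * t)⁻¹ (dil_ne ht) (𝓕 (phase (quadPhase t) (φ.toLp 2)))),
    coeFn_dil (dil_ne ht) (𝓕 (phase (quadPhase t) (φ.toLp 2))),
    (quasiMeasurePreserving_mul (dil_ne ht)).ae_eq_comp
      (coeFn_fourier_of_integrable _ (integrable_phase_toLp (quadPhase t) φ))]
    with x h1 h2 h3 h4 h5
  simp only [Function.comp_apply] at h5
  rw [h1, h2, Pi.smul_apply, h3, h4, h5, smul_eq_mul, Real.fourierInv_eq',
    Real.fourier_real_eq_integral_exp_smul, ← integral_const_mul]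
  have hmain := fresnel_integral (φ.integrable (μ := volume))
    ((𝓕 φ).integrable (μ := volume)) ht x
  trans ∫ ξ : ℝ, Complex.exp (-(2 * Real.pi ^ 2 * t * ξ ^ 2) * Complex.I
        + 2 * Real.pi * x * ξ * Complex.I) * 𝓕 (φ : ℝ → ℂ) ξ
  · apply integral_congr_ae
    filter_upwards [coeFn_phase (freqPhase t) ((𝓕 φ).toLp 2), (𝓕 φ).coeFn_toLp 2] with ξ h6 h7
    rw [h6, h7, smul_eq_mul, ← mul_assoc, ← Complex.exp_add, SchwartzMap.fourier_coe]
    congr 2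
    simp only [freqPhase, ContinuousMap.coe_mk]
    simp
    ring
  · rw [hmain]
    congr 1
    apply integral_congr_ae
    filter_upwards [coeFn_phase (quadPhase t) (φ.toLp 2), φ.coeFn_toLp 2] with y h6 h7
    rw [h6, h7, smul_eq_mul, ← mul_assoc, ← mul_assoc, ← Complex.exp_add, ← Complex.exp_add]
    congr 2
    simp only [quadPhase, ContinuousMap.coe_mk]
    have hp : (Real.pi : ℂ) ≠ 0 := by exact_mod_cast Real.pi_ne_zero
    have ht' : (t : ℂ) ≠ 0 := by exact_mod_cast ht.ne'
    push_cast
    field_simp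
    ring

/-! ### The weight `x` through modulations -/

/-- The modulations of `f` are Lipschitz with constant `L`; equivalently `‖x f‖ ≤ L / (2 π)`. -/
def LipW (L : ℝ) (f : L2) : Prop := ∀ h : ℝ, ‖phase (modPhase h) f - f‖ ≤ L * |h|

theorem LipW.nonneg {L : ℝ} {f : L2} (hf : LipW L f) : 0 ≤ L := by
  simpa using (norm_nonneg _).trans (hf 1)

theorem LipW.mono {L L' : ℝ} {f : L2} (hf : LipW L f) (h : L ≤ L') : LipW L' f := fun a =>
  (hf a).trans (mul_le_mul_of_nonneg_right h (abs_nonneg a))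

theorem LipW.add {L L' : ℝ} {f g : L2} (hf : LipW L f) (hg : LipW L' g) : LipW (L + L') (f + g) := by
  intro h
  rw [map_add, add_sub_add_comm, add_mul]
  exact (norm_add_le _ _).trans (add_le_add (hf h) (hg h))

theorem LipW.smul {L : ℝ} {f : L2} (hf : LipW L f) (c : ℝ) : LipW (|c| * L) (c • f) := by
  intro h
  have : phase (modPhase h) (c • f) = c • phase (modPhase h) f :=
    (phase (modPhase h)).toLinearMap.map_smul_of_tower c f
  rw [this, ← smul_sub, norm_smul, Real.norm_eq_abs, mul_assoc]
  exact mul_le_mul_of_nonneg_left (hf h) (abs_nonneg c)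

theorem LipW.phase {L : ℝ} {f : L2} (hf : LipW L f) (θ : C(ℝ, ℝ)) : LipW L (phase θ f) := by
  intro h
  rw [phase_comm, ← map_sub, LinearIsometry.norm_map]
  exact hf h

/-- Closedness under `L²` limits lets a contraction in the plain `L²` metric keep the weighted
bound. -/
theorem isClosed_lipW (L : ℝ) : IsClosed {f : L2 | LipW L f} := by
  simp only [LipW, ofPred_forall]
  refine isClosed_iInter fun h => ?_
  exact isClosed_le ((((NLSFinal.phase (modPhase h)).continuous).sub continuous_id).norm)
    continuous_const

theorem norm_trans_fourier_sub (h : ℝ) (f : L2) :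
    ‖trans h (𝓕 f) - 𝓕 f‖ = ‖phase (modPhase h) f - f‖ := by
  rw [← fourier_modulation, ← Lp.norm_fourier_eq (phase (modPhase h) f - f)]
  congr 1
  exact ((Lp.fourierTransformₗᵢ ℝ ℂ).map_sub _ _).symm

/-- Modulations are bounded operators, so they pass under the Bochner integral; no measurability in
the weighted norm is required. -/
theorem lipW_integral {α : Type*} [MeasurableSpace α] {ν : Measure α} {G : α → L2} {b : α → ℝ}
    (hG : Integrable G ν) (hb : Integrable b ν) (h : ∀ᵐ τ ∂ν, LipW (b τ) (G τ)) :
    LipW (∫ τ, b τ ∂ν) (∫ τ, G τ ∂ν) := by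
  intro a
  have h1 : phase (modPhase a) (∫ τ, G τ ∂ν) = ∫ τ, phase (modPhase a) (G τ) ∂ν :=
    ((phase (modPhase a)).toContinuousLinearMap.integral_comp_comm hG).symm
  have h2 : Integrable (fun τ => phase (modPhase a) (G τ)) ν :=
    (phase (modPhase a)).toContinuousLinearMap.integrable_comp hG
  rw [h1, ← integral_sub h2 hG, ← integral_mul_const]
  refine norm_integral_le_of_norm_le (hb.mul_const _) ?_
  filter_upwards [h] with τ hτ using hτ a

/-! ### Comparison of the modulation bound with the norm of `x f` -/

theorem lipW_of_eLpNorm_le {f : L2} {X : ℝ} (hX : 0 ≤ X)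
    (h : eLpNorm (fun x : ℝ => (x : ℂ) * f x) 2 volume ≤ ENNReal.ofReal X) :
    LipW (2 * Real.pi * X) f := by
  intro a
  have h1 : eLpNorm (phase (modPhase a) f - f : L2) 2 volume ≤
      ENNReal.ofReal (2 * Real.pi * |a|) * eLpNorm (fun x : ℝ => (x : ℂ) * f x) 2 volume := by
    refine eLpNorm_le_mul_eLpNorm_of_ae_le_mul ?_ 2
    filter_upwards [Lp.coeFn_sub (phase (modPhase a) f) f, coeFn_phase (modPhase a) f] with x h1 h2
    rw [h1, Pi.sub_apply, h2, norm_mul, ← sub_one_mul, norm_mul, ← mul_assoc]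
    refine mul_le_mul_of_nonneg_right ?_ (norm_nonneg _)
    rw [mul_comm ((modPhase a x : ℝ) : ℂ)]
    refine (Real.norm_exp_I_mul_ofReal_sub_one_le (x := modPhase a x)).trans ?_
    simp only [modPhase, ContinuousMap.coe_mk, norm_mul, Complex.norm_real, Real.norm_eq_abs]
    rw [abs_of_pos Real.pi_pos]
    simp
  rw [Lp.norm_def]
  have h2 := h1.trans (mul_le_mul_right h _)
  rw [← ENNReal.ofReal_mul (by positivity)] at h2
  refine (ENNReal.toReal_le_of_le_ofReal (by positivity) h2).trans (le_of_eq (by ring))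

/-- The difference quotients of the modulation along steps `1/(n+1)` are bounded in `L²` and
converge pointwise to `i x f`; Fatou's lemma gives the bound for the limit. -/
theorem eLpNorm_le_of_lipW {f : L2} {L : ℝ} (h : LipW L f) :
    eLpNorm (fun x : ℝ => (x : ℂ) * f x) 2 volume ≤ ENNReal.ofReal (L / (2 * Real.pi)) := by
  set a : ℕ → ℝ := fun n => 1 / ((n : ℝ) + 1) with ha
  have hapos : ∀ n, 0 < a n := fun n => by positivity
  have hpi := Real.pi_pos
  set F : ℕ → L2 := fun n => ((2 * Real.pi * a n)⁻¹ : ℝ) • (phase (modPhase (a n)) f - f) with hF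
  have hFn : ∀ n, eLpNorm (F n) 2 volume ≤ ENNReal.ofReal (L / (2 * Real.pi)) := by
    intro n
    rw [← Lp.enorm_def, ← ofReal_norm]
    apply ENNReal.ofReal_le_ofReal
    rw [hF]
    simp only
    rw [norm_smul, Real.norm_of_nonneg (by have := hapos n; positivity)]
    refine (mul_le_mul_of_nonneg_left (h (a n))
      (by have := hapos n; positivity)).trans (le_of_eq ?_)
    rw [abs_of_pos (hapos n)]
    have := (hapos n).ne'
    field_simp
  have hlim : ∀ᵐ x : ℝ, Tendsto (fun n => F n x) atTop (𝓝 (Complex.I * (x * f x))) := by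
    have e1 : ∀ᵐ x : ℝ, ∀ n, F n x = (((2 * Real.pi * a n)⁻¹ : ℝ) : ℂ) *
        (Complex.exp ((2 * Real.pi * a n * x : ℝ) * Complex.I) * f x - f x) := by
      rw [ae_all_iff]
      intro n
      filter_upwards [Lp.coeFn_smul ((2 * Real.pi * a n)⁻¹ : ℝ) (phase (modPhase (a n)) f - f),
        Lp.coeFn_sub (phase (modPhase (a n)) f) f, coeFn_phase (modPhase (a n)) f] with x h1 h2 h3
      rw [hF]
      simp only
      rw [h1, Pi.smul_apply, h2, Pi.sub_apply, h3, Complex.real_smul]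
      rfl
    filter_upwards [e1] with x hx
    have hd : HasDerivAt (fun y : ℝ => Complex.exp ((y * x : ℝ) * Complex.I)) (x * Complex.I) 0 := by
      have h1 : HasDerivAt (fun y : ℝ => ((y * x : ℝ) : ℂ) * Complex.I) (x * Complex.I) 0 := by
        have := (((hasDerivAt_id (0 : ℝ)).mul_const x).ofReal_comp).mul_const Complex.I
        simpa using this
      have h2 := h1.cexp
      simpa using h2
    have ht := hd.tendsto_slope
    have hb : Tendsto (fun n => 2 * Real.pi * a n) atTop (𝓝[≠] 0) := by
      refine tendsto_nhdsWithin_iff.2 ⟨?_, Eventually.of_forall fun n => ?_⟩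
      · have := (tendsto_one_div_add_atTop_nhds_zero_nat (𝕜 := ℝ)).const_mul (2 * Real.pi)
        simpa [ha] using this
      · have := hapos n
        exact (by positivity : (2 * Real.pi * a n) ≠ 0)
    have h3 := (ht.comp hb).mul_const (f x)
    refine Tendsto.congr' (Eventually.of_forall fun n => ?_) (h3.trans (le_of_eq ?_))
    · beta_reduce
      rw [hx n]
      simp only [Function.comp_apply, slope, sub_zero, vsub_eq_sub, Complex.real_smul, zero_mul,
        Complex.ofReal_zero, Complex.exp_zero]
      ring
    · congr 1; ring
  have hlim' := Lp.eLpNorm_lim_le_liminf_eLpNorm (p := 2) (μ := volume)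
    (fun n => Lp.aestronglyMeasurable (F n)) _ hlim
  refine le_trans (le_of_eq ?_) (hlim'.trans ?_)
  · apply eLpNorm_congr_norm_ae
    exact Eventually.of_forall fun x => by simp
  · exact liminf_le_of_le (by isBoundedDefault) fun b hb => by
      obtain ⟨n, hn⟩ := hb.exists
      exact hn.trans (hFn n)

theorem memLp_of_lipW {f : L2} {L : ℝ} (h : LipW L f) :
    MemLp (fun x : ℝ => (x : ℂ) * f x) 2 volume :=
  ⟨(Complex.continuous_ofReal.aestronglyMeasurable).mul (Lp.aestronglyMeasurable f),
    (eLpNorm_le_of_lipW h).trans_lt ENNReal.ofReal_lt_top⟩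

/-- Cauchy–Schwarz for `|f| = (l² + x²)^(-1/2) · (l² + x²)^(1/2) |f|`, with `∫ (l² + x²)⁻¹ = π / l`.
The free scale `l` allows optimization between `‖f‖` and `‖x f‖`. -/
theorem integrable_and_integral_norm_le_of_lipW {f : L2} {L l : ℝ} (h : LipW L f) (hl : 0 < l) :
    Integrable f ∧
      ∫ x, ‖f x‖ ≤ Real.sqrt (Real.pi / l) * (l * ‖f‖ + L / (2 * Real.pi)) := by
  have hpos : ∀ x : ℝ, 0 < l ^ 2 + x ^ 2 := fun x => by positivity
  set k : ℝ → ℂ := fun x => (((Real.sqrt (l ^ 2 + x ^ 2))⁻¹ : ℝ) : ℂ) with hk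
  set g : ℝ → ℂ := fun x => ((Real.sqrt (l ^ 2 + x ^ 2) * ‖f x‖ : ℝ) : ℂ) with hg
  have hkc : Continuous k := by
    refine Complex.continuous_ofReal.comp (Continuous.inv₀ (by fun_prop) fun x => ?_)
    exact (Real.sqrt_pos.2 (hpos x)).ne'
  have hksq : ∀ x, ‖k x‖ ^ 2 = (l ^ 2)⁻¹ * (1 + (l⁻¹ * x) ^ 2)⁻¹ := by
    intro x
    rw [hk]
    simp only
    rw [Complex.norm_real, norm_inv, Real.norm_of_nonneg (Real.sqrt_nonneg _), inv_pow,
      Real.sq_sqrt (hpos x).le, ← mul_inv]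
    congr 1
    field_simp
  have hkint : Integrable fun x => ‖k x‖ ^ 2 := by
    simp only [hksq]
    exact (integrable_inv_one_add_sq.comp_mul_left' (inv_ne_zero hl.ne')).const_mul _
  have hkm : MemLp k 2 volume := (memLp_two_iff_integrable_sq_norm hkc.aestronglyMeasurable).2 hkint
  have hkval : ∫ x, ‖k x‖ ^ 2 = Real.pi / l := by
    simp only [hksq]
    rw [integral_const_mul, Measure.integral_comp_mul_left (fun x : ℝ => (1 + x ^ 2)⁻¹) l⁻¹,
      integral_univ_inv_one_add_sq, inv_inv, abs_of_pos hl, smul_eq_mul]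
    field_simp
  have hxf := memLp_of_lipW h
  have hgb : ∀ x, ‖g x‖ ≤ ‖(l * ‖f x‖ + ‖(x : ℂ) * f x‖ : ℝ)‖ := by
    intro x
    rw [Real.norm_of_nonneg (by positivity), hg]
    simp only
    rw [Complex.norm_real, Real.norm_of_nonneg (by positivity), norm_mul, Complex.norm_real,
      ← add_mul]
    refine mul_le_mul_of_nonneg_right ?_ (norm_nonneg _)
    rw [Real.sqrt_le_left (by positivity), add_sq, Real.norm_eq_abs, sq_abs]
    have : 0 ≤ 2 * l * |x| := by positivity
    linarith
  have hgs : AEStronglyMeasurable g volume := by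
    refine Complex.continuous_ofReal.comp_aestronglyMeasurable (AEStronglyMeasurable.mul
      (Continuous.aestronglyMeasurable (by fun_prop)) (Lp.aestronglyMeasurable f).norm)
  have hgm : MemLp g 2 volume :=
    (((Lp.memLp f).norm.const_mul l).add hxf.norm).mono hgs (Eventually.of_forall hgb)
  have hgn : ‖hgm.toLp g‖ ≤ l * ‖f‖ + L / (2 * Real.pi) := by
    have hpi := Real.pi_pos
    have hL := h.nonneg
    rw [Lp.norm_toLp]
    refine ENNReal.toReal_le_of_le_ofReal (by positivity) ?_
    refine (eLpNorm_mono hgb).trans ((eLpNorm_add_le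
      ((Lp.aestronglyMeasurable f).norm.const_mul l) hxf.1.norm (by norm_num)).trans ?_)
    rw [ENNReal.ofReal_add (by positivity) (by positivity), eLpNorm_norm]
    refine add_le_add (le_of_eq ?_) (eLpNorm_le_of_lipW h)
    have : (fun x => l * ‖f x‖) = l • fun x => ‖f x‖ := rfl
    rw [this, eLpNorm_const_smul, eLpNorm_norm, ENNReal.ofReal_mul hl.le, ofReal_norm,
      Lp.enorm_def, Real.enorm_of_nonneg hl.le]
  have hkg : ∀ x, k x * g x = (‖f x‖ : ℂ) := by
    intro x
    rw [hk, hg]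
    simp only
    rw [← Complex.ofReal_mul, ← mul_assoc, inv_mul_cancel₀ (Real.sqrt_pos.2 (hpos x)).ne', one_mul]
  have hint : Integrable fun x => (‖f x‖ : ℂ) := by
    simp only [← hkg]
    exact hkm.integrable_mul hgm
  constructor
  · refine (integrable_norm_iff (Lp.aestronglyMeasurable f)).1 ?_
    simpa using hint.re
  · have hin : inner ℂ (hkm.toLp k) (hgm.toLp g) = ((∫ x, ‖f x‖ : ℝ) : ℂ) := by
      rw [L2.inner_def, ← integral_complex_ofReal]
      apply integral_congr_ae
      filter_upwards [hkm.coeFn_toLp, hgm.coeFn_toLp] with x h1 h2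
      rw [h1, h2, ← hkg, RCLike.inner_apply, mul_comm]
      simp [hk]
    have h1 := norm_inner_le_norm (𝕜 := ℂ) (hkm.toLp k) (hgm.toLp g)
    rw [hin, Complex.norm_real] at h1
    have h2 : ‖hkm.toLp k‖ = Real.sqrt (Real.pi / l) := by
      rw [← hkval, ← Real.sqrt_sq (norm_nonneg (hkm.toLp k)), norm_sq_eq_integral]
      congr 1
      apply integral_congr_ae
      filter_upwards [hkm.coeFn_toLp] with x h1
      rw [h1]
    rw [h2] at h1
    exact (le_abs_self _).trans (h1.trans (mul_le_mul_of_nonneg_left hgn (Real.sqrt_nonneg _)))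

theorem ae_norm_fourier_le_of_lipW {f : L2} {L l : ℝ} (h : LipW L f) (hl : 0 < l) :
    ∀ᵐ ξ, ‖(𝓕 f : L2) ξ‖ ≤ Real.sqrt (Real.pi / l) * (l * ‖f‖ + L / (2 * Real.pi)) := by
  obtain ⟨h1, h2⟩ := integrable_and_integral_norm_le_of_lipW h hl
  filter_upwards [ae_norm_fourier_le f h1] with ξ h3 using h3.trans h2

/-! ### The commutator of the weight with the chirp -/

theorem norm_exp_sub_one_le_rpow {p : ℝ} (hp0 : 0 ≤ p) (hp1 : p ≤ 1) {y : ℝ} (hy : 0 ≤ y) :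
    ‖Complex.exp ((y : ℂ) * Complex.I) - 1‖ ≤ 2 * y ^ p := by
  rcases le_or_gt y 1 with h | h
  · have h1 := Real.norm_exp_I_mul_ofReal_sub_one_le (x := y)
    rw [mul_comm Complex.I, Real.norm_of_nonneg hy] at h1
    rcases hy.eq_or_lt with rfl | h0
    · simpa using Real.rpow_nonneg le_rfl p
    · have h2 : y ^ (1 : ℝ) ≤ y ^ p := Real.rpow_le_rpow_of_exponent_ge h0 h hp1
      rw [Real.rpow_one] at h2
      have := Real.rpow_nonneg hy p
      linarith
  · have h1 := norm_sub_le (Complex.exp ((y : ℂ) * Complex.I)) 1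
    rw [Complex.norm_exp_ofReal_mul_I, norm_one] at h1
    have h2 := Real.one_le_rpow h.le hp0
    linarith

/-- Each power `t^(-p)` of decay is bought with `2p` powers of the weight, by `|exp(iy) - 1| ≤ 2
y^p` at `y = x²/(2t)`; this needs `p ≤ 1`. -/
theorem norm_chirp_sub_one_le {p e s : ℝ} (hp0 : 0 ≤ p) (hp1 : p ≤ 1) (he : 0 ≤ e)
    (hs : 2 * p + e ≤ s) {t : ℝ} (ht : 1 ≤ t) (x : ℝ) :
    |x| ^ e * ‖Complex.exp (((quadPhase t x : ℝ) : ℂ) * Complex.I) - 1‖ ≤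
      2 * t ^ (-p) * Real.sqrt (1 + x ^ 2) ^ s := by
  have ht0 : 0 < t := by linarith
  set w := Real.sqrt (1 + x ^ 2) with hw
  have hw1 : 1 ≤ w := by rw [hw, Real.one_le_sqrt]; nlinarith [sq_nonneg x]
  have hxw : |x| ≤ w := by
    rw [hw]; apply Real.le_sqrt_of_sq_le; rw [sq_abs]; linarith
  have hxw2 : x ^ 2 ≤ w ^ 2 := by rw [hw, Real.sq_sqrt (by positivity)]; linarith
  have h1 : ‖Complex.exp (((quadPhase t x : ℝ) : ℂ) * Complex.I) - 1‖ ≤ 2 * (t ^ (-p) * w ^ (2 * p)) := by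
    refine (norm_exp_sub_one_le_rpow hp0 hp1 (y := quadPhase t x) ?_).trans ?_
    · simp only [quadPhase, ContinuousMap.coe_mk]; positivity
    · refine mul_le_mul_of_nonneg_left ?_ zero_le_two
      have h2 : quadPhase t x ≤ t⁻¹ * w ^ 2 := by
        simp only [quadPhase, ContinuousMap.coe_mk]
        rw [div_eq_inv_mul]
        refine mul_le_mul ?_ hxw2 (sq_nonneg _) (by positivity)
        exact inv_anti₀ ht0 (by linarith)
      refine (Real.rpow_le_rpow ?_ h2 hp0).trans (le_of_eq ?_)
      · simp only [quadPhase, ContinuousMap.coe_mk]; positivity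
      · rw [Real.mul_rpow (by positivity) (by positivity), Real.inv_rpow ht0.le,
          Real.rpow_neg ht0.le, Real.rpow_mul (by positivity)]
        norm_num
  calc _ ≤ w ^ e * (2 * (t ^ (-p) * w ^ (2 * p))) :=
        mul_le_mul (Real.rpow_le_rpow (abs_nonneg _) hxw he) h1 (norm_nonneg _) (by positivity)
    _ = 2 * t ^ (-p) * w ^ (2 * p + e) := by
        rw [Real.rpow_add (by linarith)]; ring
    _ ≤ _ := by
        refine mul_le_mul_of_nonneg_left (Real.rpow_le_rpow_of_exponent_le hw1 hs) (by positivity)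

/-- Taking `p = m + 1/2` without the factor `x` and `p = m` with it costs `2m + 1 ≤ s` weights in
both cases. The bound `m ≤ 1/2` is `p ≤ 1` in the first one. -/
theorem exists_chirp_bound {s m : ℝ} (hm : 0 < m) (hm2 : m ≤ 1 / 2) (hs : 2 * m + 1 ≤ s) {ψ : L2}
    (hψ : MemH0 s ψ) : ∃ K : ℝ, 0 ≤ K ∧ ∀ t, 1 ≤ t →
      ‖phase (quadPhase t) ψ - ψ‖ ≤ K * t ^ (-(m + 1 / 2)) ∧
      LipW (K * t ^ (-m)) (phase (quadPhase t) ψ - ψ) := by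
  set W := (eLpNorm (weight s ψ) 2 volume).toReal with hW
  have hWe : eLpNorm (weight s ψ) 2 volume = ENNReal.ofReal W :=
    (ENNReal.ofReal_toReal hψ.2.ne).symm
  have hW0 : 0 ≤ W := ENNReal.toReal_nonneg
  have hpi := Real.pi_gt_three
  have hgen : ∀ e : ℝ, 0 ≤ e → ∀ p : ℝ, 0 ≤ p → p ≤ 1 → 2 * p + e ≤ s → ∀ t, 1 ≤ t →
      ∀ g : ℝ → ℂ, (∀ᵐ x, ‖g x‖ = |x| ^ e * ‖(phase (quadPhase t) ψ - ψ : L2) x‖) →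
      eLpNorm g 2 volume ≤ ENNReal.ofReal (2 * t ^ (-p) * W) := by
    intro e he p hp0 hp1 hs t ht g hg
    rw [ENNReal.ofReal_mul (by positivity), ← hWe]
    refine eLpNorm_le_mul_eLpNorm_of_ae_le_mul ?_ 2
    filter_upwards [hg, Lp.coeFn_sub (phase (quadPhase t) ψ) ψ, coeFn_phase (quadPhase t) ψ]
      with x h1 h2 h3
    rw [h1, h2, Pi.sub_apply, h3, ← sub_one_mul, norm_mul, weight, norm_mul, Complex.norm_real,
      Real.norm_of_nonneg (by positivity), ← mul_assoc, ← mul_assoc]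
    exact mul_le_mul_of_nonneg_right (norm_chirp_sub_one_le hp0 hp1 he hs ht x) (norm_nonneg _)
  -- A factor 2 comes from the chirp estimate and `2π` from the normalization of `LipW`; the `L²`
  -- bound alone would need only `2 W`.
  refine ⟨4 * Real.pi * W, by positivity, fun t ht => ⟨?_, ?_⟩⟩
  · have h1 := hgen 0 le_rfl (m + 1 / 2) (by positivity) (by linarith) (by linarith) t ht
      (phase (quadPhase t) ψ - ψ : L2) (Eventually.of_forall fun x => by simp)
    rw [Lp.norm_def]
    refine (ENNReal.toReal_le_of_le_ofReal (by positivity) h1).trans ?_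
    have h2 : 0 ≤ W * t ^ (-(m + 1 / 2)) := by positivity
    nlinarith
  · have h1 := hgen 1 zero_le_one m hm.le (by linarith) (by linarith) t ht
      (fun x => (x : ℂ) * (phase (quadPhase t) ψ - ψ : L2) x) (Eventually.of_forall fun x => by simp)
    refine (lipW_of_eLpNorm_le (by positivity) h1).mono (le_of_eq (by ring))

theorem exists_lipW_of_memH0 {s : ℝ} (hs : 1 ≤ s) {f : L2} (hf : MemH0 s f) : ∃ L, LipW L f := by
  refine ⟨_, lipW_of_eLpNorm_le (X := (eLpNorm (weight s f) 2 volume).toReal)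
    ENNReal.toReal_nonneg ?_⟩
  rw [ENNReal.ofReal_toReal hf.2.ne]
  refine eLpNorm_mono fun x => ?_
  rw [weight, norm_mul, norm_mul]
  refine mul_le_mul_of_nonneg_right ?_ (norm_nonneg _)
  rw [Complex.norm_real, Complex.norm_real, Real.norm_eq_abs, Real.norm_eq_abs,
    abs_of_nonneg (a := Real.sqrt (1 + x ^ 2) ^ s) (by positivity)]
  have hw1 : 1 ≤ Real.sqrt (1 + x ^ 2) := by rw [Real.one_le_sqrt]; nlinarith [sq_nonneg x]
  have hxw : |x| ≤ Real.sqrt (1 + x ^ 2) := by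
    apply Real.le_sqrt_of_sq_le; rw [sq_abs]; linarith
  calc |x| ≤ Real.sqrt (1 + x ^ 2) ^ (1 : ℝ) := by rwa [Real.rpow_one]
    _ ≤ _ := Real.rpow_le_rpow_of_exponent_le hw1 hs

theorem normH0_one_le {f : L2} {L : ℝ} (h : LipW L f) :
    normH0 1 f ≤ ENNReal.ofReal (‖f‖ + L / (2 * Real.pi)) := by
  have hpi := Real.pi_pos
  have hL := h.nonneg
  have h1 : normH0 1 f ≤ eLpNorm (fun x => ‖f x‖ + ‖(x : ℂ) * f x‖) 2 volume := by
    refine eLpNorm_mono fun x => ?_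
    rw [weight, Real.norm_of_nonneg (by positivity), norm_mul, norm_mul, Complex.norm_real,
      Complex.norm_real, Real.rpow_one, Real.norm_of_nonneg (by positivity), Real.norm_eq_abs,
      ← one_add_mul]
    refine mul_le_mul_of_nonneg_right ?_ (norm_nonneg _)
    rw [Real.sqrt_le_left (by positivity), add_sq, sq_abs]
    have : 0 ≤ |x| := abs_nonneg x
    linarith
  refine h1.trans ((eLpNorm_add_le (Lp.aestronglyMeasurable f).norm
    (memLp_of_lipW h).1.norm (by norm_num)).trans ?_)
  rw [ENNReal.ofReal_add (by positivity) (by positivity), eLpNorm_norm, eLpNorm_norm]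
  refine add_le_add (le_of_eq ?_) (eLpNorm_le_of_lipW h)
  rw [ofReal_norm, Lp.enorm_def]

theorem memH0_one_of_lipW {f : L2} {L : ℝ} (h : LipW L f) : MemH0 1 f := by
  refine ⟨?_, (normH0_one_le h).trans_lt ENNReal.ofReal_lt_top⟩
  refine AEStronglyMeasurable.mul (Continuous.aestronglyMeasurable ?_) (Lp.aestronglyMeasurable f)
  simp only [Real.rpow_one]
  fun_prop

theorem enorm_le_normH0 {s : ℝ} (hs : 0 ≤ s) (f : L2) : ENNReal.ofReal ‖f‖ ≤ normH0 s f := by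
  rw [ofReal_norm, Lp.enorm_def]
  refine eLpNorm_mono fun x => ?_
  rw [weight, norm_mul, Complex.norm_real, Real.norm_of_nonneg (by positivity)]
  refine le_mul_of_one_le_left (norm_nonneg _) (Real.one_le_rpow ?_ hs)
  rw [Real.one_le_sqrt]
  nlinarith [sq_nonneg x]

/-! ### The cubic product -/

/-- Essential boundedness by `a`. -/
def Bdd (a : ℝ) (z : L2) : Prop := ∀ᵐ ξ, ‖z ξ‖ ≤ a

theorem Bdd.mono {a b : ℝ} {z : L2} (hz : Bdd a z) (h : a ≤ b) : Bdd b z := by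
  filter_upwards [hz] with ξ hξ using hξ.trans h

theorem Bdd.nonneg {a : ℝ} {z : L2} (hz : Bdd a z) : 0 ≤ a := by
  obtain ⟨ξ, hξ⟩ := hz.exists
  exact (norm_nonneg _).trans hξ

theorem Bdd.add {a b : ℝ} {z w : L2} (hz : Bdd a z) (hw : Bdd b w) : Bdd (a + b) (z + w) := by
  filter_upwards [hz, hw, Lp.coeFn_add z w] with ξ h1 h2 h3
  rw [h3]
  exact (norm_add_le _ _).trans (add_le_add h1 h2)

/-- Turns the pointwise algebra of the cubic product into `L²` estimates, so that each product
estimate below is proved for complex numbers. -/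
theorem norm_le_sum_of_ae_le {n : ℕ} {F : L2} {A : Fin n → L2} {c : Fin n → ℝ}
    (hc : ∀ i, 0 ≤ c i) (h : ∀ᵐ x, ‖F x‖ ≤ ∑ i, c i * ‖A i x‖) : ‖F‖ ≤ ∑ i, c i * ‖A i‖ := by
  have h1 : eLpNorm F 2 volume ≤ eLpNorm (∑ i, fun x => c i * ‖A i x‖) 2 volume := by
    refine eLpNorm_mono_ae ?_
    filter_upwards [h] with x hx
    refine hx.trans ((le_abs_self _).trans (le_of_eq ?_))
    rw [Finset.sum_apply, Real.norm_eq_abs]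
  have h2 := h1.trans (eLpNorm_sum_le
    (fun i _ => (Lp.aestronglyMeasurable (A i)).norm.const_mul (c i)) (by norm_num))
  have h3 : ∀ i, eLpNorm (fun x => c i * ‖A i x‖) 2 volume = ENNReal.ofReal (c i * ‖A i‖) := by
    intro i
    have : (fun x => c i * ‖A i x‖) = c i • fun x => ‖A i x‖ := rfl
    rw [this, eLpNorm_const_smul, eLpNorm_norm, ENNReal.ofReal_mul (hc i), ofReal_norm,
      Lp.enorm_def, Real.enorm_of_nonneg (hc i)]
  simp only [h3] at h2
  rw [← ENNReal.ofReal_sum_of_nonneg (fun i _ => mul_nonneg (hc i) (norm_nonneg _))] at h2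
  rw [Lp.norm_def]
  exact ENNReal.toReal_le_of_le_ofReal
    (Finset.sum_nonneg fun i _ => mul_nonneg (hc i) (norm_nonneg _)) h2

open scoped Classical in
/-- The product `|z|² w`, set to zero if it is not in `L²`. -/
def cub (z w : L2) : L2 :=
  if h : MemLp (fun ξ => ((‖z ξ‖ ^ 2 : ℝ) : ℂ) * w ξ) 2 volume then h.toLp _ else 0

theorem coeFn_cub {a : ℝ} {z w : L2} (hz : Bdd a z) :
    cub z w =ᵐ[volume] fun ξ => ((‖z ξ‖ ^ 2 : ℝ) : ℂ) * w ξ := by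
  have h : MemLp (fun ξ => ((‖z ξ‖ ^ 2 : ℝ) : ℂ) * w ξ) 2 volume := by
    refine MemLp.of_le_mul (c := a ^ 2) (Lp.memLp w) (AEStronglyMeasurable.mul
      (Complex.continuous_ofReal.comp_aestronglyMeasurable
        ((Lp.aestronglyMeasurable z).norm.pow 2)) (Lp.aestronglyMeasurable w)) ?_
    filter_upwards [hz] with ξ hξ
    rw [norm_mul, Complex.norm_real, Real.norm_of_nonneg (by positivity)]
    exact mul_le_mul_of_nonneg_right (pow_le_pow_left₀ (norm_nonneg _) hξ 2) (norm_nonneg _)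
  rw [cub, dif_pos h]
  exact h.coeFn_toLp

theorem norm_cub_sub_le_pointwise {a : ℝ} {z z' w w' : ℂ} (hz : ‖z‖ ≤ a) (hz' : ‖z'‖ ≤ a)
    (hw' : ‖w'‖ ≤ a) : ‖((‖z‖ ^ 2 : ℝ) : ℂ) * w - ((‖z'‖ ^ 2 : ℝ) : ℂ) * w'‖ ≤
      2 * a ^ 2 * ‖z - z'‖ + a ^ 2 * ‖w - w'‖ := by
  have ha : 0 ≤ a := (norm_nonneg _).trans hz
  have e : ((‖z‖ ^ 2 : ℝ) : ℂ) * w - ((‖z'‖ ^ 2 : ℝ) : ℂ) * w' =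
      ((‖z‖ ^ 2 : ℝ) : ℂ) * (w - w') + (((‖z‖ - ‖z'‖) * (‖z‖ + ‖z'‖) : ℝ) : ℂ) * w' := by
    push_cast; ring
  rw [e]
  refine (norm_add_le _ _).trans ?_
  rw [norm_mul, norm_mul, Complex.norm_real, Complex.norm_real, norm_mul,
    Real.norm_of_nonneg (by positivity), Real.norm_of_nonneg (by positivity : 0 ≤ ‖z‖ + ‖z'‖)]
  have h1 : ‖‖z‖ - ‖z'‖‖ ≤ ‖z - z'‖ := abs_norm_sub_norm_le z z'
  have h2 : ‖z‖ ^ 2 ≤ a ^ 2 := pow_le_pow_left₀ (norm_nonneg _) hz 2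
  have h3 : ‖‖z‖ - ‖z'‖‖ * (‖z‖ + ‖z'‖) * ‖w'‖ ≤ ‖z - z'‖ * (a + a) * a := by gcongr
  have h4 := mul_le_mul_of_nonneg_right h2 (norm_nonneg (w - w'))
  linarith

theorem norm_cub_sub_le {a : ℝ} {z z' w w' : L2} (hz : Bdd a z) (hz' : Bdd a z')
    (hw' : Bdd a w') :
    ‖cub z w - cub z' w'‖ ≤ 2 * a ^ 2 * ‖z - z'‖ + a ^ 2 * ‖w - w'‖ := by
  have := norm_le_sum_of_ae_le (F := cub z w - cub z' w') (A := ![z - z', w - w'])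
    (c := ![2 * a ^ 2, a ^ 2]) (by intro i; fin_cases i <;> simp <;> positivity) (by
      filter_upwards [hz, hz', hw', coeFn_cub (w := w) hz, coeFn_cub (w := w') hz',
        Lp.coeFn_sub (cub z w) (cub z' w'), Lp.coeFn_sub z z', Lp.coeFn_sub w w']
        with x h1 h2 h3 h4 h5 h6 h7 h8
      simp only [Fin.sum_univ_two, Matrix.cons_val_zero, Matrix.cons_val_one]
      rw [h6, h7, h8, Pi.sub_apply, Pi.sub_apply, Pi.sub_apply, h4, h5]
      exact norm_cub_sub_le_pointwise h1 h2 h3)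
  simpa [Fin.sum_univ_two] using this

/-- Translation-Lipschitz functions. -/
def LipT (L : ℝ) (z : L2) : Prop := ∀ h : ℝ, ‖trans h z - z‖ ≤ L * |h|

theorem lipT_fourier {L : ℝ} {f : L2} : LipT L (𝓕 f : L2) ↔ LipW L f := by
  simp only [LipT, LipW, norm_trans_fourier_sub]

theorem LipT.fourierInv {L : ℝ} {z : L2} (h : LipT L z) : LipW L (𝓕⁻ z : L2) := by
  rw [← lipT_fourier, FourierTransform.fourier_fourierInv_eq]
  exact h

theorem ae_trans {p : ℝ → Prop} (hp : ∀ᵐ ξ, p ξ) (h : ℝ) : ∀ᵐ ξ : ℝ, p (ξ - h) :=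
  (measurePreserving_sub_right (volume : Measure ℝ) h).quasiMeasurePreserving.ae hp

/-- A factorization of `|w|² v` when `w = p + z`, `v = q + y` and `p q = 0`. -/
theorem cub_eq_of_mul_eq_zero {p q z y w v : ℂ} (hw : w = p + z) (hv : v = q + y) (hpq : p * q = 0) :
    ((‖w‖ ^ 2 : ℝ) : ℂ) * v = (starRingEnd ℂ) w * (p * y + z * v) := by
  have h1 : ((‖w‖ ^ 2 : ℝ) : ℂ) = (starRingEnd ℂ) w * w := by
    rw [← Complex.normSq_eq_conj_mul_self, Complex.normSq_eq_norm_sq]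
  have h2 : w * v = p * y + z * v := by
    rw [hw, hv]; linear_combination hpq
  rw [h1, mul_assoc, h2]

/-- With `p q = 0` one has `w v = p y + z v`, so a remainder `z` or `y` can always be put in `L²`
and the two other factors in `L^∞`. -/
theorem norm_cub_le_of_mul_eq_zero {a : ℝ} {p q z y w v : L2} (hw : w = p + z) (hv : v = q + y)
    (hpq : ∀ᵐ ξ, p ξ * q ξ = 0) (hwb : Bdd a w) (hvb : Bdd a v) (hpb : Bdd a p) :
    ‖cub w v‖ ≤ a ^ 2 * (‖z‖ + ‖y‖) := by
  have ha := hwb.nonneg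
  have := norm_le_sum_of_ae_le (F := cub w v) (A := ![z, y])
    (c := ![a ^ 2, a ^ 2]) (by intro i; fin_cases i <;> simp <;> positivity) (by
      filter_upwards [hwb, hvb, hpb, hpq, coeFn_cub (w := v) hwb, Lp.coeFn_add p z,
        Lp.coeFn_add q y] with x h1 h2 h3 h4 h5 h6 h7
      rw [← hw] at h6
      rw [← hv] at h7
      simp only [Fin.sum_univ_two, Matrix.cons_val_zero, Matrix.cons_val_one]
      rw [h5, cub_eq_of_mul_eq_zero h6 h7 h4, norm_mul, RCLike.norm_conj]
      have h8 : ‖p x * y x + z x * v x‖ ≤ a * ‖y x‖ + ‖z x‖ * a := by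
        refine (norm_add_le _ _).trans ?_
        rw [norm_mul, norm_mul]
        gcongr
      calc _ ≤ a * (a * ‖y x‖ + ‖z x‖ * a) := by gcongr
        _ = _ := by ring)
  simp only [Fin.sum_univ_two, Matrix.cons_val_zero, Matrix.cons_val_one] at this
  linarith

/-- A discrete Leibniz rule: the difference is telescoped so that it falls on one factor at a time.
If it falls on a remainder, the other factors cost `a²`; otherwise a remainder is still present and
contributes `ε`. -/
theorem norm_diff_le_pointwise {a ε : ℝ} {p z y w v p' z' y' w' v' : ℂ}
    (hw : ‖w‖ ≤ a) (hp : ‖p‖ ≤ a) (hz : ‖z‖ ≤ ε)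
    (hv' : ‖v'‖ ≤ a) (hp' : ‖p'‖ ≤ a) (hz' : ‖z'‖ ≤ ε) (hy' : ‖y'‖ ≤ ε) :
    ‖(starRingEnd ℂ) w' * (p' * y' + z' * v') - (starRingEnd ℂ) w * (p * y + z * v)‖ ≤
      2 * a * ε * ‖w' - w‖ + a * ε * ‖p' - p‖ + a ^ 2 * ‖y' - y‖ + a ^ 2 * ‖z' - z‖
        + a * ε * ‖v' - v‖ := by
  have ha : 0 ≤ a := (norm_nonneg _).trans hw
  have hε : 0 ≤ ε := (norm_nonneg _).trans hz
  have e : (starRingEnd ℂ) w' * (p' * y' + z' * v') - (starRingEnd ℂ) w * (p * y + z * v) =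
      (starRingEnd ℂ) (w' - w) * (p' * y' + z' * v') + (starRingEnd ℂ) w *
        ((p' - p) * y' + p * (y' - y) + (z' - z) * v' + z * (v' - v)) := by
    rw [map_sub]; ring
  rw [e]
  have h1 : ‖p' * y' + z' * v'‖ ≤ a * ε + ε * a := by
    refine (norm_add_le _ _).trans ?_
    rw [norm_mul, norm_mul]
    gcongr
  have h2 : ‖(p' - p) * y' + p * (y' - y) + (z' - z) * v' + z * (v' - v)‖ ≤
      ‖p' - p‖ * ε + a * ‖y' - y‖ + ‖z' - z‖ * a + ε * ‖v' - v‖ := by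
    refine (norm_add₄_le).trans ?_
    rw [norm_mul, norm_mul, norm_mul, norm_mul]
    gcongr
  refine (norm_add_le _ _).trans ?_
  rw [norm_mul, norm_mul, RCLike.norm_conj, RCLike.norm_conj]
  calc _ ≤ ‖w' - w‖ * (a * ε + ε * a) +
        a * (‖p' - p‖ * ε + a * ‖y' - y‖ + ‖z' - z‖ * a + ε * ‖v' - v‖) := by gcongr
    _ = _ := by ring

theorem lipT_cub_of_mul_eq_zero {a ε : ℝ} {p q z y w v : L2} (hw : w = p + z) (hv : v = q + y)
    (hpq : ∀ᵐ ξ, p ξ * q ξ = 0) (hwb : Bdd a w) (hvb : Bdd a v) (hpb : Bdd a p)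
    (hzb : Bdd ε z) (hyb : Bdd ε y) {Lp' Lw Lv Lz Ly : ℝ} (hLp : LipT Lp' p) (hLw : LipT Lw w)
    (hLv : LipT Lv v) (hLz : LipT Lz z) (hLy : LipT Ly y) :
    LipT (a ^ 2 * (Lz + Ly) + a * ε * (2 * Lw + Lp' + Lv)) (cub w v) := by
  intro h
  have ha := hwb.nonneg
  have hε := hzb.nonneg
  have hcub : ∀ᵐ x, cub w v x = (starRingEnd ℂ) (w x) * (p x * y x + z x * v x) := by
    filter_upwards [hpq, coeFn_cub (w := v) hwb, Lp.coeFn_add p z,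
        Lp.coeFn_add q y] with x h4 h5 h6 h7
    rw [← hw] at h6
    rw [← hv] at h7
    rw [h5, cub_eq_of_mul_eq_zero h6 h7 h4]
  have := norm_le_sum_of_ae_le (F := trans h (cub w v) - cub w v)
    (A := ![trans h w - w, trans h p - p, trans h y - y, trans h z - z, trans h v - v])
    (c := ![2 * a * ε, a * ε, a ^ 2, a ^ 2, a * ε])
    (by intro i; fin_cases i <;> simp <;> positivity) (by
      have hd : ∀ g : L2, ∀ᵐ x, (trans h g - g : L2) x = g (x - h) - g x := fun g => by
        filter_upwards [Lp.coeFn_sub (trans h g) g, coeFn_trans h g] with x h1 h2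
        rw [h1, Pi.sub_apply, h2]
      filter_upwards [hwb, hpb, hzb, ae_trans hvb h, ae_trans hpb h, ae_trans hzb h,
        ae_trans hyb h, hd w, hd p, hd y, hd z, hd v, hd (cub w v), hcub, ae_trans hcub h]
        with x h1 h2 h3 h4 h5 h6 h7 d1 d2 d3 d4 d5 d6 c1 c2
      simp only [Fin.sum_univ_five, Matrix.cons_val]
      rw [d1, d2, d3, d4, d5, d6, c1, c2]
      exact norm_diff_le_pointwise h1 h2 h3 h4 h5 h6 h7)
  simp only [Fin.sum_univ_five, Matrix.cons_val] at this
  refine this.trans ?_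
  have i1 := mul_le_mul_of_nonneg_left (hLw h) (by positivity : 0 ≤ 2 * a * ε)
  have i2 := mul_le_mul_of_nonneg_left (hLp h) (by positivity : 0 ≤ a * ε)
  have i3 := mul_le_mul_of_nonneg_left (hLy h) (by positivity : 0 ≤ a ^ 2)
  have i4 := mul_le_mul_of_nonneg_left (hLz h) (by positivity : 0 ≤ a ^ 2)
  have i5 := mul_le_mul_of_nonneg_left (hLv h) (by positivity : 0 ≤ a * ε)
  linarith

/-! ### The profile equation -/

/-- The map `f ↦ 𝓕 M(t) f`. -/
def E (t : ℝ) : L2 →ₗᵢ[ℂ] L2 :=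
  (Lp.fourierTransformₗᵢ ℝ ℂ).toLinearIsometry.comp (phase (quadPhase t))

theorem E_apply (t : ℝ) (f : L2) : E t f = 𝓕 (phase (quadPhase t) f) := rfl

theorem lipT_E {t L : ℝ} {f : L2} (h : LipW L f) : LipT L (E t f) := by
  rw [E_apply, lipT_fourier]
  exact h.phase _

theorem tendsto_quadPhase {t : ℝ} (ht : 0 < t) {ι : Type*} {l : Filter ι} {τ : ι → ℝ}
    (hτ : Tendsto τ l (𝓝 t)) (x : ℝ) :
    Tendsto (fun i => quadPhase (τ i) x) l (𝓝 (quadPhase t x)) := by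
  simp only [quadPhase, ContinuousMap.coe_mk]
  exact tendsto_const_nhds.div (hτ.const_mul 2) (by positivity)

theorem tendsto_E {t : ℝ} (ht : 0 < t) {ι : Type*} {l : Filter ι} [l.IsCountablyGenerated]
    {τ : ι → ℝ} (hτ : Tendsto τ l (𝓝 t)) {f : ι → L2} {f₀ : L2} (hf : Tendsto f l (𝓝 f₀)) :
    Tendsto (fun i => E (τ i) (f i)) l (𝓝 (E t f₀)) :=
  ((Lp.fourierTransformₗᵢ ℝ ℂ).continuous.tendsto _).comp
    (tendsto_phase_apply (tendsto_quadPhase ht hτ) hf)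

/-- The nonlinearity `U(-t) (|U(t) f|² U(t) g)` of the profile equation. -/
def G (t : ℝ) (f g : L2) : L2 :=
  ((2 * Real.pi * t)⁻¹ : ℝ) • phase (-quadPhase t) (𝓕⁻ (cub (E t f) (E t g)))

theorem norm_fourierInv_sub (f g : L2) : ‖(𝓕⁻ f : L2) - 𝓕⁻ g‖ = ‖f - g‖ := by
  rw [← (Lp.fourierTransformₗᵢ ℝ ℂ).symm.norm_map (f - g), map_sub]
  rfl

theorem norm_fourierInv (f : L2) : ‖(𝓕⁻ f : L2)‖ = ‖f‖ :=
  (Lp.fourierTransformₗᵢ ℝ ℂ).symm.norm_map f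

/-- Every operation in `G` other than the cubic product is an isometry or the scalar `(2πt)⁻¹`. -/
theorem norm_G_sub_le {t a : ℝ} (ht : 0 < t) {f f' g g' : L2} (hf : Bdd a (E t f))
    (hf' : Bdd a (E t f')) (hg' : Bdd a (E t g')) :
    ‖G t f g - G t f' g'‖ ≤
      (2 * Real.pi * t)⁻¹ * (2 * a ^ 2 * ‖f - f'‖ + a ^ 2 * ‖g - g'‖) := by
  have hpi := Real.pi_pos
  rw [G, G, ← smul_sub, norm_smul, Real.norm_of_nonneg (by positivity), ← map_sub,
    LinearIsometry.norm_map, norm_fourierInv_sub]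
  refine mul_le_mul_of_nonneg_left ?_ (by positivity)
  have := norm_cub_sub_le hf hf' hg' (w := E t g)
  rwa [← map_sub, ← map_sub, LinearIsometry.norm_map, LinearIsometry.norm_map] at this

theorem norm_G_le {t c : ℝ} (ht : 0 < t) {f g : L2} (h : ‖cub (E t f) (E t g)‖ ≤ c) :
    ‖G t f g‖ ≤ (2 * Real.pi * t)⁻¹ * c := by
  have hpi := Real.pi_pos
  rw [G, norm_smul, Real.norm_of_nonneg (by positivity), LinearIsometry.norm_map, norm_fourierInv]
  exact mul_le_mul_of_nonneg_left h (by positivity)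

theorem lipW_G {t L : ℝ} (ht : 0 < t) {f g : L2} (h : LipT L (cub (E t f) (E t g))) :
    LipW ((2 * Real.pi * t)⁻¹ * L) (G t f g) := by
  have hpi := Real.pi_pos
  have := (h.fourierInv.phase (-quadPhase t)).smul ((2 * Real.pi * t)⁻¹)
  rwa [abs_of_pos (by positivity)] at this

/-- Phases are only strongly continuous in `t`; this suffices, since the sup bounds make the cubic
product Lipschitz in `L²`. -/
theorem tendsto_G {t a : ℝ} (ht : 0 < t) {ι : Type*} {l : Filter ι} [l.IsCountablyGenerated]
    {τ : ι → ℝ} (hτ : Tendsto τ l (𝓝 t)) {f g : ι → L2} {f₀ g₀ : L2} (hf : Tendsto f l (𝓝 f₀))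
    (hg : Tendsto g l (𝓝 g₀)) (hfb : ∀ᶠ i in l, Bdd a (E (τ i) (f i))) (hf₀ : Bdd a (E t f₀))
    (hg₀ : Bdd a (E t g₀)) : Tendsto (fun i => G (τ i) (f i) (g i)) l (𝓝 (G t f₀ g₀)) := by
  have h1 : Tendsto (fun i => cub (E (τ i) (f i)) (E (τ i) (g i))) l
      (𝓝 (cub (E t f₀) (E t g₀))) := by
    rw [tendsto_iff_norm_sub_tendsto_zero]
    have h2 : Tendsto (fun i => 2 * a ^ 2 * ‖E (τ i) (f i) - E t f₀‖ +
        a ^ 2 * ‖E (τ i) (g i) - E t g₀‖) l (𝓝 (2 * a ^ 2 * 0 + a ^ 2 * 0)) :=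
      ((tendsto_iff_norm_sub_tendsto_zero.1 (tendsto_E ht hτ hf)).const_mul _).add
        ((tendsto_iff_norm_sub_tendsto_zero.1 (tendsto_E ht hτ hg)).const_mul _)
    simp only [mul_zero, add_zero] at h2
    refine squeeze_zero' (Eventually.of_forall fun _ => norm_nonneg _) ?_ h2
    filter_upwards [hfb] with i hi
    exact norm_cub_sub_le hi hf₀ hg₀
  refine Tendsto.smul (Tendsto.inv₀ (hτ.const_mul _) (by positivity)) ?_
  refine tendsto_phase_apply (fun x => ?_)
    (((Lp.fourierTransformₗᵢ ℝ ℂ).symm.continuous.tendsto _).comp h1)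
  simpa using (tendsto_quadPhase ht hτ x).neg

/-! ### The free group and the nonlinearity in profile variables -/

theorem U_neg_U (t : ℝ) (f : L2) : U (-t) (U t f) = f := by
  rw [U_eq, U_eq, FourierTransform.fourier_fourierInv_eq, phase_phase]
  have : freqPhase (-t) + freqPhase t = 0 := by
    ext ξ; simp [freqPhase]
  rw [this, phase_zero, FourierTransform.fourierInv_fourier_eq]

theorem U_U_neg (t : ℝ) (f : L2) : U t (U (-t) f) = f := by
  simpa using U_neg_U (-t) f

theorem U_sub (t : ℝ) (f g : L2) : U t (f - g) = U t f - U t g := by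
  rw [U_eq, U_eq, U_eq]
  have h1 := (Lp.fourierTransformₗᵢ ℝ ℂ).map_sub f g
  have h2 := (Lp.fourierTransformₗᵢ ℝ ℂ).symm.map_sub (phase (freqPhase t) (𝓕 f))
    (phase (freqPhase t) (𝓕 g))
  change (𝓕 (f - g) : L2) = 𝓕 f - 𝓕 g at h1
  rw [h1, map_sub]
  exact h2

theorem norm_U (t : ℝ) (f : L2) : ‖U t f‖ = ‖f‖ := by
  rw [U_eq, norm_fourierInv, LinearIsometry.norm_map, Lp.norm_fourier_eq]

theorem coeFn_U {t : ℝ} (ht : 0 < t) (f : L2) : U t f =ᵐ[volume] fun x =>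
    fresnel t * (Complex.exp ((quadPhase t x : ℂ) * Complex.I) *
      E t f ((2 * Real.pi * t)⁻¹ * x)) := by
  rw [U_factorization ht, ← E_apply]
  filter_upwards [Lp.coeFn_smul (fresnel t) (phase (quadPhase t)
      (dil (2 * Real.pi * t)⁻¹ (dil_ne ht) (E t f))), coeFn_phase (quadPhase t)
      (dil (2 * Real.pi * t)⁻¹ (dil_ne ht) (E t f)), coeFn_dil (dil_ne ht) (E t f)]
    with x h1 h2 h3
  rw [h1, Pi.smul_apply, h2, h3, smul_eq_mul]

/-- By the factorization, `U t f` is a constant times a chirp times the dilated `E t f`. The chirp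
drops out of `|U f_k|²`, and the squared modulus of the constant is exactly the `(2πt)⁻¹` in `G`. -/
theorem N_U_ae_eq {t a : ℝ} (ht : 0 < t) (f : Fin 2 → L2) (j : Fin 2)
    (h : Bdd a (E t (f (1 - j)))) :
    N (fun k => U t (f k)) j =ᵐ[volume] U t (G t (f (1 - j)) (f j)) := by
  have hE : E t (G t (f (1 - j)) (f j)) =
      ((2 * Real.pi * t)⁻¹ : ℝ) • cub (E t (f (1 - j))) (E t (f j)) := by
    have h1 : phase (quadPhase t) (G t (f (1 - j)) (f j)) = ((2 * Real.pi * t)⁻¹ : ℝ) •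
        (𝓕⁻ (cub (E t (f (1 - j))) (E t (f j))) : L2) := by
      rw [G]
      refine ((phase (quadPhase t)).toLinearMap.map_smul_of_tower _ _).trans ?_
      simp only [LinearIsometry.coe_toLinearMap, phase_phase_neg]
    rw [E_apply, h1]
    refine ((Lp.fourierTransformₗᵢ ℝ ℂ).toLinearEquiv.toLinearMap.map_smul_of_tower _ _).trans ?_
    congr 1
    exact (Lp.fourierTransformₗᵢ ℝ ℂ).apply_symm_apply _
  filter_upwards [coeFn_U ht (f (1 - j)), coeFn_U ht (f j), coeFn_U ht (G t (f (1 - j)) (f j)),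
    (quasiMeasurePreserving_mul (dil_ne ht)).ae_eq_comp (coeFn_cub (w := E t (f j)) h),
    (quasiMeasurePreserving_mul (dil_ne ht)).ae_eq_comp (Lp.coeFn_smul ((2 * Real.pi * t)⁻¹ : ℝ)
      (cub (E t (f (1 - j))) (E t (f j))))] with x h1 h2 h3 h4 h5
  simp only [Function.comp_apply, Pi.smul_apply] at h4 h5
  rw [N, h1, h2, h3, hE, h5, h4, norm_mul, norm_mul, Complex.norm_exp_ofReal_mul_I, one_mul,
    mul_pow, norm_fresnel_sq ht, Complex.real_smul]
  push_cast
  ring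

/-! ### Weak and strong forms of the equation -/

theorem inner_phase_left (θ : C(ℝ, ℝ)) (f g : L2) :
    inner ℂ (phase θ f) g = inner ℂ f (phase (-θ) g) := by
  rw [← LinearIsometry.inner_map_map (phase (-θ)) (phase θ f) g, phase_neg_phase]

theorem freqPhase_neg (t : ℝ) : freqPhase (-t) = -freqPhase t := by
  ext ξ; simp [freqPhase]

theorem fourier_U (t : ℝ) (f : L2) : (𝓕 (U t f) : L2) = phase (freqPhase t) (𝓕 f) := by
  rw [U_eq]
  exact FourierTransform.fourier_fourierInv_eq _

/-- The frequency-side test vector `conj (𝓕⁻ φ)`. -/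
def testVec (φ : 𝓢(ℝ, ℂ)) : L2 := star ((𝓕⁻ φ).toLp 2)

theorem coeFn_testVec (φ : 𝓢(ℝ, ℂ)) :
    testVec φ =ᵐ[volume] fun ξ => (starRingEnd ℂ) ((𝓕⁻ φ) ξ) := by
  filter_upwards [Lp.coeFn_star ((𝓕⁻ φ).toLp 2 volume), (𝓕⁻ φ).coeFn_toLp 2] with ξ h1 h2
  rw [testVec, h1, Pi.star_apply, h2]
  rfl

theorem inner_testVec (φ : 𝓢(ℝ, ℂ)) (g : L2) :
    inner ℂ (testVec φ) (𝓕 g) = ∫ x, g x * φ x := by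
  have h := integral_mul_fourier g (𝓕⁻ φ)
  rw [FourierTransform.fourier_fourierInv_eq] at h
  rw [L2.inner_def]
  calc _ = ∫ x, (𝓕⁻ φ) x * (𝓕 g : L2) x := by
        apply integral_congr_ae
        filter_upwards [coeFn_testVec φ] with x hx
        rw [hx, RCLike.inner_apply, RCLike.conj_conj, mul_comm]
    _ = _ := by
        rw [h]
        simp only [mul_comm]

theorem fourierInv_deriv_deriv (φ : 𝓢(ℝ, ℂ)) (ξ : ℝ) :
    (𝓕⁻ (SchwartzMap.derivCLM ℂ ℂ (SchwartzMap.derivCLM ℂ ℂ φ))) ξ =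
      -(4 * Real.pi ^ 2 * ξ ^ 2) * (𝓕⁻ φ) ξ := by
  have h : ∀ (φ : 𝓢(ℝ, ℂ)) (ξ : ℝ), (𝓕⁻ (SchwartzMap.derivCLM ℂ ℂ φ)) ξ =
      -(2 * Real.pi * Complex.I * ξ) * (𝓕⁻ φ) ξ := by
    intro φ ξ
    have hd : ((SchwartzMap.derivCLM ℂ ℂ φ : 𝓢(ℝ, ℂ)) : ℝ → ℂ) = deriv φ := by
      ext x; exact SchwartzMap.derivCLM_apply (𝕜 := ℂ) φ x
    rw [SchwartzMap.fourierInv_coe, SchwartzMap.fourierInv_coe, hd,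
      Real.fourierInv_eq_fourier_neg, Real.fourierInv_eq_fourier_neg,
      Real.fourier_deriv φ.integrable φ.differentiable
        (hd ▸ (SchwartzMap.derivCLM ℂ ℂ φ).integrable)]
    simp
  rw [h, h]
  linear_combination (4 * Real.pi ^ 2 * ξ ^ 2) * (𝓕⁻ φ) ξ * Complex.I_sq

theorem coeFn_testVec_deriv_deriv (φ : 𝓢(ℝ, ℂ)) :
    testVec (SchwartzMap.derivCLM ℂ ℂ (SchwartzMap.derivCLM ℂ ℂ φ)) =ᵐ[volume]
      fun ξ => -(4 * Real.pi ^ 2 * ξ ^ 2) * testVec φ ξ := by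
  filter_upwards [coeFn_testVec φ,
    coeFn_testVec (SchwartzMap.derivCLM ℂ ℂ (SchwartzMap.derivCLM ℂ ℂ φ))] with ξ h1 h2
  rw [h2, h1, fourierInv_deriv_deriv, map_mul, map_neg]
  congr 2
  rw [← Complex.ofReal_pow, ← Complex.ofReal_pow, map_mul, map_mul, Complex.conj_ofReal,
    Complex.conj_ofReal]
  congr 2
  exact Complex.conj_ofReal 4

theorem norm_exp_sub_exp_le (a b : ℝ) :
    ‖Complex.exp ((a : ℂ) * Complex.I) - Complex.exp ((b : ℂ) * Complex.I)‖ ≤ |a - b| := by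
  have e : Complex.exp ((a : ℂ) * Complex.I) - Complex.exp ((b : ℂ) * Complex.I) =
      Complex.exp ((b : ℂ) * Complex.I) *
        (Complex.exp (Complex.I * ((a - b : ℝ) : ℂ)) - 1) := by
    rw [mul_sub, mul_one, ← Complex.exp_add]
    congr 2
    push_cast
    ring
  rw [e, norm_mul, Complex.norm_exp_ofReal_mul_I, one_mul]
  exact Real.norm_exp_I_mul_ofReal_sub_one_le

/-- The derivative in `L²` of the free evolution on the frequency side. Here `K₂ = -4 π² ξ² K`. -/
theorem hasDerivAt_phase_freqPhase {K K₂ : L2}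
    (hK : K₂ =ᵐ[volume] fun ξ => -(4 * Real.pi ^ 2 * ξ ^ 2) * K ξ) (t : ℝ) :
    HasDerivAt (fun τ => phase (freqPhase τ) K)
      ((Complex.I / 2) • phase (freqPhase t) K₂) t := by
  rw [hasDerivAt_iff_tendsto_slope, ← tendsto_sub_nhds_zero_iff]
  refine tendsto_zero_of_dominated
    (k := fun τ ξ => ((τ - t)⁻¹ : ℝ) * (Complex.exp ((freqPhase τ ξ : ℂ) * Complex.I) * K ξ -
      Complex.exp ((freqPhase t ξ : ℂ) * Complex.I) * K ξ) - (Complex.I / 2) *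
      (Complex.exp ((freqPhase t ξ : ℂ) * Complex.I) * K₂ ξ)) (b := fun ξ => ‖K₂ ξ‖) ?_
    (Lp.memLp K₂).norm ?_ ?_
  · intro τ
    rw [slope, vsub_eq_sub]
    filter_upwards [Lp.coeFn_sub (((τ - t)⁻¹ : ℝ) • (phase (freqPhase τ) K - phase (freqPhase t) K))
        ((Complex.I / 2) • phase (freqPhase t) K₂),
      Lp.coeFn_smul ((τ - t)⁻¹ : ℝ) (phase (freqPhase τ) K - phase (freqPhase t) K),
      Lp.coeFn_smul (Complex.I / 2) (phase (freqPhase t) K₂),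
      Lp.coeFn_sub (phase (freqPhase τ) K) (phase (freqPhase t) K),
      coeFn_phase (freqPhase τ) K, coeFn_phase (freqPhase t) K, coeFn_phase (freqPhase t) K₂]
      with ξ h1 h2 h3 h4 h5 h6 h7
    rw [h1, Pi.sub_apply, h2, h3, Pi.smul_apply, Pi.smul_apply, h4, Pi.sub_apply, h5, h6, h7,
      Complex.real_smul, smul_eq_mul]
  · filter_upwards [self_mem_nhdsWithin] with τ hτ
    filter_upwards [hK] with ξ hξ
    have hne : τ - t ≠ 0 := sub_ne_zero.2 hτ
    have h1 := norm_exp_sub_exp_le (freqPhase τ ξ) (freqPhase t ξ)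
    have h2 : |freqPhase τ ξ - freqPhase t ξ| = |τ - t| * (2 * Real.pi ^ 2 * ξ ^ 2) := by
      have : freqPhase τ ξ - freqPhase t ξ = -((τ - t) * (2 * Real.pi ^ 2 * ξ ^ 2)) := by
        simp only [freqPhase, ContinuousMap.coe_mk]; ring
      rw [this, abs_neg, abs_mul, abs_of_nonneg (by positivity : 0 ≤ 2 * Real.pi ^ 2 * ξ ^ 2)]
    have h3 : ‖K₂ ξ‖ = 4 * Real.pi ^ 2 * ξ ^ 2 * ‖K ξ‖ := by
      have e : (-(4 * Real.pi ^ 2 * ξ ^ 2) : ℂ) = ((-(4 * Real.pi ^ 2 * ξ ^ 2) : ℝ) : ℂ) := by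
        push_cast; ring
      rw [hξ, norm_mul, e, Complex.norm_real, norm_neg, Real.norm_of_nonneg (by positivity)]
    refine (norm_sub_le _ _).trans ?_
    rw [← sub_mul, norm_mul, norm_mul, norm_mul, norm_mul, Complex.norm_exp_ofReal_mul_I, one_mul,
      Complex.norm_real, norm_inv, Real.norm_eq_abs]
    rw [h2] at h1
    have h4 : |τ - t|⁻¹ * (‖Complex.exp ((freqPhase τ ξ : ℂ) * Complex.I) -
        Complex.exp ((freqPhase t ξ : ℂ) * Complex.I)‖ * ‖K ξ‖) ≤
        |τ - t|⁻¹ * ((|τ - t| * (2 * Real.pi ^ 2 * ξ ^ 2)) * ‖K ξ‖) := by gcongr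
    rw [mul_assoc |τ - t|, inv_mul_cancel_left₀ (abs_ne_zero.2 hne)] at h4
    have h5 : ‖(Complex.I / 2 : ℂ)‖ = 1 / 2 := by simp
    rw [h5]
    linarith
  · filter_upwards [hK] with ξ hξ
    have hd : HasDerivAt (fun τ : ℝ => Complex.exp ((freqPhase τ ξ : ℂ) * Complex.I) * K ξ)
        ((Complex.I / 2) * (Complex.exp ((freqPhase t ξ : ℂ) * Complex.I) * K₂ ξ)) t := by
      have h1 : HasDerivAt (fun τ : ℝ => freqPhase τ ξ) (-(2 * Real.pi ^ 2 * 1 * ξ ^ 2)) t := by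
        simp only [freqPhase, ContinuousMap.coe_mk]
        exact ((((hasDerivAt_id t).const_mul (2 * Real.pi ^ 2)).mul_const (ξ ^ 2))).neg
      have h2 := ((h1.ofReal_comp.mul_const Complex.I).cexp).mul_const (K ξ)
      refine h2.congr_deriv ?_
      rw [hξ]
      push_cast
      ring
    have h3 := tendsto_sub_nhds_zero_iff.2 hd.tendsto_slope
    refine h3.congr fun τ => ?_
    rw [slope, vsub_eq_sub, Complex.real_smul]

/-- The free group is moved onto the test vector, where it is differentiable in `L²` because the
vector has two moments in frequency. The pairing is then an inner product of two differentiable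
curves. -/
theorem isSolution_of_hasDerivWithinAt {T : ℝ} (hT : 0 < T) {f : Fin 2 → ℝ → L2}
    (hb : ∀ t, T ≤ t → ∃ a, ∀ k, Bdd a (E t (f k t)))
    (hf : ∀ j t, T ≤ t → HasDerivWithinAt (f j) (-G t (f (1 - j) t) (f j t)) (Ici T) t) :
    IsSolution T (fun j t => U t (f j t)) := by
  intro j φ t ht
  obtain ⟨a, ha⟩ := hb t ht
  have hN := N_U_ae_eq (hT.trans_le ht) (fun k => f k t) j (ha _)
  set g := G t (f (1 - j) t) (f j t) with hg
  have hint : Integrable fun x => U t g x * φ x :=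
    (Lp.memLp (U t g)).integrable_mul (φ.memLp 2 volume)
  have hNφ : (fun x => N (fun k => U t (f k t)) j x * φ x) =ᵐ[volume] fun x => U t g x * φ x := by
    filter_upwards [hN] with x hx
    rw [hx]
  refine ⟨hint.congr hNφ.symm, ?_⟩
  have hpair : ∀ (φ : 𝓢(ℝ, ℂ)) τ (h : L2), ∫ x, U τ h x * φ x =
      inner ℂ (phase (freqPhase (-τ)) (testVec φ)) (𝓕 h : L2) := by
    intro φ τ h
    rw [← inner_testVec, fourier_U, inner_phase_left, freqPhase_neg, neg_neg]
  have hd1 : HasDerivWithinAt (fun τ => phase (freqPhase (-τ)) (testVec φ))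
      (-((Complex.I / 2) • phase (freqPhase (-t))
        (testVec (SchwartzMap.derivCLM ℂ ℂ (SchwartzMap.derivCLM ℂ ℂ φ))))) (Ici T) t := by
    have h1 := (hasDerivAt_phase_freqPhase (coeFn_testVec_deriv_deriv φ) (-t)).scomp t
      (hasDerivAt_neg t)
    simpa [Function.comp_def] using h1.hasDerivWithinAt (s := Ici T)
  have hd2 : HasDerivWithinAt (fun τ => (𝓕 (f j τ) : L2)) (-(𝓕 g : L2)) (Ici T) t := by
    have h1 := ((Lp.fourierTransformₗᵢ ℝ ℂ).toContinuousLinearEquiv.toContinuousLinearMap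
      |>.restrictScalars ℝ).hasFDerivAt.comp_hasDerivWithinAt t (hf j t ht)
    have h2 : (Lp.fourierTransformₗᵢ ℝ ℂ) (-g) = -(𝓕 g : L2) := (Lp.fourierTransformₗᵢ ℝ ℂ).map_neg g
    rw [← h2]
    exact h1
  have hd := hd1.inner ℂ hd2
  refine ⟨_, (hd.congr (fun τ _ => hpair φ τ _) (hpair φ t _)), ?_⟩
  have hd3 : ∫ x, U t (f j t) x * deriv (deriv φ) x = ∫ x, U t (f j t) x *
      (SchwartzMap.derivCLM ℂ ℂ (SchwartzMap.derivCLM ℂ ℂ φ)) x := rfl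
  rw [integral_congr_ae hNφ, hpair, hd3, hpair, inner_neg_right, inner_neg_left, inner_smul_left]
  simp only [map_div₀, Complex.conj_I, map_ofNat]
  linear_combination (1 / 2) * inner ℂ (phase (freqPhase (-t))
    (testVec (SchwartzMap.derivCLM ℂ ℂ (SchwartzMap.derivCLM ℂ ℂ φ)))) (𝓕 (f j t) : L2) *
      Complex.I_sq

/-- A product rule in which `Y` is differentiable only when paired with the frozen vector `X t`.
Continuity of `Y` suffices for the other term, whose slope is the slope of `X` paired with `Y τ`. -/
theorem hasDerivWithinAt_inner_of_continuous {X Y : ℝ → L2} {X' : L2} {d : ℂ} {s : Set ℝ} {t : ℝ}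
    (hX : HasDerivWithinAt X X' s t) (hY : ContinuousWithinAt Y s t)
    (h : HasDerivWithinAt (fun τ => inner ℂ (X t) (Y τ)) d s t) :
    HasDerivWithinAt (fun τ => inner ℂ (X τ) (Y τ)) (d + inner ℂ X' (Y t)) s t := by
  have h1 : HasDerivWithinAt (fun τ => inner ℂ (X τ - X t) (Y τ)) (inner ℂ X' (Y t)) s t := by
    rw [hasDerivWithinAt_iff_tendsto_slope] at hX ⊢
    have h2 := hX.inner (𝕜 := ℂ) (hY.mono_left (nhdsWithin_mono t (sdiff_subset (t := {t}))))
    refine h2.congr fun τ => ?_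
    rw [slope, slope, vsub_eq_sub, vsub_eq_sub, sub_self, inner_zero_left, sub_zero,
      RCLike.real_smul_eq_coe_smul (K := ℂ), inner_smul_left, RCLike.conj_ofReal,
      Complex.real_smul]
    rfl
  refine (h.add h1).congr (fun τ _ => ?_) ?_ <;> simp [inner_sub_left]

/-- The Schwartz function `𝓕 (exp(-i θ) γ)` for a real test function `γ`. -/
def phaseTest (θ : C(ℝ, ℝ)) (hθ : ContDiff ℝ (⊤ : ℕ∞) θ) {γ : ℝ → ℝ} (hγ : ContDiff ℝ (⊤ : ℕ∞) γ)
    (hc : HasCompactSupport γ) : 𝓢(ℝ, ℂ) :=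
  𝓕 (HasCompactSupport.toSchwartzMap
    (f := fun ξ : ℝ => Complex.exp (-(θ ξ : ℂ) * Complex.I) * (γ ξ : ℂ))
    ((hc.comp_left (g := Complex.ofReal) rfl).mul_left)
    (by
      have h1 : ContDiff ℝ (⊤ : ℕ∞) fun ξ : ℝ => (θ ξ : ℂ) := Complex.ofRealCLM.contDiff.comp hθ
      have h2 : ContDiff ℝ (⊤ : ℕ∞) fun ξ : ℝ => (γ ξ : ℂ) := Complex.ofRealCLM.contDiff.comp hγ
      exact ((h1.neg.mul contDiff_const).cexp).mul h2))

theorem testVec_phaseTest (θ : C(ℝ, ℝ)) (hθ : ContDiff ℝ (⊤ : ℕ∞) θ) {γ : ℝ → ℝ} (hγ : ContDiff ℝ (⊤ : ℕ∞) γ)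
    (hc : HasCompactSupport γ) {K : L2} (hK : K =ᵐ[volume] fun ξ => (γ ξ : ℂ)) :
    testVec (phaseTest θ hθ hγ hc) = phase θ K := by
  apply Lp.ext
  filter_upwards [coeFn_testVec (phaseTest θ hθ hγ hc), coeFn_phase θ K, hK] with ξ h1 h2 h3
  rw [h1, h2, h3, phaseTest, FourierTransform.fourierInv_fourier_eq]
  rw [HasCompactSupport.toSchwartzMap_toFun, map_mul, Complex.conj_ofReal, ← Complex.exp_conj]
  simp

theorem contDiff_freqPhase (t : ℝ) : ContDiff ℝ (⊤ : ℕ∞) (freqPhase t) := by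
  simp only [freqPhase, ContinuousMap.coe_mk]
  fun_prop

theorem tendsto_freqPhase {ι : Type*} {l : Filter ι} {τ : ι → ℝ} {t : ℝ} (h : Tendsto τ l (𝓝 t))
    (ξ : ℝ) : Tendsto (fun i => freqPhase (τ i) ξ) l (𝓝 (freqPhase t ξ)) := by
  have : Continuous fun τ => freqPhase τ ξ := by
    simp only [freqPhase, ContinuousMap.coe_mk]; fun_prop
  exact (this.tendsto t).comp h

/-- Undoes the free group inside the weak equation: the pairing of `K` with the profile is that of
the moving vector `phase (freqPhase τ) K` with `𝓕 (v j τ)`. The `∂ₓ²` term cancels the derivative of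
the moving vector. -/
theorem hasDerivWithinAt_inner_profile {T : ℝ} {v f g : Fin 2 → ℝ → L2} (hsol : IsSolution T v)
    (hvf : ∀ j t, v j t = U t (f j t)) (hf : ∀ j, ContinuousOn (f j) (Ici T))
    (hN : ∀ j t, T ≤ t → N (fun k => v k t) j =ᵐ[volume] U t (g j t)) (j : Fin 2)
    {γ : ℝ → ℝ} (hγ : ContDiff ℝ (⊤ : ℕ∞) γ) (hc : HasCompactSupport γ) {K : L2}
    (hK : K =ᵐ[volume] fun ξ => (γ ξ : ℂ)) {t : ℝ} (ht : T ≤ t) :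
    HasDerivWithinAt (fun τ => inner ℂ K (𝓕 (f j τ) : L2)) (-inner ℂ K (𝓕 (g j t) : L2))
      (Ici T) t := by
  have hUf : ∀ τ, (𝓕 (v j τ) : L2) = phase (freqPhase τ) (𝓕 (f j τ)) := fun τ => by
    rw [hvf, fourier_U]
  have hcont : ContinuousWithinAt (fun τ => (𝓕 (v j τ) : L2)) (Ici T) t := by
    simp only [hUf]
    exact tendsto_phase_apply (tendsto_freqPhase (tendsto_id.mono_left nhdsWithin_le_nhds))
      (((Lp.fourierTransformₗᵢ ℝ ℂ).continuous.tendsto _).comp (hf j t ht))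
  -- The test function depends on the time `t` at which one differentiates. It is Schwartz because
  -- `γ` is smooth with compact support.
  set φ := phaseTest (freqPhase t) (contDiff_freqPhase t) hγ hc with hφ
  have hφK : testVec φ = phase (freqPhase t) K := testVec_phaseTest _ _ hγ hc hK
  set φ₂ := SchwartzMap.derivCLM ℂ ℂ (SchwartzMap.derivCLM ℂ ℂ φ) with hφ₂
  set K₂ := phase (freqPhase (-t)) (testVec φ₂) with hK₂
  have hK₂e : K₂ =ᵐ[volume] fun ξ => -(4 * Real.pi ^ 2 * ξ ^ 2) * K ξ := by
    filter_upwards [coeFn_phase (freqPhase (-t)) (testVec φ₂), coeFn_testVec_deriv_deriv φ,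
      coeFn_phase (freqPhase t) K] with ξ h1 h2 h3
    rw [h1, h2, hφK, h3, freqPhase_neg]
    simp only [ContinuousMap.neg_apply, Complex.ofReal_neg]
    rw [mul_left_comm, ← mul_assoc (Complex.exp _) (Complex.exp _), ← Complex.exp_add]
    simp
  have hX := (hasDerivAt_phase_freqPhase hK₂e t).hasDerivWithinAt (s := Ici T)
  have hK₂t : phase (freqPhase t) K₂ = testVec φ₂ := by
    rw [hK₂, freqPhase_neg, phase_phase_neg]
  rw [hK₂t] at hX
  obtain ⟨-, d, hd, heq⟩ := hsol j φ t ht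
  have hd' : HasDerivWithinAt (fun τ => inner ℂ (phase (freqPhase t) K) (𝓕 (v j τ) : L2)) d
      (Ici T) t := by
    simp only [← hφK, inner_testVec]
    exact hd
  have hmain := hasDerivWithinAt_inner_of_continuous hX hcont hd'
  have hNint : ∫ x, N (fun k => v k t) j x * φ x = inner ℂ K (𝓕 (g j t) : L2) := by
    have : ∫ x, N (fun k => v k t) j x * φ x = ∫ x, U t (g j t) x * φ x := by
      apply integral_congr_ae
      filter_upwards [hN j t ht] with x hx
      rw [hx]
    rw [this, ← inner_testVec, hφK, fourier_U, LinearIsometry.inner_map_map]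
  have hd3 : ∫ x, v j t x * deriv (deriv φ) x = inner ℂ (testVec φ₂) (𝓕 (v j t) : L2) := by
    rw [inner_testVec]
    rfl
  rw [hNint, hd3] at heq
  refine (hmain.congr_deriv ?_).congr (fun τ _ => ?_) ?_
  · rw [inner_smul_left]
    simp only [map_div₀, Complex.conj_I, map_ofNat]
    linear_combination (-Complex.I) * heq + (d + inner ℂ K (𝓕 (g j t) : L2)) * Complex.I_sq
  · rw [hUf, LinearIsometry.inner_map_map]
  · rw [hUf, LinearIsometry.inner_map_map]

/-- Adding the primitive of the continuous curve `g j` to `f j` gives a curve whose pairings with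
all smooth compactly supported frequency functions are constant. Hence `f j` is itself a primitive
of `-g j`, differentiable in norm. -/
theorem hasDerivWithinAt_of_isSolution {T : ℝ} {v f g : Fin 2 → ℝ → L2} (hsol : IsSolution T v)
    (hvf : ∀ j t, v j t = U t (f j t)) (hf : ∀ j, ContinuousOn (f j) (Ici T))
    (hg : ∀ j, ContinuousOn (g j) (Ici T))
    (hN : ∀ j t, T ≤ t → N (fun k => v k t) j =ᵐ[volume] U t (g j t)) (j : Fin 2)
    {t : ℝ} (ht : T ≤ t) : HasDerivWithinAt (f j) (-g j t) (Ici T) t := by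
  -- Freezing `g j` before `T` makes it continuous on the line, so the fundamental theorem of
  -- calculus applies two-sidedly even at `T`.
  set g' : ℝ → L2 := fun τ => g j (max T τ) with hg'
  have hg'c : Continuous g' :=
    (hg j).comp_continuous (by fun_prop) fun τ => mem_Ici.2 (le_max_left _ _)
  have hg'eq : ∀ τ, T ≤ τ → g' τ = g j τ := fun τ hτ => by rw [hg']; simp only [max_eq_right hτ]
  set F : ℝ → L2 := fun τ => ∫ σ in T..τ, g' σ with hF
  have hFd : ∀ τ, HasDerivAt F (g' τ) τ := fun τ =>
    intervalIntegral.integral_hasDerivAt_right (hg'c.intervalIntegrable _ _)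
      (hg'c.stronglyMeasurableAtFilter _ _) hg'c.continuousAt
  set e : ℝ → L2 := fun τ => f j τ - f j T + F τ with he
  have hez : ∀ τ, T ≤ τ → e τ = 0 := by
    intro τ hτ
    have hsmul : ∀ γ : ℝ → ℝ, ContDiff ℝ (⊤ : ℕ∞) γ → HasCompactSupport γ →
        ∫ ξ, γ ξ • (𝓕 (e τ) : L2) ξ = 0 := by
      intro γ hγ hc
      have hKm : MemLp (fun ξ => (γ ξ : ℂ)) 2 volume :=
        (Complex.continuous_ofReal.comp hγ.continuous).memLp_of_hasCompactSupport
          (hc.comp_left (g := Complex.ofReal) rfl)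
      set K := hKm.toLp with hKdef
      have hK : K =ᵐ[volume] fun ξ => (γ ξ : ℂ) := hKm.coeFn_toLp
      have hlin : ∀ σ, inner ℂ K (𝓕 (e σ) : L2) = inner ℂ K (𝓕 (f j σ) : L2) -
          inner ℂ K (𝓕 (f j T) : L2) + inner ℂ K (𝓕 (F σ) : L2) := by
        intro σ
        have h1 : (𝓕 (e σ) : L2) = 𝓕 (f j σ) - 𝓕 (f j T) + 𝓕 (F σ) := by
          have h2 := (Lp.fourierTransformₗᵢ ℝ ℂ).map_add (f j σ - f j T) (F σ)
          have h3 := (Lp.fourierTransformₗᵢ ℝ ℂ).map_sub (f j σ) (f j T)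
          rw [h3] at h2
          exact h2
        rw [h1, inner_add_right, inner_sub_right]
      have hder : ∀ σ, T ≤ σ → HasDerivWithinAt (fun σ => inner ℂ K (𝓕 (e σ) : L2)) 0 (Ici T) σ := by
        intro σ hσ
        simp only [hlin]
        have h1 := hasDerivWithinAt_inner_profile hsol hvf hf hN j hγ hc hK hσ
        have h2 : HasDerivAt (fun σ => inner ℂ K (𝓕 (F σ) : L2)) (inner ℂ K (𝓕 (g' σ) : L2)) σ := by
          have h3 := (((innerSL ℂ K).comp
            (Lp.fourierTransformₗᵢ ℝ ℂ).toContinuousLinearEquiv.toContinuousLinearMap).restrictScalars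
              ℝ).hasFDerivAt.comp_hasDerivAt σ (hFd σ)
          exact h3
        refine ((h1.sub_const (inner ℂ K (𝓕 (f j T) : L2))).add
          h2.hasDerivWithinAt).congr_deriv ?_
        rw [hg'eq σ hσ, neg_add_cancel]
      have hconst := constant_of_has_deriv_right_zero (a := T) (b := τ)
        (f := fun σ => inner ℂ K (𝓕 (e σ) : L2))
        (fun σ hσ => ((hder σ hσ.1).continuousWithinAt).mono Icc_subset_Ici_self)
        (fun σ hσ => (hder σ hσ.1).mono (Ici_subset_Ici.2 hσ.1)) τ ⟨hτ, le_rfl⟩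
      have hT0 : inner ℂ K (𝓕 (e T) : L2) = 0 := by
        rw [hlin]
        have hF0 : (𝓕 (F T) : L2) = 0 := by
          have : F T = 0 := intervalIntegral.integral_same
          rw [this]
          exact (Lp.fourierTransformₗᵢ ℝ ℂ).map_zero
        rw [hF0, inner_zero_right, sub_self, add_zero]
      rw [hT0, L2.inner_def] at hconst
      rw [← hconst]
      apply integral_congr_ae
      filter_upwards [hK] with ξ hξ
      rw [hξ, RCLike.inner_apply, Complex.conj_ofReal, Complex.real_smul, mul_comm]
    have h0 := ae_eq_zero_of_integral_contDiff_smul_eq_zero (locallyIntegrable_L2 _) hsmul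
    have h1 : (𝓕 (e τ) : L2) = 0 := (Lp.eq_zero_iff_ae_eq_zero).2 h0
    rw [← norm_eq_zero, ← Lp.norm_fourier_eq, h1, norm_zero]
  have hfe : ∀ τ, T ≤ τ → f j τ = f j T - F τ := fun τ hτ => by
    have := hez τ hτ
    rw [he] at this
    simp only at this
    rw [sub_add, sub_eq_zero] at this
    rw [this]
  refine ((((hFd t).hasDerivWithinAt (s := Ici T)).const_sub (f j T)).congr
    (fun τ hτ => hfe τ hτ) (hfe t ht)).congr_deriv ?_
  rw [hg'eq t ht]

/-! ### Tail integrals -/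

theorem integrableOn_Ioi_rpow {β t : ℝ} (hβ : 0 < β) (ht : 0 < t) (C : ℝ) :
    IntegrableOn (fun τ : ℝ => C * β * τ ^ (-(1 + β))) (Ioi t) :=
  (integrableOn_Ioi_rpow_of_lt (by linarith) ht).const_mul _

theorem integral_Ioi_rpow {β t : ℝ} (hβ : 0 < β) (ht : 0 < t) (C : ℝ) :
    ∫ τ in Ioi t, C * β * τ ^ (-(1 + β)) = C * t ^ (-β) := by
  rw [integral_const_mul, integral_Ioi_rpow_of_lt (by linarith) ht]
  have e : -(1 + β) + 1 = -β := by ring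
  rw [e]
  field_simp

section Tail

variable {h : ℝ → L2} {T C β : ℝ}

theorem integrableOn_tail (hT : 0 < T) (hβ : 0 < β) (hc : Continuous h)
    (hb : ∀ τ, T ≤ τ → ‖h τ‖ ≤ C * β * τ ^ (-(1 + β))) {t : ℝ} (ht : T ≤ t) :
    IntegrableOn h (Ioi t) := by
  refine Integrable.mono' (integrableOn_Ioi_rpow hβ (hT.trans_le ht) C)
    hc.aestronglyMeasurable ?_
  filter_upwards [ae_restrict_mem measurableSet_Ioi] with τ hτ
  exact hb τ (ht.trans (le_of_lt hτ))

theorem norm_tail_le (hT : 0 < T) (hβ : 0 < β)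
    (hb : ∀ τ, T ≤ τ → ‖h τ‖ ≤ C * β * τ ^ (-(1 + β))) {t : ℝ} (ht : T ≤ t) :
    ‖∫ τ in Ioi t, h τ‖ ≤ C * t ^ (-β) := by
  rw [← integral_Ioi_rpow hβ (hT.trans_le ht) C]
  refine norm_integral_le_of_norm_le (integrableOn_Ioi_rpow hβ (hT.trans_le ht) C) ?_
  filter_upwards [ae_restrict_mem measurableSet_Ioi] with τ hτ
  exact hb τ (ht.trans (le_of_lt hτ))

theorem lipW_tail (hT : 0 < T) (hβ : 0 < β)
    (hb : ∀ τ, T ≤ τ → LipW (C * β * τ ^ (-(1 + β))) (h τ)) {t : ℝ} (ht : T ≤ t)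
    (hi : IntegrableOn h (Ioi t)) : LipW (C * t ^ (-β)) (∫ τ in Ioi t, h τ) := by
  rw [← integral_Ioi_rpow hβ (hT.trans_le ht) C]
  refine lipW_integral hi (integrableOn_Ioi_rpow hβ (hT.trans_le ht) C) ?_
  filter_upwards [ae_restrict_mem measurableSet_Ioi] with τ hτ
  exact hb τ (ht.trans (le_of_lt hτ))

theorem hasDerivWithinAt_tail (hc : Continuous h) (hi : IntegrableOn h (Ioi T)) {t : ℝ}
    (ht : T ≤ t) : HasDerivWithinAt (fun t => ∫ τ in Ioi t, h τ) (-h t) (Ici T) t := by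
  have hd : HasDerivAt (fun t => ∫ σ in T..t, h σ) (h t) t :=
    intervalIntegral.integral_hasDerivAt_right (hc.intervalIntegrable _ _)
      (hc.stronglyMeasurableAtFilter _ _) hc.continuousAt
  have he : ∀ t ∈ Ici T, ∫ τ in Ioi t, h τ = (∫ τ in Ioi T, h τ) - ∫ σ in T..t, h σ := by
    intro t ht
    rw [← intervalIntegral.integral_Ioi_sub_Ioi hi ht, sub_sub_cancel]
  exact (hd.hasDerivWithinAt.const_sub _).congr he (he t ht)

end Tail

/-! ### Deviations from the final state -/

/-- Quantitative data on the final states. -/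
structure Datum (m δ K L : ℝ) (ψ : Fin 2 → L2) : Prop where
  m_pos : 0 < m
  bdd : ∀ j, Bdd δ (𝓕 (ψ j) : L2)
  mul_eq_zero : ∀ j, ∀ᵐ ξ, (𝓕 (ψ (1 - j)) : L2) ξ * (𝓕 (ψ j) : L2) ξ = 0
  lip : ∀ j, LipW L (ψ j)
  nonneg : 0 ≤ K
  chirp : ∀ j t, 1 ≤ t → ‖phase (quadPhase t) (ψ j) - ψ j‖ ≤ K * t ^ (-(m + 1 / 2)) ∧
      LipW (K * t ^ (-m)) (phase (quadPhase t) (ψ j) - ψ j)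

theorem sqrt_pi_const : Real.sqrt Real.pi * (1 + 1 / (2 * Real.pi)) ≤ 4 := by
  have h1 : Real.sqrt Real.pi ≤ 2 := by
    rw [Real.sqrt_le_left (by norm_num)]
    linarith [Real.pi_le_four]
  have h2 : 1 / (2 * Real.pi) ≤ 1 := by
    rw [div_le_one (by positivity)]
    linarith [Real.pi_gt_three]
  have h3 : 0 ≤ 1 / (2 * Real.pi) := by positivity
  nlinarith [Real.sqrt_nonneg Real.pi]

/-- Interpolation at scale `l = t^(1/2)`, where `l ‖f‖` and the weighted bound have the same rate
`t^(-m)`. The prefactor `√(π/l)` supplies the extra `t^(-1/4)`. -/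
theorem ae_norm_fourier_le_rpow {f : L2} {D m t : ℝ} (ht : 0 < t)
    (hf : ‖f‖ ≤ D * t ^ (-(m + 1 / 2))) (hL : LipW (D * t ^ (-m)) f) :
    Bdd (4 * D * t ^ (-(m + 1 / 4))) (𝓕 f : L2) := by
  have hD : 0 ≤ D := by
    have := hL.nonneg
    have h2 : 0 < t ^ (-m) := Real.rpow_pos_of_pos ht _
    exact nonneg_of_mul_nonneg_left this h2
  have hl : 0 < t ^ (1 / 2 : ℝ) := Real.rpow_pos_of_pos ht _
  refine Eventually.mono (ae_norm_fourier_le_of_lipW hL hl) fun ξ h => h.trans ?_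
  have e1 : Real.sqrt (Real.pi / t ^ (1 / 2 : ℝ)) = Real.sqrt Real.pi * t ^ (-(1 / 4) : ℝ) := by
    rw [Real.sqrt_div Real.pi_pos.le, Real.sqrt_eq_rpow (t ^ (1 / 2 : ℝ)), ← Real.rpow_mul ht.le,
      Real.rpow_neg ht.le, div_eq_mul_inv]
    norm_num
  have e2 : t ^ (1 / 2 : ℝ) * (D * t ^ (-(m + 1 / 2))) = D * t ^ (-m) := by
    rw [mul_left_comm, ← Real.rpow_add ht]
    congr 2
    ring
  have h1 : t ^ (1 / 2 : ℝ) * ‖f‖ + D * t ^ (-m) / (2 * Real.pi) ≤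
      (1 + 1 / (2 * Real.pi)) * (D * t ^ (-m)) := by
    have := mul_le_mul_of_nonneg_left hf hl.le
    rw [e2] at this
    calc _ ≤ D * t ^ (-m) + D * t ^ (-m) / (2 * Real.pi) := by linarith
      _ = _ := by ring
  calc _ ≤ Real.sqrt Real.pi * t ^ (-(1 / 4) : ℝ) *
        ((1 + 1 / (2 * Real.pi)) * (D * t ^ (-m))) := by
        rw [e1]; gcongr
    _ = (Real.sqrt Real.pi * (1 + 1 / (2 * Real.pi))) * (D * (t ^ (-m) * t ^ (-(1 / 4) : ℝ))) := by
        ring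
    _ ≤ 4 * (D * (t ^ (-m) * t ^ (-(1 / 4) : ℝ))) := by
        have := sqrt_pi_const
        gcongr
    _ = _ := by
        rw [← Real.rpow_add ht, ← mul_assoc]
        congr 2
        ring

section Datum

variable {m δ K L ρ : ℝ} {ψ : Fin 2 → L2}

/-- The remainder is the Fourier transform of `(M(t) - 1) ψ_j + M(t) r`. Its two parts obey the same
rates, so their constants add. -/
theorem Datum.dev (hd : Datum m δ K L ψ) (j : Fin 2) {t : ℝ} (ht : 1 ≤ t) {r : L2}
    (hr : ‖r‖ ≤ ρ * t ^ (-(m + 1 / 2))) (hL : LipW (ρ * t ^ (-m)) r) :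
    ∃ z : L2, E t (ψ j + r) = 𝓕 (ψ j) + z ∧ ‖z‖ ≤ (K + ρ) * t ^ (-(m + 1 / 2)) ∧
      LipT ((K + ρ) * t ^ (-m)) z ∧ Bdd (4 * (K + ρ) * t ^ (-(m + 1 / 4))) z := by
  obtain ⟨h1, h2⟩ := hd.chirp j t ht
  set y : L2 := (phase (quadPhase t) (ψ j) - ψ j) + phase (quadPhase t) r with hy
  have hyn : ‖y‖ ≤ (K + ρ) * t ^ (-(m + 1 / 2)) := by
    refine (norm_add_le _ _).trans ?_
    rw [LinearIsometry.norm_map]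
    linarith
  have hyL : LipW ((K + ρ) * t ^ (-m)) y := by
    rw [add_mul]
    exact h2.add (hL.phase _)
  refine ⟨𝓕 y, ?_, ?_, ?_, ?_⟩
  · have h3 : phase (quadPhase t) (ψ j + r) = ψ j + y := by
      rw [map_add, hy]; abel
    rw [E_apply, h3]
    exact (Lp.fourierTransformₗᵢ ℝ ℂ).map_add _ _
  · rwa [Lp.norm_fourier_eq]
  · rwa [lipT_fourier]
  · exact ae_norm_fourier_le_rpow (by linarith) hyn hyL

theorem Datum.bdd_E (hd : Datum m δ K L ψ) (j : Fin 2) {t : ℝ} (ht : 1 ≤ t) {r : L2}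
    (hr : ‖r‖ ≤ ρ * t ^ (-(m + 1 / 2))) (hL : LipW (ρ * t ^ (-m)) r) :
    Bdd (δ + 4 * (K + ρ) * t ^ (-(m + 1 / 4))) (E t (ψ j + r)) := by
  obtain ⟨z, h1, -, -, h2⟩ := hd.dev j ht hr hL
  rw [h1]
  exact (hd.bdd j).add h2

/-- In the weighted bound, `4L + 3ρ` is `2(L + ρ) + L + (L + ρ)`: the Lipschitz constants of the
factors other than the remainders, which the product rule pairs with the sup norm of a remainder. -/
theorem Datum.G_bounds (hd : Datum m δ K L ψ) (j : Fin 2) {t a : ℝ} (ht : 1 ≤ t) {r : Fin 2 → L2}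
    (hr : ∀ k, ‖r k‖ ≤ ρ * t ^ (-(m + 1 / 2))) (hL : ∀ k, LipW (ρ * t ^ (-m)) (r k))
    (hδ : 0 ≤ δ) (hρ : 0 ≤ ρ) (ha : δ + 4 * (K + ρ) * t ^ (-(m + 1 / 4)) ≤ a) :
    ‖G t (ψ (1 - j) + r (1 - j)) (ψ j + r j)‖ ≤
        (2 * Real.pi * t)⁻¹ * (a ^ 2 * (2 * ((K + ρ) * t ^ (-(m + 1 / 2))))) ∧
      LipW ((2 * Real.pi * t)⁻¹ * (a ^ 2 * (2 * ((K + ρ) * t ^ (-m))) +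
        a * (4 * (K + ρ) * t ^ (-(m + 1 / 4))) * (4 * L + 3 * ρ)))
        (G t (ψ (1 - j) + r (1 - j)) (ψ j + r j)) := by
  have ht0 : 0 < t := by linarith
  have hb : ∀ k, Bdd a (E t (ψ k + r k)) := fun k => (hd.bdd_E k ht (hr k) (hL k)).mono ha
  have hK := hd.nonneg
  have hε0 : 0 ≤ 4 * (K + ρ) * t ^ (-(m + 1 / 4)) := by positivity
  have hp : ∀ k, Bdd a (𝓕 (ψ k) : L2) := fun k => (hd.bdd k).mono (by linarith)
  have ha0 : 0 ≤ a := by linarith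
  have hw : ∀ k, LipT (L + ρ) (E t (ψ k + r k)) := fun k => by
    refine lipT_E ((hd.lip k).add ((hL k).mono ?_))
    exact mul_le_of_le_one_right hρ
      (Real.rpow_le_one_of_one_le_of_nonpos ht (by linarith [hd.m_pos]))
  obtain ⟨z, z1, z2, z3, z4⟩ := hd.dev (1 - j) ht (hr (1 - j)) (hL (1 - j))
  obtain ⟨y, y1, y2, y3, y4⟩ := hd.dev j ht (hr j) (hL j)
  constructor
  · refine norm_G_le ht0 ((norm_cub_le_of_mul_eq_zero z1 y1 (hd.mul_eq_zero j) (hb _) (hb _)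
      (hp _)).trans ?_)
    refine mul_le_mul_of_nonneg_left ?_ (by positivity)
    linarith
  · refine (lipW_G ht0 (lipT_cub_of_mul_eq_zero z1 y1 (hd.mul_eq_zero j) (hb _) (hb _)
      (hp _) z4 y4 (lipT_fourier.2 (hd.lip _)) (hw _) (hw _) z3 y3)).mono (le_of_eq ?_)
    ring

/-- The admissible times of the contraction argument. -/
theorem exists_time (hm : 0 < m) (hρ : 0 < ρ) (hδ : 0 < δ) (hL : 0 ≤ L) :
    ∃ T : ℝ, 1 ≤ T ∧ ∀ t, T ≤ t → 4 * (2 * ρ) * t ^ (-(m + 1 / 4)) ≤ δ ∧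
      2 * δ * (4 * (2 * ρ) * t ^ (-(m + 1 / 4))) * (4 * L + 3 * ρ) ≤ ρ * m * t ^ (-m) := by
  have h1 : Tendsto (fun t : ℝ => t ^ (-(1 / 4) : ℝ)) atTop (𝓝 0) :=
    tendsto_rpow_neg_atTop (by norm_num)
  -- The two thresholds are those at which `t^(-1/4) ≤ η` yields the sup bound and the weighted
  -- bound; the remaining factor `t^(-m)` is kept in the second one.
  set η := min (δ / (8 * ρ)) (ρ * m / (16 * δ * ρ * (4 * L + 3 * ρ))) with hη
  have hη0 : 0 < η := by
    refine lt_min (by positivity) ?_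
    have : 0 < 4 * L + 3 * ρ := by linarith
    positivity
  obtain ⟨T, hT⟩ := eventually_atTop.1 (h1.eventually (gt_mem_nhds hη0))
  refine ⟨max T 1, le_max_right _ _, fun t ht => ?_⟩
  have ht1 : 1 ≤ t := (le_max_right _ _).trans ht
  have ht0 : 0 < t := by linarith
  have h2 : t ^ (-(1 / 4) : ℝ) ≤ η := (hT t ((le_max_left _ _).trans ht)).le
  have e : t ^ (-(m + 1 / 4)) = t ^ (-m) * t ^ (-(1 / 4) : ℝ) := by
    rw [← Real.rpow_add ht0]; congr 1; ring
  have hm1 : t ^ (-m) ≤ 1 := Real.rpow_le_one_of_one_le_of_nonpos ht1 (by linarith)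
  have hm0 : 0 < t ^ (-m) := Real.rpow_pos_of_pos ht0 _
  have hq0 : 0 < t ^ (-(1 / 4) : ℝ) := Real.rpow_pos_of_pos ht0 _
  rw [e]
  have h3 := h2.trans (min_le_left _ _)
  have h4 := h2.trans (min_le_right _ _)
  have hLρ : 0 < 4 * L + 3 * ρ := by linarith
  rw [le_div_iff₀ (by positivity)] at h3 h4
  constructor
  · calc _ = t ^ (-m) * (t ^ (-(1 / 4) : ℝ) * (8 * ρ)) := by ring
      _ ≤ 1 * (t ^ (-(1 / 4) : ℝ) * (8 * ρ)) := by gcongr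
      _ ≤ δ := by linarith
  · calc _ = t ^ (-m) * (t ^ (-(1 / 4) : ℝ) * (16 * δ * ρ * (4 * L + 3 * ρ))) := by ring
      _ ≤ t ^ (-m) * (ρ * m) := by gcongr
      _ = _ := by ring

end Datum

/-! ### Existence -/

/-- The ball of admissible deviations at time `t`. -/
def InBall (m ρ t : ℝ) (r : L2) : Prop := ‖r‖ ≤ ρ * t ^ (-(m + 1 / 2)) ∧ LipW (ρ * t ^ (-m)) r

/-- The properties of an admissible starting time for the ball of radius `ρ`. -/
structure IsTime (m δ K L ρ T : ℝ) : Prop where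
  one_le : 1 ≤ T
  pos : 0 < ρ
  le : K ≤ ρ
  δ_pos : 0 < δ
  δ_sq : (2 * δ) ^ 2 ≤ m / 4
  sup : ∀ t, T ≤ t → 4 * (2 * ρ) * t ^ (-(m + 1 / 4)) ≤ δ
  lip : ∀ t, T ≤ t → 2 * δ * (4 * (2 * ρ) * t ^ (-(m + 1 / 4))) * (4 * L + 3 * ρ) ≤
    ρ * m * t ^ (-m)

section

variable {m δ K L ρ T : ℝ} {ψ : Fin 2 → L2}

theorem Datum.bdd_of_inBall (hd : Datum m δ K L ψ) (hT : IsTime m δ K L ρ T) {t : ℝ} (ht : T ≤ t)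
    (j : Fin 2) {r : L2} (hr : InBall m ρ t r) : Bdd (2 * δ) (E t (ψ j + r)) := by
  have ht1 := hT.one_le.trans ht
  refine (hd.bdd_E j ht1 hr.1 hr.2).mono ?_
  have h1 := hT.sup t ht
  have h2 : 4 * (K + ρ) * t ^ (-(m + 1 / 4)) ≤ 4 * (2 * ρ) * t ^ (-(m + 1 / 4)) := by
    have := hT.le
    gcongr
    linarith
  linarith

theorem inv_two_pi_mul_le {t : ℝ} (ht : 0 < t) : (2 * Real.pi * t)⁻¹ ≤ 1 / 6 * t⁻¹ := by
  rw [mul_inv]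
  refine mul_le_mul_of_nonneg_right ?_ (by positivity)
  rw [one_div]
  exact inv_anti₀ (by norm_num) (by linarith [Real.pi_gt_three])

theorem inv_mul_rpow {t : ℝ} (ht : 0 < t) (β : ℝ) : t⁻¹ * t ^ (-β) = t ^ (-(1 + β)) := by
  rw [← Real.rpow_neg_one, ← Real.rpow_add ht]
  congr 1
  ring

/-- The rates are the derivatives of `ρ t^(-(m+1/2))` and `ρ t^(-m)`, up to sign, so integration
from `t` to infinity returns to the ball. Smallness of `δ` absorbs the main terms, lateness of `T`
the sup-norm terms. -/
theorem Datum.rate (hd : Datum m δ K L ψ) (hT : IsTime m δ K L ρ T) {t : ℝ} (ht : T ≤ t)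
    (j : Fin 2) {r : Fin 2 → L2} (hr : ∀ k, InBall m ρ t (r k)) :
    ‖G t (ψ (1 - j) + r (1 - j)) (ψ j + r j)‖ ≤ ρ * (m + 1 / 2) * t ^ (-(1 + (m + 1 / 2))) ∧
      LipW (ρ * m * t ^ (-(1 + m))) (G t (ψ (1 - j) + r (1 - j)) (ψ j + r j)) := by
  have ht1 := hT.one_le.trans ht
  have ht0 : 0 < t := by linarith
  have hm := hd.m_pos
  have hρ := hT.pos
  have hK := hd.nonneg
  have hL := (hd.lip 0).nonneg
  have hδ := hT.δ_pos
  have hKρ : K + ρ ≤ 2 * ρ := by linarith [hT.le]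
  have h2 : 4 * (K + ρ) * t ^ (-(m + 1 / 4)) ≤ 4 * (2 * ρ) * t ^ (-(m + 1 / 4)) := by gcongr
  obtain ⟨b1, b2⟩ := hd.G_bounds j ht1 (fun k => (hr k).1) (fun k => (hr k).2) hT.δ_pos.le
    hρ.le (a := 2 * δ) (by linarith [hT.sup t ht])
  constructor
  · refine b1.trans ?_
    calc _ ≤ (1 / 6 * t⁻¹) * (m / 4 * (2 * ((2 * ρ) * t ^ (-(m + 1 / 2))))) := by
          gcongr
          · exact inv_two_pi_mul_le ht0
          · exact hT.δ_sq
      _ = ρ * (m / 6) * (t⁻¹ * t ^ (-(m + 1 / 2))) := by ring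
      _ ≤ ρ * (m + 1 / 2) * (t⁻¹ * t ^ (-(m + 1 / 2))) := by
          gcongr
          linarith
      _ = _ := by rw [inv_mul_rpow ht0]
  · refine b2.mono ?_
    calc _ ≤ (1 / 6 * t⁻¹) * (m / 4 * (2 * ((2 * ρ) * t ^ (-m))) + ρ * m * t ^ (-m)) := by
          have h3 : 2 * δ * (4 * (K + ρ) * t ^ (-(m + 1 / 4))) * (4 * L + 3 * ρ) ≤
              ρ * m * t ^ (-m) := by
            refine le_trans ?_ (hT.lip t ht)
            gcongr
          have h4 : (2 * δ) ^ 2 * (2 * ((K + ρ) * t ^ (-m))) ≤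
              m / 4 * (2 * ((2 * ρ) * t ^ (-m))) := by
            gcongr
            exact hT.δ_sq
          exact mul_le_mul (inv_two_pi_mul_le ht0) (add_le_add h4 h3) (by positivity)
            (by positivity)
      -- The main term and the sup-norm term each contribute `ρ m t^(-m)`; the prefactor `1/6`
      -- leaves a third of what is allowed.
      _ = ρ * m * (t⁻¹ * t ^ (-m)) * (1 / 3) := by ring
      _ ≤ ρ * m * (t⁻¹ * t ^ (-m)) := mul_le_of_le_one_right (by positivity) (by norm_num)
      _ = _ := by rw [inv_mul_rpow ht0]

/-- The rescaled deviations. -/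
def dev (m T : ℝ) (F : BoundedContinuousFunction ℝ (Fin 2 → L2)) (j : Fin 2) (t : ℝ) : L2 :=
  (max T t ^ (-(m + 1 / 2)) : ℝ) • F t j

/-- The forcing of the integral equation, frozen before time `T`. -/
def forcing (m T : ℝ) (ψ : Fin 2 → L2) (F : BoundedContinuousFunction ℝ (Fin 2 → L2))
    (j : Fin 2) (t : ℝ) : L2 :=
  G (max T t) (ψ (1 - j) + dev m T F (1 - j) t) (ψ j + dev m T F j t)

/-- The set on which the integral equation is a contraction. -/
def ballSet (ρ T : ℝ) : Set (BoundedContinuousFunction ℝ (Fin 2 → L2)) :=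
  {F | ∀ t j, ‖F t j‖ ≤ ρ ∧ LipW (ρ * max T t ^ (1 / 2 : ℝ)) (F t j)}

theorem isClosed_ballSet : IsClosed (ballSet ρ T) := by
  simp only [ballSet, ofPred_forall, ofPred_and]
  refine isClosed_iInter fun t => isClosed_iInter fun j => ?_
  have hc : Continuous fun F : BoundedContinuousFunction ℝ (Fin 2 → L2) => F t j :=
    (continuous_apply j).comp (continuous_eval_const t)
  exact (isClosed_le hc.norm continuous_const).inter ((isClosed_lipW _).preimage hc)

theorem max_pos (hT : IsTime m δ K L ρ T) (t : ℝ) : 0 < max T t :=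
  lt_max_of_lt_left (by linarith [hT.one_le])

theorem inBall_dev (hT : IsTime m δ K L ρ T) {F : BoundedContinuousFunction ℝ (Fin 2 → L2)}
    (hF : F ∈ ballSet ρ T) (j : Fin 2) (t : ℝ) : InBall m ρ (max T t) (dev m T F j t) := by
  have h0 := max_pos hT t
  have h1 : 0 < max T t ^ (-(m + 1 / 2)) := Real.rpow_pos_of_pos h0 _
  obtain ⟨h2, h3⟩ := hF t j
  constructor
  · rw [dev, norm_smul, Real.norm_of_nonneg h1.le, mul_comm]
    exact mul_le_mul_of_nonneg_right h2 h1.le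
  · refine (h3.smul _).mono (le_of_eq ?_)
    rw [abs_of_pos h1, mul_left_comm, ← Real.rpow_add h0]
    congr 2
    ring

theorem continuous_dev (hT : IsTime m δ K L ρ T) (F : BoundedContinuousFunction ℝ (Fin 2 → L2))
    (j : Fin 2) : Continuous (dev m T F j) := by
  have h1 : Continuous fun t => max T t ^ (-(m + 1 / 2)) :=
    Continuous.rpow_const (by fun_prop) fun t => Or.inl (max_pos hT t).ne'
  exact h1.smul ((continuous_apply j).comp F.continuous)

theorem continuous_forcing (hd : Datum m δ K L ψ) (hT : IsTime m δ K L ρ T)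
    {F : BoundedContinuousFunction ℝ (Fin 2 → L2)} (hF : F ∈ ballSet ρ T) (j : Fin 2) :
    Continuous (forcing m T ψ F j) := by
  rw [continuous_iff_continuousAt]
  intro t
  have hc : ∀ k, Tendsto (fun τ => ψ k + dev m T F k τ) (𝓝 t) (𝓝 (ψ k + dev m T F k t)) :=
    fun k => ((continuous_dev hT F k).tendsto t).const_add _
  have hm : Continuous fun τ => max T τ := by fun_prop
  have hb : ∀ τ k, Bdd (2 * δ) (E (max T τ) (ψ k + dev m T F k τ)) := fun τ k =>
    hd.bdd_of_inBall hT (le_max_left _ _) k (inBall_dev hT hF k τ)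
  exact tendsto_G (max_pos hT t) (hm.tendsto t) (hc _) (hc _)
    (Eventually.of_forall fun τ => hb τ _) (hb t _) (hb t _)

theorem forcing_rate (hd : Datum m δ K L ψ) (hT : IsTime m δ K L ρ T)
    {F : BoundedContinuousFunction ℝ (Fin 2 → L2)} (hF : F ∈ ballSet ρ T) (j : Fin 2) {t : ℝ}
    (ht : T ≤ t) : ‖forcing m T ψ F j t‖ ≤ ρ * (m + 1 / 2) * t ^ (-(1 + (m + 1 / 2))) ∧
      LipW (ρ * m * t ^ (-(1 + m))) (forcing m T ψ F j t) := by
  have := hd.rate hT (le_max_left T t) j (r := fun k => dev m T F k t)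
    (fun k => inBall_dev hT hF k t)
  rw [max_eq_right ht] at this
  rw [forcing, max_eq_right ht]
  exact this

/-- Differences need no orthogonality: the Lipschitz constant `3 (2δ)²` of the cubic product times
`1/(2πt)` is already small enough. -/
theorem norm_forcing_sub_le (hd : Datum m δ K L ψ) (hT : IsTime m δ K L ρ T)
    {F F' : BoundedContinuousFunction ℝ (Fin 2 → L2)} (hF : F ∈ ballSet ρ T)
    (hF' : F' ∈ ballSet ρ T) (j : Fin 2) {t : ℝ} (ht : T ≤ t) :
    ‖forcing m T ψ F j t - forcing m T ψ F' j t‖ ≤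
      (1 / 2 * dist F F') * (m + 1 / 2) * t ^ (-(1 + (m + 1 / 2))) := by
  have h0 := max_pos hT t
  have hm := hd.m_pos
  have hδ := hT.δ_pos
  have hb : ∀ F ∈ ballSet ρ T, ∀ k, Bdd (2 * δ) (E (max T t) (ψ k + dev m T F k t)) :=
    fun F hF k => hd.bdd_of_inBall hT (le_max_left _ _) k (inBall_dev hT hF k t)
  have hdiff : ∀ k, ‖ψ k + dev m T F k t - (ψ k + dev m T F' k t)‖ ≤
      max T t ^ (-(m + 1 / 2)) * dist F F' := by
    intro k
    have h1 : 0 < max T t ^ (-(m + 1 / 2)) := Real.rpow_pos_of_pos h0 _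
    rw [add_sub_add_left_eq_sub, dev, dev, ← smul_sub, norm_smul, Real.norm_of_nonneg h1.le]
    refine mul_le_mul_of_nonneg_left ?_ h1.le
    calc ‖F t k - F' t k‖ = ‖(F t - F' t) k‖ := rfl
      _ ≤ ‖F t - F' t‖ := norm_le_pi_norm _ _
      _ ≤ dist F F' := by
          rw [← dist_eq_norm]
          exact BoundedContinuousFunction.dist_coe_le_dist t
  have := norm_G_sub_le h0 (hb F hF (1 - j)) (hb F' hF' (1 - j)) (hb F' hF' j)
    (g := ψ j + dev m T F j t)
  refine this.trans ?_
  rw [max_eq_right ht] at h0 hdiff ⊢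
  have hdist : 0 ≤ dist F F' := dist_nonneg
  calc _ ≤ (1 / 6 * t⁻¹) * (2 * (m / 4) * (t ^ (-(m + 1 / 2)) * dist F F') +
        (m / 4) * (t ^ (-(m + 1 / 2)) * dist F F')) := by
        have h1 := hdiff j
        have h2 := hdiff (1 - j)
        have h3 := hT.δ_sq
        gcongr
        · exact inv_two_pi_mul_le h0
    _ = dist F F' * (m / 8) * (t⁻¹ * t ^ (-(m + 1 / 2))) := by ring
    _ ≤ dist F F' * (1 / 2 * (m + 1 / 2)) * (t⁻¹ * t ^ (-(m + 1 / 2))) := by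
        gcongr
        linarith
    _ = _ := by rw [inv_mul_rpow h0]; ring

theorem exists_image (hd : Datum m δ K L ψ) (hT : IsTime m δ K L ρ T) (F : ballSet ρ T) :
    ∃ F' : ballSet ρ T, ∀ t j, F'.1 t j =
      (max T t ^ (m + 1 / 2) : ℝ) • ∫ τ in Ioi (max T t), forcing m T ψ F.1 j τ := by
  have hT0 : 0 < T := by linarith [hT.one_le]
  have hm := hd.m_pos
  have hβ : 0 < m + 1 / 2 := by linarith
  have hbase : ∀ j, IntegrableOn (forcing m T ψ F.1 j) (Ioi T) := fun j =>
    integrableOn_tail hT0 hβ (continuous_forcing hd hT F.2 j)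
      (fun τ hτ => (forcing_rate hd hT F.2 j hτ).1) le_rfl
  set V : ℝ → Fin 2 → L2 := fun t j =>
    (max T t ^ (m + 1 / 2) : ℝ) • ∫ τ in Ioi (max T t), forcing m T ψ F.1 j τ with hV
  have hVc : Continuous V := by
    refine continuous_pi fun j => ?_
    have h1 : Continuous fun t => max T t ^ (m + 1 / 2) :=
      Continuous.rpow_const (by fun_prop) fun t => Or.inl (max_pos hT t).ne'
    refine h1.smul ?_
    have h2 : ContinuousOn (fun t => ∫ τ in Ioi t, forcing m T ψ F.1 j τ) (Ici T) := fun t ht =>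
      (hasDerivWithinAt_tail (continuous_forcing hd hT F.2 j) (hbase j) ht).continuousWithinAt
    exact h2.comp_continuous (by fun_prop) fun t => mem_Ici.2 (le_max_left _ _)
  have hVb : ∀ t j, ‖V t j‖ ≤ ρ ∧ LipW (ρ * max T t ^ (1 / 2 : ℝ)) (V t j) := by
    intro t j
    have h0 := max_pos hT t
    have h1 : 0 < max T t ^ (m + 1 / 2) := Real.rpow_pos_of_pos h0 _
    constructor
    · rw [hV]
      simp only
      rw [norm_smul, Real.norm_of_nonneg h1.le]
      refine (mul_le_mul_of_nonneg_left (norm_tail_le hT0 hβ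
        (fun τ hτ => (forcing_rate hd hT F.2 j hτ).1) (le_max_left T t)) h1.le).trans
        (le_of_eq ?_)
      rw [mul_left_comm, ← Real.rpow_add h0, add_neg_cancel, Real.rpow_zero, mul_one]
    · refine ((lipW_tail hT0 hm (fun τ hτ => (forcing_rate hd hT F.2 j hτ).2) (le_max_left T t)
        ((hbase j).mono_set (Ioi_subset_Ioi (le_max_left T t)))).smul _).mono (le_of_eq ?_)
      rw [abs_of_pos h1, mul_left_comm, ← Real.rpow_add h0]
      congr 2
      ring
  refine ⟨⟨BoundedContinuousFunction.ofNormedAddCommGroup V hVc ρ fun t =>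
    (pi_norm_le_iff_of_nonneg hT.pos.le).2 fun j => (hVb t j).1, hVb⟩, fun t j => rfl⟩

/-- Banach's theorem in the sup norm of the rescaled deviations. Only the `L²` part has to contract,
because the weighted bound cuts out a closed set. -/
theorem exists_fixed (hd : Datum m δ K L ψ) (hT : IsTime m δ K L ρ T) :
    ∃ F : ballSet ρ T, ∀ t j, F.1 t j =
      (max T t ^ (m + 1 / 2) : ℝ) • ∫ τ in Ioi (max T t), forcing m T ψ F.1 j τ := by
  have hT0 : 0 < T := by linarith [hT.one_le]
  have hm := hd.m_pos
  have hβ : 0 < m + 1 / 2 := by linarith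
  choose Φ hΦ using exists_image hd hT
  have : CompleteSpace (ballSet ρ T) := isClosed_ballSet.completeSpace_coe
  have : Nonempty (ballSet ρ T) := by
    refine ⟨⟨0, fun t j => ⟨by simpa using hT.pos.le, fun h => ?_⟩⟩⟩
    have := max_pos hT t
    have := hT.pos
    simp only [BoundedContinuousFunction.coe_zero, Pi.zero_apply, map_zero, sub_zero, norm_zero]
    positivity
  have hcon : ContractingWith (1 / 2) Φ := by
    refine ⟨by
      rw [← NNReal.coe_lt_coe]; norm_num, LipschitzWith.of_dist_le_mul fun F F' => ?_⟩
    have hdist : 0 ≤ dist F F' := dist_nonneg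
    rw [Subtype.dist_eq]
    refine (BoundedContinuousFunction.dist_le (by positivity)).2 fun t => ?_
    refine (dist_pi_le_iff (by positivity)).2 fun j => ?_
    have h0 := max_pos hT t
    have h1 : 0 < max T t ^ (m + 1 / 2) := Real.rpow_pos_of_pos h0 _
    have hint : ∀ F : ballSet ρ T, IntegrableOn (forcing m T ψ F.1 j) (Ioi (max T t)) :=
      fun F => integrableOn_tail hT0 hβ (continuous_forcing hd hT F.2 j)
        (fun τ hτ => (forcing_rate hd hT F.2 j hτ).1) (le_max_left _ _)
    rw [hΦ, hΦ, dist_eq_norm, ← smul_sub, ← integral_sub (hint F) (hint F'), norm_smul,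
      Real.norm_of_nonneg h1.le]
    refine (mul_le_mul_of_nonneg_left (norm_tail_le hT0 hβ
      (fun τ hτ => norm_forcing_sub_le hd hT F.2 F'.2 j hτ) (le_max_left T t)) h1.le).trans
      (le_of_eq ?_)
    rw [mul_left_comm, ← Real.rpow_add h0, add_neg_cancel, Real.rpow_zero, mul_one]
    norm_num [Subtype.dist_eq]
  refine ⟨hcon.fixedPoint Φ, fun t j => ?_⟩
  rw [← hΦ, hcon.fixedPoint_isFixedPt]

theorem exists_profile (hd : Datum m δ K L ψ) (hT : IsTime m δ K L ρ T) :
    ∃ f : Fin 2 → ℝ → L2, (∀ j t, T ≤ t → InBall m ρ t (f j t - ψ j)) ∧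
      ∀ j t, T ≤ t → HasDerivWithinAt (f j) (-G t (f (1 - j) t) (f j t)) (Ici T) t := by
  have hT0 : 0 < T := by linarith [hT.one_le]
  have hβ : 0 < m + 1 / 2 := by linarith [hd.m_pos]
  obtain ⟨F, hF⟩ := exists_fixed hd hT
  refine ⟨fun j t => ψ j + dev m T F.1 j t, fun j t ht => ?_, fun j t ht => ?_⟩
  · have := inBall_dev hT F.2 j t
    rw [max_eq_right ht] at this
    simpa using this
  · have h1 := hasDerivWithinAt_tail (continuous_forcing hd hT F.2 j)
      (integrableOn_tail hT0 hβ (continuous_forcing hd hT F.2 j)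
      (fun τ hτ => (forcing_rate hd hT F.2 j hτ).1) le_rfl) ht
    have h2 : ∀ τ ∈ Ici T, ψ j + dev m T F.1 j τ =
        ψ j + ∫ σ in Ioi τ, forcing m T ψ F.1 j σ := by
      intro τ hτ
      have h0 := max_pos hT τ
      rw [dev, hF τ j, smul_smul, ← Real.rpow_add h0, neg_add_cancel, Real.rpow_zero, one_smul,
        max_eq_right hτ]
    refine ((h1.const_add (ψ j)).congr h2 (h2 t ht)).congr_deriv ?_
    rw [forcing, max_eq_right ht]

end

/-! ### Uniqueness -/

theorem InBall.mono {m ρ ρ' t : ℝ} {r : L2} (h : InBall m ρ t r) (hρ : ρ ≤ ρ') (ht : 0 < t) :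
    InBall m ρ' t r :=
  ⟨h.1.trans (mul_le_mul_of_nonneg_right hρ (Real.rpow_nonneg ht.le _)),
    h.2.mono (mul_le_mul_of_nonneg_right hρ (Real.rpow_nonneg ht.le _))⟩

/-- The integrating factor `t^(2m) exp(-2 B t^(-1/2))`. -/
def gronwallWeight (m B t : ℝ) : ℝ := t ^ (2 * m) * Real.exp (-(2 * B * t ^ (-(1 / 2) : ℝ)))

theorem gronwallWeight_pos {m B t : ℝ} (ht : 0 < t) : 0 < gronwallWeight m B t :=
  mul_pos (Real.rpow_pos_of_pos ht _) (Real.exp_pos _)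

theorem gronwallWeight_le {m B t : ℝ} (ht : 0 < t) (hB : 0 ≤ B) :
    gronwallWeight m B t ≤ t ^ (2 * m) := by
  refine mul_le_of_le_one_right (Real.rpow_nonneg ht.le _) (Real.exp_le_one_iff.2 ?_)
  have := Real.rpow_nonneg ht.le (-(1 / 2) : ℝ)
  have : 0 ≤ 2 * B * t ^ (-(1 / 2) : ℝ) := by positivity
  linarith

theorem hasDerivAt_gronwallWeight {m B t : ℝ} (ht : 0 < t) :
    HasDerivAt (gronwallWeight m B)
      ((t⁻¹ * (2 * m + B * t ^ (-(1 / 2) : ℝ))) * gronwallWeight m B t) t := by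
  have h1 : HasDerivAt (fun t : ℝ => t ^ (2 * m)) (2 * m * t ^ (2 * m - 1)) t :=
    Real.hasDerivAt_rpow_const (Or.inl ht.ne')
  have h2 : HasDerivAt (fun t : ℝ => t ^ (-(1 / 2) : ℝ))
      (-(1 / 2) * t ^ (-(1 / 2) - 1 : ℝ)) t := Real.hasDerivAt_rpow_const (Or.inl ht.ne')
  refine (h1.mul ((h2.const_mul (2 * B)).neg.exp)).congr_deriv ?_
  rw [Real.rpow_sub_one ht.ne', Real.rpow_sub_one ht.ne', gronwallWeight]
  simp only [Pi.neg_apply]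
  ring

/-- A backward Gronwall lemma on a half line. -/
theorem eq_zero_of_backward_gronwall {D D' : ℝ → ℝ} {m B T C : ℝ} (hT : 0 < T) (hB : 0 ≤ B)
    (hD0 : ∀ t, T ≤ t → 0 ≤ D t)
    (hD : ∀ t, T ≤ t → HasDerivWithinAt D (D' t) (Ici T) t)
    (hD' : ∀ t, T ≤ t → -(t⁻¹ * (2 * m + B * t ^ (-(1 / 2) : ℝ)) * D t) ≤ D' t)
    (hC : ∀ t, T ≤ t → t ^ (2 * m) * D t ≤ C * t⁻¹) {t : ℝ} (ht : T ≤ t) : D t = 0 := by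
  have hder : ∀ t, T ≤ t → HasDerivWithinAt (fun t => gronwallWeight m B t * D t)
      ((t⁻¹ * (2 * m + B * t ^ (-(1 / 2) : ℝ))) * gronwallWeight m B t * D t +
        gronwallWeight m B t * D' t) (Ici T) t := fun t ht =>
    (hasDerivAt_gronwallWeight (hT.trans_le ht)).hasDerivWithinAt.mul (hD t ht)
  have hmono : MonotoneOn (fun t => gronwallWeight m B t * D t) (Ici T) := by
    refine monotoneOn_of_hasDerivWithinAt_nonneg (convex_Ici T)
      (fun t ht => (hder t ht).continuousWithinAt)
      (fun t ht => (hder t (interior_subset ht)).mono interior_subset) fun t ht => ?_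
    have ht' : T ≤ t := interior_subset ht
    have h1 := mul_le_mul_of_nonneg_left (hD' t ht')
      (gronwallWeight_pos (m := m) (B := B) (hT.trans_le ht')).le
    linarith
  -- The weighted distance is nondecreasing and tends to zero at infinity, hence is at most zero
  -- now.
  have hle : gronwallWeight m B t * D t ≤ 0 := by
    have hlim : Tendsto (fun s : ℝ => C * s⁻¹) atTop (𝓝 (C * 0)) :=
      tendsto_inv_atTop_zero.const_mul C
    rw [mul_zero] at hlim
    refine ge_of_tendsto hlim ?_
    filter_upwards [eventually_ge_atTop t] with s hs
    have hsT := ht.trans hs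
    refine (hmono ht hsT hs).trans ((mul_le_mul_of_nonneg_right
      (gronwallWeight_le (hT.trans_le hsT) hB) (hD0 s hsT)).trans (hC s hsT))
  have hw := gronwallWeight_pos (m := m) (B := B) (hT.trans_le ht)
  have h0 := hD0 t ht
  by_contra hne
  have : 0 < D t := lt_of_le_of_ne h0 (Ne.symm hne)
  have := mul_pos hw this
  linarith

section

variable {m δ K L ρ T : ℝ} {ψ : Fin 2 → L2}

/-- The cross terms satisfy `8xy ≤ 4(x² + y²)`, so the total constant is `6 a² (2πt)⁻¹`, which is at
most `a² t⁻¹` since `π > 3`. -/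
theorem energy_deriv_bound {a t : ℝ} (ht : 0 < t) {f g : Fin 2 → L2}
    (hf : ∀ j, Bdd a (E t (f j))) (hg : ∀ j, Bdd a (E t (g j))) :
    -(t⁻¹ * a ^ 2 * (‖f 0 - g 0‖ ^ 2 + ‖f 1 - g 1‖ ^ 2)) ≤
      2 * inner ℝ (f 0 - g 0) (-G t (f 1) (f 0) - -G t (g 1) (g 0)) +
      2 * inner ℝ (f 1 - g 1) (-G t (f 0) (f 1) - -G t (g 0) (g 1)) := by
  set x := ‖f 0 - g 0‖ with hx
  set y := ‖f 1 - g 1‖ with hy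
  have hx0 : 0 ≤ x := norm_nonneg _
  have hy0 : 0 ≤ y := norm_nonneg _
  have hG : ∀ (u w : L2) (c : ℝ), ∀ v v' : L2, ‖v - v'‖ ≤ c → ‖u‖ = ‖w‖ →
      -(‖w‖ * c) ≤ inner ℝ u (-v - -v') := by
    intro u w c v v' hv hu
    have h1 := abs_real_inner_le_norm u (-v - -v')
    have h2 : ‖-v - -v'‖ = ‖v - v'‖ := by rw [← norm_neg]; congr 1; abel
    rw [h2, hu] at h1
    have h3 := mul_le_mul_of_nonneg_left hv (norm_nonneg w)
    have h4 := (abs_le.1 h1).1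
    linarith
  have b0 := hG (f 0 - g 0) (f 0 - g 0) _ _ _ (norm_G_sub_le ht (hf 1) (hg 1) (hg 0) (g := f 0)) rfl
  have b1 := hG (f 1 - g 1) (f 1 - g 1) _ _ _ (norm_G_sub_le ht (hf 0) (hg 0) (hg 1) (g := f 1)) rfl
  rw [← hx, ← hy] at b0 b1
  have hc := inv_two_pi_mul_le ht
  set c := (2 * Real.pi * t)⁻¹ with hcdef
  have hc0 : 0 ≤ c := by have := Real.pi_pos; positivity
  have h1 : 2 * (x * (c * (2 * a ^ 2 * y + a ^ 2 * x))) + 2 * (y * (c * (2 * a ^ 2 * x + a ^ 2 * y)))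
      ≤ 6 * c * (a ^ 2 * (x ^ 2 + y ^ 2)) := by
    have : 0 ≤ c * a ^ 2 * (x - y) ^ 2 := by positivity
    linarith
  have h2 : 6 * c * (a ^ 2 * (x ^ 2 + y ^ 2)) ≤ t⁻¹ * (a ^ 2 * (x ^ 2 + y ^ 2)) := by
    gcongr
    linarith
  linarith

/-- Membership in the ball gives a distance squared of order `t^(-(2m+1))`. The condition `δ² ≤ m`
keeps the possible backward growth below `t^(2m)` up to a bounded factor, and the radius `ρ` may be
arbitrarily large. -/
theorem profile_unique (hd : Datum m δ K L ψ) (hT : 1 ≤ T) (hρ : 0 ≤ ρ)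
    (hδm : δ ^ 2 ≤ m) {f g : Fin 2 → ℝ → L2}
    (hf : ∀ j t, T ≤ t → InBall m ρ t (f j t - ψ j))
    (hg : ∀ j t, T ≤ t → InBall m ρ t (g j t - ψ j))
    (hf' : ∀ j t, T ≤ t → HasDerivWithinAt (f j) (-G t (f (1 - j) t) (f j t)) (Ici T) t)
    (hg' : ∀ j t, T ≤ t → HasDerivWithinAt (g j) (-G t (g (1 - j) t) (g j t)) (Ici T) t)
    (j : Fin 2) {t : ℝ} (ht : T ≤ t) : f j t = g j t := by
  have hT0 : 0 < T := by linarith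
  have hm := hd.m_pos
  have hK := hd.nonneg
  set A := 4 * (K + ρ) with hA
  have hA0 : 0 ≤ A := by positivity
  set D : ℝ → ℝ := fun t => ‖f 0 t - g 0 t‖ ^ 2 + ‖f 1 t - g 1 t‖ ^ 2 with hD
  have hbd : ∀ h : Fin 2 → ℝ → L2, (∀ j t, T ≤ t → InBall m ρ t (h j t - ψ j)) →
      ∀ t, T ≤ t → ∀ j, Bdd (δ + A * t ^ (-(m + 1 / 4))) (E t (h j t)) := by
    intro h hh t ht j
    have := hd.bdd_E j (hT.trans ht) (hh j t ht).1 (hh j t ht).2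
    rwa [add_sub_cancel] at this
  have hzero : D t = 0 := by
    -- `B = 2A²` comes from `(δ + Ay)² ≤ 2δ² + 2A²y²` with `y² ≤ t^(-1/2)`; `C = 8ρ²` is two squares
    -- of the distance bound `2ρ`.
    refine eq_zero_of_backward_gronwall (m := m) (B := 2 * A ^ 2) (C := 8 * ρ ^ 2) hT0
      (by positivity) (fun t _ => add_nonneg (sq_nonneg _) (sq_nonneg _))
      (fun t ht => (((hf' 0 t ht).sub (hg' 0 t ht)).norm_sq).add
        (((hf' 1 t ht).sub (hg' 1 t ht)).norm_sq)) (fun t ht => ?_) (fun t ht => ?_) ht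
    · have ht0 : 0 < t := hT0.trans_le ht
      have h1 := energy_deriv_bound ht0 (f := fun j => f j t) (g := fun j => g j t)
        (hbd f hf t ht) (hbd g hg t ht)
      refine le_trans ?_ h1
      rw [neg_le_neg_iff]
      refine mul_le_mul_of_nonneg_right ?_ (by positivity)
      refine mul_le_mul_of_nonneg_left ?_ (by positivity)
      have h2 : (t ^ (-(m + 1 / 4))) ^ 2 ≤ t ^ (-(1 / 2) : ℝ) := by
        rw [← Real.rpow_natCast, ← Real.rpow_mul ht0.le]
        refine Real.rpow_le_rpow_of_exponent_le (hT.trans ht) ?_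
        push_cast
        linarith
      have h3 := mul_le_mul_of_nonneg_left h2 (by positivity : 0 ≤ 2 * A ^ 2)
      have h4 := sq_nonneg (δ - A * t ^ (-(m + 1 / 4)))
      linarith
    · have ht0 : 0 < t := hT0.trans_le ht
      have h1 : ∀ j, ‖f j t - g j t‖ ^ 2 ≤ 4 * ρ ^ 2 * t ^ (-(2 * m + 1)) := by
        intro j
        have h2 : ‖f j t - g j t‖ ≤ 2 * ρ * t ^ (-(m + 1 / 2)) := by
          have := norm_sub_le (f j t - ψ j) (g j t - ψ j)
          rw [sub_sub_sub_cancel_right] at this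
          linarith [(hf j t ht).1, (hg j t ht).1]
        refine (pow_le_pow_left₀ (norm_nonneg _) h2 2).trans (le_of_eq ?_)
        rw [mul_pow, mul_pow, ← Real.rpow_natCast (t ^ (-(m + 1 / 2))), ← Real.rpow_mul ht0.le]
        congr 1
        · norm_num
        · congr 1
          push_cast
          ring
      have h3 : t ^ (2 * m) * t ^ (-(2 * m + 1)) = t⁻¹ := by
        rw [← Real.rpow_add ht0, ← Real.rpow_neg_one]
        congr 1
        ring
      have h4 := Real.rpow_nonneg ht0.le (2 * m)
      calc _ ≤ t ^ (2 * m) * (4 * ρ ^ 2 * t ^ (-(2 * m + 1)) + 4 * ρ ^ 2 * t ^ (-(2 * m + 1))) :=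
            mul_le_mul_of_nonneg_left (add_le_add (h1 0) (h1 1)) h4
        _ = 8 * ρ ^ 2 * (t ^ (2 * m) * t ^ (-(2 * m + 1))) := by ring
        _ = _ := by rw [h3]
  have h0 : ∀ x y : ℝ, x ^ 2 + y ^ 2 = 0 → x = 0 ∧ y = 0 := fun x y h =>
    ⟨by nlinarith [sq_nonneg x, sq_nonneg y], by nlinarith [sq_nonneg x, sq_nonneg y]⟩
  obtain ⟨h1, h2⟩ := h0 _ _ hzero
  rw [norm_eq_zero, sub_eq_zero] at h1 h2
  fin_cases j
  · exact h1
  · exact h2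

/-! ### The solution built from a profile -/

/-- The mean value inequality is applied to `f` and then to each modulated difference of `f`, giving
continuity in `H^{0,1}` without differentiating in that space. -/
theorem lipschitz_profile {f h : ℝ → L2} {C : ℝ}
    (hf : ∀ t, T ≤ t → HasDerivWithinAt f (-h t) (Ici T) t)
    (hh : ∀ t, T ≤ t → ‖h t‖ ≤ C ∧ LipW C (h t)) {s t : ℝ} (hs : T ≤ s) (ht : T ≤ t) :
    ‖f t - f s‖ ≤ C * |t - s| ∧ LipW (C * |t - s|) (f t - f s) := by
  constructor
  · exact (convex_Ici T).norm_image_sub_le_of_norm_hasDerivWithin_le hf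
      (fun t ht => by rw [norm_neg]; exact (hh t ht).1) hs ht
  · intro a
    have hder : ∀ t ∈ Ici T, HasDerivWithinAt (fun t => phase (modPhase a) (f t) - f t)
        (phase (modPhase a) (-h t) - -h t) (Ici T) t := by
      intro t ht
      refine HasDerivWithinAt.sub ?_ (hf t ht)
      exact (((phase (modPhase a)).toContinuousLinearMap).restrictScalars
        ℝ).hasFDerivAt.comp_hasDerivWithinAt t (hf t ht)
    have := (convex_Ici T).norm_image_sub_le_of_norm_hasDerivWithin_le hder (C := C * |a|)
      (fun t ht => by
        rw [map_neg, ← neg_sub', norm_neg]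
        exact (hh t ht).2 a) hs ht
    rw [map_sub, sub_sub_sub_comm]
    refine this.trans (le_of_eq ?_)
    rw [Real.norm_eq_abs]
    ring

theorem tendsto_rpow_neg_mul {β : ℝ} (hβ : 0 < β) (ρ : ℝ) :
    Tendsto (fun t : ℝ => ρ * t ^ (-β)) atTop (𝓝 0) := by
  simpa using (tendsto_rpow_neg_atTop hβ).const_mul ρ

theorem isFinalStateSolution_of_profile (hd : Datum m δ K L ψ) (hT : IsTime m δ K L ρ T)
    {f : Fin 2 → ℝ → L2} (hf : ∀ j t, T ≤ t → InBall m ρ t (f j t - ψ j))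
    (hf' : ∀ j t, T ≤ t → HasDerivWithinAt (f j) (-G t (f (1 - j) t) (f j t)) (Ici T) t) :
    IsFinalStateSolution m T ψ (fun j t => U t (f j t)) := by
  have hT1 := hT.one_le
  have hT0 : 0 < T := by linarith
  have hm := hd.m_pos
  have hρ := hT.pos
  have hpi := Real.pi_gt_three
  refine ⟨?_, ?_, ?_, ?_⟩
  · refine isSolution_of_hasDerivWithinAt hT0 (fun t ht => ⟨2 * δ, fun k => ?_⟩) hf'
    have := hd.bdd_of_inBall hT ht k (hf k t ht)
    rwa [add_sub_cancel] at this
  · intro j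
    simp only [U_neg_U]
    have hrate : ∀ t, T ≤ t → ‖G t (f (1 - j) t) (f j t)‖ ≤ ρ * (m + 1 / 2) ∧
        LipW (ρ * (m + 1 / 2)) (G t (f (1 - j) t) (f j t)) := by
      intro t ht
      have h1 := hd.rate hT ht j (r := fun k => f k t - ψ k) (fun k => hf k t ht)
      simp only [add_sub_cancel] at h1
      have h2 : ∀ β : ℝ, 0 < β → t ^ (-(1 + β)) ≤ 1 := fun β hβ =>
        Real.rpow_le_one_of_one_le_of_nonpos (hT1.trans ht) (by linarith)
      refine ⟨h1.1.trans (mul_le_of_le_one_right (by positivity) (h2 _ (by linarith))),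
        h1.2.mono ((mul_le_of_le_one_right (by positivity) (h2 _ hm)).trans ?_)⟩
      gcongr
      linarith
    refine ⟨fun t ht => ?_, fun t ht => ?_⟩
    · have h1 := (hd.lip j).add (hf j t ht).2
      rw [add_sub_cancel] at h1
      exact memH0_one_of_lipW h1
    · set C := ρ * (m + 1 / 2) with hC
      have hlim : Tendsto (fun τ : ℝ => ENNReal.ofReal (C * |τ - t| + C * |τ - t| / (2 * Real.pi)))
          (𝓝[Ici T] t) (𝓝 0) := by
        have hc : Continuous fun τ : ℝ =>
            ENNReal.ofReal (C * |τ - t| + C * |τ - t| / (2 * Real.pi)) :=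
          ENNReal.continuous_ofReal.comp (by fun_prop)
        have := (hc.tendsto t).mono_left (nhdsWithin_le_nhds (s := Ici T))
        simpa using this
      refine tendsto_of_tendsto_of_tendsto_of_le_of_le' tendsto_const_nhds hlim
        (Eventually.of_forall fun _ => zero_le) ?_
      filter_upwards [self_mem_nhdsWithin] with τ hτ
      obtain ⟨h1, h2⟩ := lipschitz_profile (hf' j) hrate ht hτ
      exact (normH0_one_le h2).trans (ENNReal.ofReal_le_ofReal (by linarith))
  · intro j
    refine squeeze_zero' (Eventually.of_forall fun _ => norm_nonneg _) ?_
      (tendsto_rpow_neg_mul (β := m + 1 / 2) (by linarith) ρ)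
    filter_upwards [eventually_ge_atTop T] with t ht
    rw [← U_sub, norm_U]
    exact (hf j t ht).1
  · refine ⟨⟨2 * ρ, by positivity⟩, fun j t ht => ?_⟩
    have ht0 : 0 < t := hT0.trans_le ht
    obtain ⟨h1, h2⟩ := hf j t ht
    have hJ : normJ t (U t (f j t) - U t (ψ j)) ≤ ENNReal.ofReal (ρ * t ^ (-m)) := by
      rw [normJ, ← U_sub, U_neg_U]
      refine (eLpNorm_le_of_lipW h2).trans (ENNReal.ofReal_le_ofReal ?_)
      refine div_le_self h2.nonneg (by linarith)
    have e1 : t ^ (m + 1 / 2) * (ρ * t ^ (-(m + 1 / 2))) = ρ := by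
      rw [mul_left_comm, ← Real.rpow_add ht0, add_neg_cancel, Real.rpow_zero, mul_one]
    have e2 : t ^ m * (ρ * t ^ (-m)) = ρ := by
      rw [mul_left_comm, ← Real.rpow_add ht0, add_neg_cancel, Real.rpow_zero, mul_one]
    have i1 : ENNReal.ofReal (t ^ (m + 1 / 2) * ‖U t (f j t) - U t (ψ j)‖) ≤ ENNReal.ofReal ρ := by
      rw [← U_sub, norm_U]
      refine ENNReal.ofReal_le_ofReal (le_of_le_of_eq ?_ e1)
      exact mul_le_mul_of_nonneg_left h1 (Real.rpow_nonneg ht0.le _)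
    have i2 : ENNReal.ofReal (t ^ m) * normJ t (U t (f j t) - U t (ψ j)) ≤ ENNReal.ofReal ρ := by
      refine (mul_le_mul_right hJ _).trans (le_of_eq ?_)
      rw [← ENNReal.ofReal_mul (Real.rpow_nonneg ht0.le _), e2]
    refine (add_le_add i1 i2).trans (le_of_eq ?_)
    rw [← ENNReal.ofReal_add hρ.le hρ.le, ← two_mul]
    exact ENNReal.ofReal_eq_coe_nnreal _

/-- The profile of a final state solution. -/
theorem IsFinalStateSolution.profile (hd : Datum m δ K L ψ) (hT : 1 ≤ T)
    {v : Fin 2 → ℝ → L2} (hv : IsFinalStateSolution m T ψ v) :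
    ∃ ρ' : ℝ, 0 ≤ ρ' ∧ (∀ j t, T ≤ t → InBall m ρ' t (U (-t) (v j t) - ψ j)) ∧
      ∀ j t, T ≤ t → HasDerivWithinAt (fun t => U (-t) (v j t))
        (-G t (U (-t) (v (1 - j) t)) (U (-t) (v j t))) (Ici T) t := by
  have hT0 : 0 < T := by linarith
  have hm := hd.m_pos
  have hK := hd.nonneg
  have hpi := Real.pi_gt_three
  obtain ⟨C, hC⟩ := hv.decay
  -- The factor `2π` converts a bound on `‖x r‖` into a modulation constant; it only weakens the
  -- `L²` bound.
  set ρ' : ℝ := 2 * Real.pi * C with hρ'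
  have hρ0 : 0 ≤ ρ' := by positivity
  have hball : ∀ j t, T ≤ t → InBall m ρ' t (U (-t) (v j t) - ψ j) := by
    intro j t ht
    have ht0 : 0 < t := hT0.trans_le ht
    have h := hC j t ht
    have hr : U (-t) (v j t - U t (ψ j)) = U (-t) (v j t) - ψ j := by rw [U_sub, U_neg_U]
    have hn : ‖v j t - U t (ψ j)‖ = ‖U (-t) (v j t) - ψ j‖ := by rw [← hr, norm_U]
    have hCe : (C : ℝ≥0∞) = ENNReal.ofReal C := (ENNReal.ofReal_coe_nnreal).symm
    rw [hCe] at h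
    constructor
    · have h1 := (ENNReal.ofReal_le_ofReal_iff C.2).1 (le_self_add.trans h)
      rw [hn] at h1
      have h2 := mul_le_mul_of_nonneg_left h1 (Real.rpow_nonneg ht0.le (-(m + 1 / 2)))
      rw [← mul_assoc, ← Real.rpow_add ht0, neg_add_cancel, Real.rpow_zero, one_mul] at h2
      refine h2.trans ?_
      rw [mul_comm]
      refine mul_le_mul_of_nonneg_right ?_ (Real.rpow_nonneg ht0.le _)
      have : (0 : ℝ) ≤ C := C.2
      exact le_mul_of_one_le_left this (by linarith)
    · have h1 := le_add_self.trans h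
      have h2 := mul_le_mul_right h1 (ENNReal.ofReal (t ^ (-m)))
      rw [← mul_assoc, ← ENNReal.ofReal_mul (Real.rpow_nonneg ht0.le _), ← Real.rpow_add ht0,
        neg_add_cancel, Real.rpow_zero, ENNReal.ofReal_one, one_mul,
        ← ENNReal.ofReal_mul (Real.rpow_nonneg ht0.le _), normJ, hr] at h2
      have hC0 : (0 : ℝ) ≤ C := C.2
      refine (lipW_of_eLpNorm_le (by positivity) h2).mono (le_of_eq ?_)
      rw [hρ']
      ring
  refine ⟨ρ', hρ0, hball, ?_⟩
  have hcont : ∀ j, ContinuousOn (fun t => U (-t) (v j t)) (Ici T) := by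
    intro j t ht
    have h1 := (hv.cont j).2 t ht
    rw [ContinuousWithinAt, tendsto_iff_norm_sub_tendsto_zero]
    have h2 : Tendsto (fun τ => ENNReal.ofReal ‖U (-τ) (v j τ) - U (-t) (v j t)‖) (𝓝[Ici T] t)
        (𝓝 0) :=
      tendsto_of_tendsto_of_tendsto_of_le_of_le tendsto_const_nhds h1 (fun _ => zero_le)
        fun τ => enorm_le_normH0 zero_le_one _
    have h3 := (ENNReal.tendsto_toReal ENNReal.zero_ne_top).comp h2
    simpa [Function.comp_def] using h3
  have hb : ∀ t, T ≤ t → ∀ j, Bdd (δ + 4 * (K + ρ')) (E t (U (-t) (v j t))) := by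
    intro t ht j
    have h1 := hd.bdd_E j (hT.trans ht) (hball j t ht).1 (hball j t ht).2
    rw [add_sub_cancel] at h1
    refine h1.mono ?_
    have h2 : t ^ (-(m + 1 / 4)) ≤ 1 :=
      Real.rpow_le_one_of_one_le_of_nonpos (hT.trans ht) (by linarith)
    have h3 := mul_le_of_le_one_right (by positivity : 0 ≤ 4 * (K + ρ')) h2
    linarith
  have hvU : ∀ j t, v j t = U t (U (-t) (v j t)) := fun j t => (U_U_neg _ _).symm
  intro j t ht
  refine hasDerivWithinAt_of_isSolution (f := fun j t => U (-t) (v j t))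
    (g := fun j t => G t (U (-t) (v (1 - j) t)) (U (-t) (v j t))) hv.solution hvU hcont ?_ ?_ j ht
  · intro j t ht
    refine tendsto_G (hT0.trans_le ht) (tendsto_id.mono_left nhdsWithin_le_nhds)
      (hcont (1 - j) t ht) (hcont j t ht) ?_ (hb t ht _) (hb t ht _)
    filter_upwards [self_mem_nhdsWithin] with τ hτ using hb τ hτ _
  · intro j t ht
    have h1 := N_U_ae_eq (hT0.trans_le ht) (fun k => U (-t) (v k t)) j (hb t ht _)
    simpa only [U_U_neg] using h1

end

/-! ### The data of the theorem -/

/-- The dilation by `2π` preserves null sets, which carries hypotheses on `hat` over to `𝓕`. -/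
theorem ae_of_ae_hat {p : ℝ → Prop} (h : ∀ᵐ ξ : ℝ, p (ξ / (2 * Real.pi))) : ∀ᵐ η, p η := by
  have hne : 2 * Real.pi ≠ 0 := by positivity
  filter_upwards [(quasiMeasurePreserving_mul hne).ae h] with η hη
  rwa [mul_div_cancel_left₀ _ hne] at hη

theorem bdd_of_hat {ψ : L2} {δ₀ : ℝ} (hδ : 0 ≤ δ₀)
    (h : eLpNorm (hat ψ) ∞ volume ≤ ENNReal.ofReal δ₀) :
    Bdd (Real.sqrt (2 * Real.pi) * δ₀) (𝓕 ψ : L2) := by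
  have hpos : 0 < Real.sqrt (2 * Real.pi) := by positivity
  refine ae_of_ae_hat (p := fun η => ‖(𝓕 ψ : L2) η‖ ≤ Real.sqrt (2 * Real.pi) * δ₀) ?_
  rw [eLpNorm_exponent_top] at h
  filter_upwards [ae_le_eLpNormEssSup (f := hat ψ) (μ := volume)] with ξ hξ
  have h1 := hξ.trans h
  rw [← ofReal_norm, ENNReal.ofReal_le_ofReal_iff hδ, hat, norm_mul, Complex.norm_real, norm_inv,
    Real.norm_of_nonneg hpos.le, inv_mul_le_iff₀ hpos] at h1
  exact h1

theorem ae_mul_eq_zero_of_hat {ψ φ : L2} (h : ∀ᵐ ξ : ℝ, hat ψ ξ * hat φ ξ = 0) :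
    ∀ᵐ η, (𝓕 ψ : L2) η * (𝓕 φ : L2) η = 0 := by
  have hpos : Real.sqrt (2 * Real.pi) ≠ 0 := by positivity
  refine ae_of_ae_hat (p := fun η => (𝓕 ψ : L2) η * (𝓕 φ : L2) η = 0) ?_
  filter_upwards [h] with ξ hξ
  rw [hat, hat, mul_mul_mul_comm] at hξ
  refine (mul_eq_zero.1 hξ).resolve_left (mul_ne_zero ?_ ?_) <;>
    exact Complex.ofReal_ne_zero.2 (inv_ne_zero hpos)

theorem exists_datum {s m δ₀ : ℝ} (hm : 0 < m) (hm2 : m ≤ 1 / 2) (hs : 2 * m + 1 ≤ s)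
    (hδ : 0 ≤ δ₀) {ψ : Fin 2 → L2} (hψ : ∀ j, MemH0 s (ψ j))
    (hb : ∀ j, eLpNorm (hat (ψ j)) ∞ volume ≤ ENNReal.ofReal δ₀)
    (h0 : ∀ᵐ ξ : ℝ, hat (ψ 0) ξ * hat (ψ 1) ξ = 0) :
    ∃ K L, Datum m (Real.sqrt (2 * Real.pi) * δ₀) K L ψ := by
  choose K hK0 hK using fun j => exists_chirp_bound hm hm2 hs (hψ j)
  choose L hL using fun j => exists_lipW_of_memH0 (by linarith) (hψ j)
  have hKle : ∀ j, K j ≤ K 0 + K 1 := by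
    intro j
    fin_cases j
    · simpa using hK0 1
    · simpa using hK0 0
  have hLle : ∀ j, L j ≤ max (L 0) (L 1) := by
    intro j
    fin_cases j
    · exact le_max_left _ _
    · exact le_max_right _ _
  refine ⟨K 0 + K 1, max (L 0) (L 1), hm, fun j => bdd_of_hat hδ (hb j), fun j => ?_,
    fun j => (hL j).mono (hLle j), add_nonneg (hK0 0) (hK0 1), fun j t ht => ?_⟩
  · have h1 := ae_mul_eq_zero_of_hat h0
    fin_cases j
    · filter_upwards [h1] with ξ hξ
      rw [mul_comm]
      exact hξ
    · exact h1
  · have ht0 : 0 < t := by linarith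
    obtain ⟨h1, h2⟩ := hK j t ht
    exact InBall.mono ⟨h1, h2⟩ (hKle j) ht0

end NLSFinal

end

theorem propositionB2 (s μ : ℝ) (hs : 1 < s) (hμ : 0 < μ) (hμs : μ < (min 2 s - 1) / 2) :
    ∃ δ₀ : ℝ, 0 < δ₀ ∧ ∀ ψ : Fin 2 → NLSFinal.L2,
      (∀ j, NLSFinal.MemH0 s (ψ j)) →
      (∀ j, MemLp (NLSFinal.hat (ψ j)) ∞ volume) →
      (∀ j, eLpNorm (NLSFinal.hat (ψ j)) ∞ volume ≤ ENNReal.ofReal δ₀) →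
      (∀ᵐ ξ : ℝ, NLSFinal.hat (ψ 0) ξ * NLSFinal.hat (ψ 1) ξ = 0) →
      ∃ T : ℝ, 1 ≤ T ∧ ∃ u : Fin 2 → ℝ → NLSFinal.L2,
        NLSFinal.IsFinalStateSolution μ T ψ u ∧
        ∀ v : Fin 2 → ℝ → NLSFinal.L2, NLSFinal.IsFinalStateSolution μ T ψ v →
          ∀ j, ∀ t, T ≤ t → v j t = u j t := by
  open NLSFinal in
  have hμ2 : μ ≤ 1 / 2 := by linarith [min_le_left 2 s]
  have hμs' : 2 * μ + 1 ≤ s := by linarith [min_le_right 2 s]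
  have hpos : 0 < Real.sqrt (2 * Real.pi) := by positivity
  -- Chosen so that `(2δ)² = μ/4`, the smallness used by the contraction; the `δ² ≤ μ` of the
  -- uniqueness argument follows. Dividing by `√(2π)` below passes from `𝓕` to `hat`.
  set δ := Real.sqrt μ / 4 with hδdef
  have hδ : 0 < δ := by positivity
  have hδsq : δ ^ 2 = μ / 16 := by
    rw [hδdef, div_pow, Real.sq_sqrt hμ.le]
    norm_num
  refine ⟨δ / Real.sqrt (2 * Real.pi), by positivity, fun ψ hψ _ hb h0 => ?_⟩
  obtain ⟨K, L, hd⟩ := exists_datum hμ hμ2 hμs' (by positivity) hψ hb h0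
  rw [mul_div_cancel₀ _ hpos.ne'] at hd
  have hρ : 0 < K + 1 := by linarith [hd.nonneg]
  obtain ⟨T, hT1, hTt⟩ := exists_time hμ hρ hδ (hd.lip 0).nonneg
  have hT : IsTime μ δ K L (K + 1) T :=
    ⟨hT1, hρ, by linarith, hδ, by rw [mul_pow, hδsq]; linarith, fun t ht => (hTt t ht).1,
      fun t ht => (hTt t ht).2⟩
  obtain ⟨f, hf, hf'⟩ := exists_profile hd hT
  refine ⟨T, hT1, fun j t => U t (f j t), isFinalStateSolution_of_profile hd hT hf hf',
    fun v hv j t ht => ?_⟩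
  obtain ⟨ρ', hρ0, hg, hg'⟩ := hv.profile hd hT1
  have h0t : ∀ t, T ≤ t → 0 < t := fun t ht => by linarith
  -- The competitor's radius `ρ'` is not controlled by the data, so the two profiles are compared in
  -- the larger of the two balls.
  have := profile_unique hd hT1 (hρ0.trans (le_max_right (K + 1) ρ'))
    (by rw [hδsq]; linarith)
    (fun j t ht => (hf j t ht).mono (le_max_left _ _) (h0t t ht))
    (fun j t ht => (hg j t ht).mono (le_max_right _ _) (h0t t ht)) hf' hg' j ht
  change v j t = U t (f j t)
  rw [this, U_U_neg]
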